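/- **Theorem.** All homology is with integer coefficients. Let $K\subset\mathbb{R}^n$ be a closed (compact, boundaryless) smooth submanifold. Its reach $\nu\in(0,\infty]$ is the supremum of all $\alpha>0$ such that the normal bundle of $K$ of radius $\alpha$ is embedded in $\mathbb{R}^n$ by $(y,v)\mapsto y+v$. Let $\varepsilon>0$ and let $P\subset\mathbb{R}^n$ be an $\varepsilon$-sample of $K$, i.e. a finite set at Hausdorff distance less than $\varepsilon$ from $K$. Put $t=0$ if $P\subseteq K$ (noise-free case) and $t=1$ otherwise. Let $p\in P$, and let $x\in K$ be the point of $K$ closest to $p$ if $P\subseteq K$, and any point of $K$ with $\|x-p\|<\varepsilon$ otherwise. For $Q\subseteq P$ and $a>0$ let $\mathcal{C}_a(Q)$ be the Čech complex, whose simplices are the nonempty finite $\sigma\subseteq Q$ such that the closed balls of radius $a$ about the points of $\sigma$ have a common point, and let $\mathcal{R}_a(Q)$ be the Vietoris–Rips complex, whose simplices are the nonempty finite $\sigma\subseteq Q$ all of whose edges lie in $\mathcal{C}_a(Q)$. With $B_b(p)$ the open ball of radius $b$ about $p$, put $$C(a,b)=H_*\big(\mathcal{C}_a(P),\mathcal{C}_a(P\setminus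 B_b(p))\big),\qquad V(a,b)=H_*\big(\mathcal{R}_a(P),\mathcal{R}_a(P\setminus B_b(p))\big).$$ For $c\in\{1,\sqrt2\}$ let $$\beta=c^2+(t+1)c+t,\qquad \gamma=c^2+(t+3)c+5t+2,$$ and call $(R,r)$ $c$-admissible if $\varepsilon<\dfrac{2\nu}{2\beta+\gamma}$, $$R\in\big((\beta+\gamma-t-1)\varepsilon,\ 2\nu-(\beta+t+1)\varepsilon\big)\quad\text{and}\quad r\in\big(2\beta\varepsilon,\ R-(\gamma-\beta)\varepsilon\big).$$ Then the images of the homomorphisms induced by inclusion satisfy, in every homological degree, $$\operatorname{im}\big(C(\varepsilon,R)\to C((2+t)\varepsilon,r)\big)\cong H_*(K,K\setminus\{x\})\quad\text{if }(R,r)\text{ is }1\text{-admissible},$$ $$\operatorname{im}\big(V(\varepsilon,R)\to V((1+\sqrt2+t)\varepsilon,r)\big)\cong H_*(K,K\setminus\{x\})\quad\text{if }(R,r)\text{ is }\sqrt2\text{-admissible}.$$ -/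

import Mathlib

open CategoryTheory CategoryTheory.Limits
open scoped ContDiff ENNReal NNReal

noncomputable section

namespace LocalHomology

/-! ### Relative homology with integer coefficients -/

/-- Chain complexes of abelian groups (as `ℤ`-modules), in degrees `ℓ ≥ 0`. -/
abbrev Chains := ChainComplex (ModuleCat.{0} ℤ) ℕ

/-- The homology `H_ℓ(D / C)` of the cokernel of a chain map `φ : C ⟶ D`. It is used for the
inclusion of the chains of a subobject into the chains of the whole object, so that `D / C` is the
relative chain complex. -/
def relativeHomology {C D : Chains} (φ : C ⟶ D) (ℓ : ℕ) : ModuleCat.{0} ℤ :=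
  (cokernel φ).homology ℓ

/-- The map in relative homology induced by a commutative square of chain maps. -/
def relativeHomologyMap {C D C' D' : Chains} {φ : C ⟶ D} {φ' : C' ⟶ D'}
    (f : C ⟶ C') (g : D ⟶ D') (w : φ ≫ g = f ≫ φ') (ℓ : ℕ) :
    relativeHomology φ ℓ ⟶ relativeHomology φ' ℓ :=
  HomologicalComplex.homologyMap (cokernel.map φ φ' f g w) ℓ

/-- The relative singular homology `H_ℓ(X, A)` of a topological space `X` and a subset `A`. -/
def relativeSingularHomology (X : Type) [TopologicalSpace X] (A : Set X) (ℓ : ℕ) :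
    ModuleCat.{0} ℤ :=
  relativeHomology
    (((AlgebraicTopology.singularChainComplexFunctor (ModuleCat.{0} ℤ)).obj
      (ModuleCat.of ℤ ℤ)).map (TopPair.ofSubset (X := TopCat.of X) A).map) ℓ

/-! ### Homology of pairs of abstract simplicial complexes -/

section Simplicial

variable {V : Type}

/-- The simplicial set of ordered simplices of an abstract simplicial complex `L`: its
`m`-simplices are all the tuples `(v₀, …, v_m)`, repetitions allowed, such that `{v₀, …, v_m}` is a
simplex of `L`. Its chain complex is the ordered chain complex of `L`, which computes the simplicial
homology of `L`. -/
def orderedSimplices (L : PreAbstractSimplicialComplex V) : SSet.{0} where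
  obj Δ := {v : Fin (Δ.unop.len + 1) → V // (Set.finite_range v).toFinset ∈ L.faces}
  map θ := ↾fun v => ⟨v.1 ∘ θ.unop.toOrderHom,
    (L.isRelLowerSet_faces v.2).2
      (by
        intro a ha
        simp only [Set.Finite.mem_toFinset] at ha ⊢
        exact Set.range_comp_subset_range _ _ ha)
      ⟨v.1 (θ.unop.toOrderHom 0), by simp⟩⟩

/-- The inclusion of ordered simplices for a subcomplex `L` of `L'`. -/
def orderedInclusion {L L' : PreAbstractSimplicialComplex V} (h : L ≤ L') :
    orderedSimplices L ⟶ orderedSimplices L' where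
  app _ := ↾fun v => ⟨v.1, h v.2⟩

/-- The ordered chain complex of an abstract simplicial complex, with integer coefficients. -/
abbrev orderedChains (L : PreAbstractSimplicialComplex V) : Chains :=
  (orderedSimplices L).chainComplex (ModuleCat.of ℤ ℤ)

/-- The inclusion of ordered chain complexes for a subcomplex `L` of `L'`. -/
abbrev orderedChainsMap {L L' : PreAbstractSimplicialComplex V} (h : L ≤ L') :
    orderedChains L ⟶ orderedChains L' :=
  SSet.chainComplexMap (orderedInclusion h) (ModuleCat.of ℤ ℤ)

/-- A pair of abstract simplicial complexes: a complex `total` with a subcomplex `sub`. -/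
structure ComplexPair (V : Type) where
  total : PreAbstractSimplicialComplex V
  sub : PreAbstractSimplicialComplex V
  sub_le : sub ≤ total

/-- Inclusion of pairs of complexes. -/
instance : LE (ComplexPair V) where
  le S T := S.total ≤ T.total ∧ S.sub ≤ T.sub

/-- The relative simplicial homology `H_ℓ(S.total, S.sub)`. -/
def ComplexPair.homology (S : ComplexPair V) (ℓ : ℕ) : ModuleCat.{0} ℤ :=
  relativeHomology (orderedChainsMap S.sub_le) ℓ

/-- The map in relative simplicial homology induced by an inclusion of pairs. -/
def ComplexPair.homologyMap {S T : ComplexPair V} (h : S ≤ T) (ℓ : ℕ) :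
    S.homology ℓ ⟶ T.homology ℓ :=
  relativeHomologyMap (orderedChainsMap h.2) (orderedChainsMap h.1)
    (by rw [← Functor.map_comp, ← Functor.map_comp]; rfl) ℓ

end Simplicial

/-! ### Čech and Vietoris–Rips complexes -/

section Complexes

variable {X : Type} [MetricSpace X]

/-- The Čech complex of `P` at scale `α`: nonempty finite sets of points of `P` whose closed balls of
radius `α` have a common point. -/
def cechComplex (P : Set X) (α : ℝ) : PreAbstractSimplicialComplex X where
  faces := {σ | σ.Nonempty ∧ (σ : Set X) ⊆ P ∧ (⋂ x ∈ σ, Metric.closedBall x α).Nonempty}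
  isRelLowerSet_faces := by
    rintro σ ⟨hne, hP, y, hy⟩
    refine ⟨hne, fun τ hτ hτne => ⟨hτne, fun a ha => hP (hτ ha), y, ?_⟩⟩
    simp only [Set.mem_iInter] at hy ⊢
    exact fun a ha => hy a (hτ ha)

/-- The Vietoris–Rips complex of `P` at scale `α`: nonempty finite sets of points of `P` all of whose
edges belong to the Čech complex of `P` at scale `α`. -/
def ripsComplex (P : Set X) (α : ℝ) : PreAbstractSimplicialComplex X where
  faces := {σ | σ.Nonempty ∧ (σ : Set X) ⊆ P ∧
    ∀ e ⊆ σ, e.card = 2 → e ∈ (cechComplex P α).faces}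
  isRelLowerSet_faces := by
    rintro σ ⟨hne, hP, he⟩
    exact ⟨hne, fun τ hτ hτne => ⟨hτne, fun a ha => hP (hτ ha), fun e h => he e (h.trans hτ)⟩⟩

theorem cechComplex_mono {P Q : Set X} (h : Q ⊆ P) (α : ℝ) : cechComplex Q α ≤ cechComplex P α :=
  fun _ hσ => ⟨hσ.1, hσ.2.1.trans h, hσ.2.2⟩

theorem ripsComplex_mono {P Q : Set X} (h : Q ⊆ P) (α : ℝ) : ripsComplex Q α ≤ ripsComplex P α :=
  fun _ hσ => ⟨hσ.1, hσ.2.1.trans h, fun e he hc => cechComplex_mono h α (hσ.2.2 e he hc)⟩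

/-- The pair of Čech complexes over `P` and over `P - B_b(p)` at scale `a`;
its homology is `C(a, b)`. -/
def cechPair (P : Set X) (p : X) (a b : ℝ) : ComplexPair X where
  total := cechComplex P a
  sub := cechComplex (P \ Metric.ball p b) a
  sub_le := cechComplex_mono Set.sdiff_subset a

/-- The pair of Vietoris–Rips complexes over `P` and over `P - B_b(p)` at scale `a`;
its homology is `V(a, b)`. -/
def ripsPair (P : Set X) (p : X) (a b : ℝ) : ComplexPair X where
  total := ripsComplex P a
  sub := ripsComplex (P \ Metric.ball p b) a
  sub_le := ripsComplex_mono Set.sdiff_subset a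

/-- `P` is a (possibly noisy) `ε`-sample of `K`: a finite set at Hausdorff distance less than `ε`. -/
structure IsSample (K P : Set X) (ε : ℝ) : Prop where
  pos : 0 < ε
  finite : P.Finite
  dist_lt : Metric.hausdorffEDist K P < ENNReal.ofReal ε

open Classical in
/-- The constant `t`: it is `0` if the sample is noise-free and `1` otherwise. -/
def noise (K P : Set X) : ℝ := if P ⊆ K then 0 else 1

/-- The points of `K` allowed for `p`: a closest point of `K` to `p` if the sample is
noise-free, and any point of `K` with `d(x, p) < ε` otherwise. -/
def IsBasePoint (K P : Set X) (ε : ℝ) (p x : X) : Prop :=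
  x ∈ K ∧ (P ⊆ K → ∀ y ∈ K, dist x p ≤ dist y p) ∧ (¬ P ⊆ K → dist x p < ε)

end Complexes

/-! ### Submanifolds of Euclidean space and their reach -/

section Submanifold

variable {E : Type} [NormedAddCommGroup E] [InnerProductSpace ℝ E]

/-- `K` is a closed (that is, compact and boundaryless) smooth submanifold of `E`: it is compact, and
near each of its points a smooth diffeomorphism between open subsets of `E` carries it to a linear
subspace of `E`. The submanifold need not be connected, and its components may differ in
dimension. -/
structure IsClosedSubmanifold (K : Set E) : Prop where
  isCompact : IsCompact K
  locally_flat : ∀ x ∈ K, ∃ (φ : OpenPartialHomeomorph E E) (W : Submodule ℝ E), x ∈ φ.source ∧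
    ContDiffOn ℝ ∞ φ φ.source ∧ ContDiffOn ℝ ∞ φ.symm φ.target ∧
    φ '' (φ.source ∩ K) = φ.target ∩ W

/-- The normal space of `K` at `x`: the orthogonal complement of the tangent space. -/
def normalSpace (K : Set E) (x : E) : Submodule ℝ E :=
  (Submodule.span ℝ (tangentConeAt ℝ K x))ᗮ

/-- The normal (disc) bundle of `K` of radius `α`: pairs of a point of `K` and a normal vector there,
of length less than `α`. -/
def normalBundle (K : Set E) (α : ℝ) : Set (E × E) :=
  {q | q.1 ∈ K ∧ q.2 ∈ normalSpace K q.1 ∧ ‖q.2‖ < α}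

/-- The reach of a submanifold: the supremum of all `α > 0` such that the normal bundle of radius `α`
is embedded in `E` by `(x, v) ↦ x + v`. It is `∞` for a single point. Taking discs of length at most
`α`, or asking for a smooth embedding, gives the same supremum for a closed smooth submanifold. -/
def reach (K : Set E) : ℝ≥0∞ :=
  ⨆ (α : ℝ≥0) (_ : 0 < α ∧
    Topology.IsEmbedding (fun q : normalBundle K (α : ℝ) => q.1.1 + q.1.2)), (α : ℝ≥0∞)

end Submanifold

/-! ### The constants and the admissible scales -/

/-- `β = c² + (t + 1)c + t`. -/
def betaConst (c t : ℝ) : ℝ := c ^ 2 + (t + 1) * c + t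

/-- `γ = c² + (t + 3)c + 5t + 2`. -/
def gammaConst (c t : ℝ) : ℝ := c ^ 2 + (t + 3) * c + 5 * t + 2

/-- The admissible scales: `ε < 2ν / (2β + γ)`, `R ∈ ((β + γ - t - 1)ε, 2ν - (β + t + 1)ε)` and
`r ∈ (2βε, R - (γ - β)ε)`. The extended real `ν` may be infinite. -/
structure AdmissibleScales (ν : ℝ≥0∞) (c t ε R r : ℝ) : Prop where
  eps_lt : ENNReal.ofReal ε < 2 * ν / ENNReal.ofReal (2 * betaConst c t + gammaConst c t)
  lt_R : (betaConst c t + gammaConst c t - t - 1) * ε < R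
  R_lt : ENNReal.ofReal R < 2 * ν - ENNReal.ofReal ((betaConst c t + t + 1) * ε)
  lt_r : 2 * betaConst c t * ε < r
  r_lt : r < R - (gammaConst c t - betaConst c t) * ε

end LocalHomology

end

open CategoryTheory CategoryTheory.Limits
open scoped ContDiff ENNReal NNReal

noncomputable section

namespace LocalHomology

/-! ### Augmented face systems and relative homology of pairs

Simplices are indexed by their number of vertices, so that there is an empty simplex in degree `0`.
A subobject containing the empty simplex has the same relative homology with or without
augmentation. -/

/-! Write `A_s` for the points of `K` at distance at least `s` from `x`. Fix a radius `α`, below or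
equal to the reach and large enough for the given scales, such that the nearest point projection `π`
to `K` is continuous on the open `α`-tube, nearest points there are unique, and `π` is constant
along normal segments shorter than `α`.

Local homology is visible at every radius: for `0 < s < 2α` the groups `H(K, A_s)` and `H(K, K ∖
{x})` agree (`IsTube.away_bijective`). Stretching `K` linearly from `x` and projecting back by `π`
never decreases the distance to `x`. It strictly increases it at every `y ≠ x` with `dist y x < 2α`:
otherwise `y` is the nearest point of its stretched image, so the segment from `y` to `x` is normal
to `K` at `y` and the midpoint of `x` and `y` has two nearest points. By compactness, iteration
carries every chain of `K ∖ {x}` into `A_s`.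

There are two comparison maps. A small singular simplex of `K` goes to the sample points nearest to
its vertices (`vertexHom`), and a simplex of the sample goes to the projection of its affine span
(`projHom`). The composite on `K` is homologous to the identity by a projected straight-line
homotopy (`pushChain_vertexMap_sub_mem`). The composite on the sample is, after subdivision,
contiguous to the inclusion of the small scale in the large one (`exists_vertexMap_sub_mem`). Every
step costs a controlled part of the radius.

These facts are interleaved in `IsSetting.nonempty_range_equiv` at radii `s₃ < s₂ ≤ s₁`. The vertex
map `g` from `H(K, A_{s₂})` to the sample at scale `(a, r)` is injective because projecting back to
radius `s₃` undoes it. Its image is that of the inclusion from `(ε, R)`: classes at radius `s₂` lift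
to radius `s₁` and so pass through `(ε, R)`, and conversely cycles at `(ε, R)` come from `K` at
radius `s₂`. So the image is `H(K, A_{s₂})`, the local homology.

The Čech and Rips cases differ only in the constant of `IsScaleFamily`: a point in the hull of a
simplex at scale `a` lies within `c * a` of a vertex, with `c = 1` or `c = √2`. All the work is done
with explicit chains, and `PairModel` transfers the result to categorical homology. -/

/-- A graded family of simplices with face maps; `simplex k` consists of simplices with `k`
vertices. -/
structure FaceSystem where
  simplex : ℕ → Type
  face : ∀ {k : ℕ}, Fin (k + 1) → simplex (k + 1) → simplex k

namespace FaceSystem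

/-- Integral chains. -/
abbrev Chain (X : FaceSystem) (k : ℕ) : Type := X.simplex k →₀ ℤ

/-- The alternating sum of the faces. -/
def boundary (X : FaceSystem) (k : ℕ) : X.Chain (k + 1) →ₗ[ℤ] X.Chain k :=
  Finsupp.linearCombination ℤ
    (fun σ => ∑ i : Fin (k + 1), (-1 : ℤ) ^ (i : ℕ) • Finsupp.single (X.face i σ) (1 : ℤ))

theorem boundary_single (X : FaceSystem) {k : ℕ} (σ : X.simplex (k + 1)) :
    X.boundary k (Finsupp.single σ 1) =
      ∑ i : Fin (k + 1), (-1 : ℤ) ^ (i : ℕ) • Finsupp.single (X.face i σ) (1 : ℤ) := by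
  simp [boundary]

theorem boundary_lmapDomain {X Y : FaceSystem} (φ : ∀ k, X.simplex k → Y.simplex k)
    (hφ : ∀ k (i : Fin (k + 1)) σ, φ k (X.face i σ) = Y.face i (φ (k + 1) σ)) (k : ℕ)
    (z : X.Chain (k + 1)) : Y.boundary k (Finsupp.lmapDomain ℤ ℤ (φ (k + 1)) z) =
      Finsupp.lmapDomain ℤ ℤ (φ k) (X.boundary k z) := by
  have : Y.boundary k ∘ₗ Finsupp.lmapDomain ℤ ℤ (φ (k + 1)) =
      Finsupp.lmapDomain ℤ ℤ (φ k) ∘ₗ X.boundary k := by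
    ext σ : 2
    simp only [LinearMap.comp_apply, Finsupp.lsingle_apply, Finsupp.lmapDomain_apply,
      Finsupp.mapDomain_single, boundary_single]
    rw [← Finsupp.lmapDomain_apply ℤ ℤ, map_sum]
    simp [hφ, Finsupp.mapDomain_single, -Finsupp.smul_single]
  exact LinearMap.congr_fun this z

end FaceSystem

/-- A linear map on chains sends chains supported on `s` into `N` as soon as it does so for single
simplices. -/
theorem map_mem_of_mem_supported {α : Type} {M : Type} [AddCommGroup M] (f : (α →₀ ℤ) →ₗ[ℤ] M)
    {s : Set α} {N : Submodule ℤ M} (h : ∀ a ∈ s, f (Finsupp.single a 1) ∈ N)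
    {z : α →₀ ℤ} (hz : z ∈ Finsupp.supported ℤ ℤ s) : f z ∈ N := by
  have : Finsupp.supported ℤ ℤ s ≤ N.comap f := by
    rw [Finsupp.supported_eq_span_single, Submodule.span_le]
    rintro _ ⟨a, ha, rfl⟩
    exact h a ha
  exact this hz

/-- Two linear maps which agree on simplices in `s` agree on chains supported on `s`. -/
theorem map_eq_of_mem_supported {α : Type} {M : Type} [AddCommGroup M] (f g : (α →₀ ℤ) →ₗ[ℤ] M)
    {s : Set α} (h : ∀ a ∈ s, f (Finsupp.single a 1) = g (Finsupp.single a 1))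
    {z : α →₀ ℤ} (hz : z ∈ Finsupp.supported ℤ ℤ s) : f z = g z := by
  have := map_mem_of_mem_supported (f - g) (N := ⊥) (s := s)
    (fun a ha => by simp [h a ha]) hz
  simpa [sub_eq_zero] using this

theorem single_mem_supported {α : Type} {s : Set α} {a : α} (h : a ∈ s) :
    Finsupp.single a (1 : ℤ) ∈ Finsupp.supported ℤ ℤ s :=
  Finsupp.single_mem_supported ℤ 1 h

theorem mapDomain_mem_supported {α β : Type} (f : α → β) {s : Set α} {t : Set β}
    (h : ∀ a ∈ s, f a ∈ t) {z : α →₀ ℤ} (hz : z ∈ Finsupp.supported ℤ ℤ s) :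
    Finsupp.lmapDomain ℤ ℤ f z ∈ Finsupp.supported ℤ ℤ t :=
  map_mem_of_mem_supported _ (fun a ha => by simpa using single_mem_supported (h a ha)) hz

/-- A pair of graded sets of simplices. -/
structure FaceSystem.Pair (X : FaceSystem) where
  total : ∀ k, Set (X.simplex k)
  sub : ∀ k, Set (X.simplex k)

namespace FaceSystem.Pair

variable {X Y : FaceSystem}

/-- Relative cycles. -/
def cycles (P : X.Pair) (ℓ : ℕ) : Submodule ℤ (X.Chain (ℓ + 1)) :=
  Finsupp.supported ℤ ℤ (P.total (ℓ + 1)) ⊓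
    (Finsupp.supported ℤ ℤ (P.sub ℓ)).comap (X.boundary ℓ)

/-- Relative boundaries. -/
def boundaries (P : X.Pair) (ℓ : ℕ) : Submodule ℤ (X.Chain (ℓ + 1)) :=
  Finsupp.supported ℤ ℤ (P.sub (ℓ + 1)) ⊔
    (Finsupp.supported ℤ ℤ (P.total (ℓ + 2))).map (X.boundary (ℓ + 1))

theorem mem_boundaries {P : X.Pair} {ℓ : ℕ} {z : X.Chain (ℓ + 1)} :
    z ∈ P.boundaries ℓ ↔ ∃ s ∈ Finsupp.supported ℤ ℤ (P.sub (ℓ + 1)),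
      ∃ y ∈ Finsupp.supported ℤ ℤ (P.total (ℓ + 2)), s + X.boundary (ℓ + 1) y = z := by
  simp [boundaries, Submodule.mem_sup]

/-- Relative homology of a pair. -/
abbrev Homology (P : X.Pair) (ℓ : ℕ) : Type :=
  P.cycles ℓ ⧸ (P.boundaries ℓ).submoduleOf (P.cycles ℓ)

/-- The class of a relative cycle. -/
def homologyMk (P : X.Pair) {ℓ : ℕ} (z : X.Chain (ℓ + 1)) (hz : z ∈ P.cycles ℓ) : P.Homology ℓ :=
  Submodule.Quotient.mk ⟨z, hz⟩

theorem exists_homologyMk {P : X.Pair} {ℓ : ℕ} (h : P.Homology ℓ) :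
    ∃ z hz, P.homologyMk (ℓ := ℓ) z hz = h := by
  obtain ⟨⟨z, hz⟩, rfl⟩ := Submodule.Quotient.mk_surjective _ h
  exact ⟨z, hz, rfl⟩

theorem homologyMk_eq {P : X.Pair} {ℓ : ℕ} {z z' : X.Chain (ℓ + 1)} {hz : z ∈ P.cycles ℓ}
    {hz' : z' ∈ P.cycles ℓ} : P.homologyMk z hz = P.homologyMk z' hz' ↔ z - z' ∈ P.boundaries ℓ := by
  rw [homologyMk, homologyMk, Submodule.Quotient.eq]
  rfl

theorem homologyMk_eq_zero {P : X.Pair} {ℓ : ℕ} {z : X.Chain (ℓ + 1)} {hz : z ∈ P.cycles ℓ} :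
    P.homologyMk z hz = 0 ↔ z ∈ P.boundaries ℓ := by
  rw [homologyMk, Submodule.Quotient.mk_eq_zero]
  rfl

/-- A chain map of pairs. -/
structure Hom (P : X.Pair) (Q : Y.Pair) where
  toFun : ∀ k, X.Chain k →ₗ[ℤ] Y.Chain k
  comm : ∀ k z, Y.boundary k (toFun (k + 1) z) = toFun k (X.boundary k z)
  total : ∀ k, ∀ σ ∈ P.total k,
    toFun k (Finsupp.single σ 1) ∈ Finsupp.supported ℤ ℤ (Q.total k)
  sub : ∀ k, ∀ σ ∈ P.sub k, toFun k (Finsupp.single σ 1) ∈ Finsupp.supported ℤ ℤ (Q.sub k)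

variable {P : X.Pair} {Q : Y.Pair}

theorem Hom.map_cycles (f : Hom P Q) {ℓ : ℕ} {z : X.Chain (ℓ + 1)} (hz : z ∈ P.cycles ℓ) :
    f.toFun (ℓ + 1) z ∈ Q.cycles ℓ := by
  refine ⟨map_mem_of_mem_supported _ (f.total _) hz.1, ?_⟩
  rw [SetLike.mem_coe, Submodule.mem_comap, f.comm]
  exact map_mem_of_mem_supported _ (f.sub _) hz.2

theorem Hom.map_boundaries (f : Hom P Q) {ℓ : ℕ} {z : X.Chain (ℓ + 1)} (hz : z ∈ P.boundaries ℓ) :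
    f.toFun (ℓ + 1) z ∈ Q.boundaries ℓ := by
  obtain ⟨s, hs, y, hy, rfl⟩ := mem_boundaries.1 hz
  refine mem_boundaries.2 ⟨_, map_mem_of_mem_supported _ (f.sub _) hs,
    _, map_mem_of_mem_supported _ (f.total _) hy, ?_⟩
  rw [map_add, f.comm]

/-- The map induced in homology. -/
def Hom.map (f : Hom P Q) (ℓ : ℕ) : P.Homology ℓ →ₗ[ℤ] Q.Homology ℓ :=
  Submodule.mapQ _ _ ((f.toFun (ℓ + 1)).restrict fun _ h => f.map_cycles h)
    fun _ h => f.map_boundaries h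

theorem Hom.map_mk (f : Hom P Q) {ℓ : ℕ} {z : X.Chain (ℓ + 1)} (hz : z ∈ P.cycles ℓ) :
    f.map ℓ (P.homologyMk z hz) = Q.homologyMk (f.toFun (ℓ + 1) z) (f.map_cycles hz) := rfl

/-- The inclusion of a pair in a larger pair. -/
def Hom.ofLE {P P' : X.Pair} (ht : ∀ k, P.total k ⊆ P'.total k) (hs : ∀ k, P.sub k ⊆ P'.sub k) :
    Hom P P' where
  toFun _ := LinearMap.id
  comm _ _ := rfl
  total k _ h := single_mem_supported (ht k h)
  sub k _ h := single_mem_supported (hs k h)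

/-- The chain map induced by a map of simplices which commutes with faces. -/
def Hom.ofSimplexMap (φ : ∀ k, X.simplex k → Y.simplex k)
    (hφ : ∀ k (i : Fin (k + 1)) σ, φ k (X.face i σ) = Y.face i (φ (k + 1) σ))
    (ht : ∀ k, ∀ σ ∈ P.total k, φ k σ ∈ Q.total k) (hs : ∀ k, ∀ σ ∈ P.sub k, φ k σ ∈ Q.sub k) :
    Hom P Q where
  toFun k := Finsupp.lmapDomain ℤ ℤ (φ k)
  comm := boundary_lmapDomain φ hφ
  total k σ h := by simpa using single_mem_supported (ht k σ h)
  sub k σ h := by simpa using single_mem_supported (hs k σ h)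

/-- Chain homotopic maps send a relative cycle to homologous relative cycles. -/
theorem sub_mem_boundaries {ℓ : ℕ} (φ ψ : X.Chain (ℓ + 1) →ₗ[ℤ] Y.Chain (ℓ + 1))
    (h : ∀ k, X.Chain k →ₗ[ℤ] Y.Chain (k + 1))
    (hh : ∀ z, Y.boundary (ℓ + 1) (h (ℓ + 1) z) = ψ z - φ z - h ℓ (X.boundary ℓ z))
    (ht : ∀ k, ∀ σ ∈ P.total k,
      h k (Finsupp.single σ 1) ∈ Finsupp.supported ℤ ℤ (Q.total (k + 1)))
    (hs : ∀ k, ∀ σ ∈ P.sub k,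
      h k (Finsupp.single σ 1) ∈ Finsupp.supported ℤ ℤ (Q.sub (k + 1)))
    {z : X.Chain (ℓ + 1)} (hz : z ∈ P.cycles ℓ) : ψ z - φ z ∈ Q.boundaries ℓ := by
  refine mem_boundaries.2 ⟨_, map_mem_of_mem_supported _ (hs _) hz.2,
    _, map_mem_of_mem_supported _ (ht _) hz.1, ?_⟩
  rw [hh]
  abel

/-- An inclusion is the identity on chains, so surjectivity only asks to move a relative cycle,
within its class, into the smaller pair. Subdivision and the stretching deformation both do this. -/
theorem Hom.map_ofLE_surjective_iff {P P' : X.Pair} (ht : ∀ k, P.total k ⊆ P'.total k)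
    (hs : ∀ k, P.sub k ⊆ P'.sub k) (ℓ : ℕ) : Function.Surjective ((Hom.ofLE ht hs).map ℓ) ↔
      ∀ z ∈ P'.cycles ℓ, ∃ y ∈ P.cycles ℓ, y - z ∈ P'.boundaries ℓ := by
  constructor
  · intro h z hz
    obtain ⟨y, hy⟩ := h (P'.homologyMk z hz)
    obtain ⟨y, hy', rfl⟩ := exists_homologyMk y
    rw [Hom.map_mk, homologyMk_eq] at hy
    exact ⟨y, hy', hy⟩
  · intro h z
    obtain ⟨z, hz, rfl⟩ := exists_homologyMk z
    obtain ⟨y, hy, hyz⟩ := h z hz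
    exact ⟨P.homologyMk y hy, by rw [Hom.map_mk, homologyMk_eq]; exact hyz⟩

theorem Hom.map_ofLE_injective_iff {P P' : X.Pair} (ht : ∀ k, P.total k ⊆ P'.total k)
    (hs : ∀ k, P.sub k ⊆ P'.sub k) (ℓ : ℕ) : Function.Injective ((Hom.ofLE ht hs).map ℓ) ↔
      ∀ z ∈ P.cycles ℓ, z ∈ P'.boundaries ℓ → z ∈ P.boundaries ℓ := by
  rw [injective_iff_map_eq_zero]
  constructor
  · intro h z hz hz'
    exact homologyMk_eq_zero.1 (h (P.homologyMk z hz)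
      (by rw [Hom.map_mk, homologyMk_eq_zero]; exact hz'))
  · intro h z hz'
    obtain ⟨z, hz, rfl⟩ := exists_homologyMk z
    rw [Hom.map_mk, homologyMk_eq_zero] at hz'
    exact homologyMk_eq_zero.2 (h z hz hz')

end FaceSystem.Pair

/-! ### Ordered tuples: cones, chain homotopies and barycentric subdivision -/

open FaceSystem Filter

/-- If a finite condition holds eventually on simplices, it holds eventually on chains. -/
theorem eventually_map_mem_of_mem_supported {α M : Type} [AddCommGroup M]
    (f : ℕ → (α →₀ ℤ) →ₗ[ℤ] M) {s : Set α} {N : Submodule ℤ M}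
    (h : ∀ a ∈ s, ∀ᶠ n in atTop, f n (Finsupp.single a 1) ∈ N)
    {z : α →₀ ℤ} (hz : z ∈ Finsupp.supported ℤ ℤ s) : ∀ᶠ n in atTop, f n z ∈ N := by
  rw [Finsupp.supported_eq_span_single] at hz
  induction hz using Submodule.span_induction with
  | mem x hx => obtain ⟨a, ha, rfl⟩ := hx; exact h a ha
  | zero => simp
  | add x y _ _ hx hy =>
    filter_upwards [hx, hy] with n h1 h2
    rw [map_add]
    exact N.add_mem h1 h2
  | smul c x _ hx =>
    filter_upwards [hx] with n h1
    rw [map_smul]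
    exact N.smul_mem c h1

/-- The difference telescopes: each further application changes the current cycle by a boundary. -/
theorem FaceSystem.Pair.Hom.pow_cycles {X : FaceSystem} {P : X.Pair} (f : Pair.Hom P P) {ℓ : ℕ}
    (hf : ∀ z ∈ P.cycles ℓ, f.toFun (ℓ + 1) z - z ∈ P.boundaries ℓ) {z : X.Chain (ℓ + 1)}
    (hz : z ∈ P.cycles ℓ) (N : ℕ) : (f.toFun (ℓ + 1) ^ N) z ∈ P.cycles ℓ ∧
      (f.toFun (ℓ + 1) ^ N) z - z ∈ P.boundaries ℓ := by
  induction N with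
  | zero => simpa using hz
  | succ N ih =>
    rw [pow_succ', Module.End.mul_apply]
    refine ⟨f.map_cycles ih.1, ?_⟩
    have := (P.boundaries ℓ).add_mem (hf _ ih.1) ih.2
    simpa using this

/-- The ordered tuples of elements of a type. -/
abbrev tuples (Y : Type) : FaceSystem where
  simplex k := Fin k → Y
  face i v := v ∘ i.succAbove

/-- The map of chains of tuples induced by a function. -/
def mapTuples {Y Z : Type} (m : Y → Z) (k : ℕ) : (tuples Y).Chain k →ₗ[ℤ] (tuples Z).Chain k :=
  Finsupp.lmapDomain ℤ ℤ (fun v : Fin k → Y => m ∘ v)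

@[simp]
theorem mapTuples_single {Y Z : Type} (m : Y → Z) {k : ℕ} (v : Fin k → Y) (c : ℤ) :
    mapTuples m k (Finsupp.single v c) = Finsupp.single (α := Fin k → Z) (m ∘ v) c := by
  simp [mapTuples]

theorem boundary_mapTuples {Y Z : Type} (m : Y → Z) (k : ℕ) (z : (tuples Y).Chain (k + 1)) :
    (tuples Z).boundary k (mapTuples m (k + 1) z) = mapTuples m k ((tuples Y).boundary k z) :=
  boundary_lmapDomain (X := tuples Y) (Y := tuples Z) (fun _ v => m ∘ v) (fun _ _ _ => rfl) k z

/-! ### Cones and carrier-based chain homotopies. -/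

section Tuples

variable {Y Y' Z Z' : Type}

/-- Adding a first vertex. -/
def cone (b : Y) (k : ℕ) : (tuples Y).Chain k →ₗ[ℤ] (tuples Y).Chain (k + 1) :=
  Finsupp.lmapDomain ℤ ℤ (fun v : Fin k → Y => (Fin.cons b v : Fin (k + 1) → Y))

@[simp]
theorem cone_single (b : Y) {k : ℕ} (v : Fin k → Y) (c : ℤ) :
    cone b k (Finsupp.single v c) =
      Finsupp.single (α := Fin (k + 1) → Y) (Fin.cons b v) c := by
  simp [cone]

theorem mapTuples_cone (m : Y → Z) (b : Y) (k : ℕ) (z : (tuples Y).Chain k) :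
    mapTuples m (k + 1) (cone b k z) = cone (m b) k (mapTuples m k z) := by
  have : mapTuples m (k + 1) ∘ₗ cone b k = cone (m b) k ∘ₗ mapTuples m k := by
    refine Finsupp.lhom_ext' fun v => LinearMap.ext_ring ?_
    simp only [LinearMap.comp_apply, Finsupp.lsingle_apply]
    rw [cone_single, mapTuples_single, mapTuples_single, cone_single]
    congr 1
    funext i
    refine Fin.cases ?_ (fun j => ?_) i <;> simp
  exact LinearMap.congr_fun this z

theorem boundary_cone_zero (b : Y) (z : (tuples Y).Chain 0) :
    (tuples Y).boundary 0 (cone b 0 z) = z := by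
  have : (tuples Y).boundary 0 ∘ₗ cone b 0 = LinearMap.id := by
    refine Finsupp.lhom_ext' fun v => LinearMap.ext_ring ?_
    simp only [LinearMap.comp_apply, Finsupp.lsingle_apply]
    rw [cone_single, boundary_single, Fin.sum_univ_one, Fin.val_zero, pow_zero, one_smul,
      LinearMap.id_apply]
    congr 1
  exact LinearMap.congr_fun this z

/-- Deleting the apex returns the base; deleting another vertex gives the cone over a face of the
base, with the sign shifted by one. In particular a cone fills any cycle. -/
theorem boundary_cone_succ (b : Y) (k : ℕ) (z : (tuples Y).Chain (k + 1)) :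
    (tuples Y).boundary (k + 1) (cone b (k + 1) z) =
      z - cone b k ((tuples Y).boundary k z) := by
  have : (tuples Y).boundary (k + 1) ∘ₗ cone b (k + 1) =
      LinearMap.id - cone b k ∘ₗ (tuples Y).boundary k := by
    refine Finsupp.lhom_ext' fun v => LinearMap.ext_ring ?_
    simp only [LinearMap.comp_apply, Finsupp.lsingle_apply, LinearMap.sub_apply]
    rw [cone_single, boundary_single, boundary_single, Fin.sum_univ_succ, map_sum, sub_eq_add_neg,
      ← Finset.sum_neg_distrib]
    congr 1
    · simp only [Fin.val_zero, pow_zero, one_smul, LinearMap.id_apply]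
      congr 1
    · refine Finset.sum_congr rfl fun i _ => ?_
      rw [map_smul, cone_single, ← neg_smul, Fin.val_succ, pow_succ, mul_neg_one]
      congr 2
      funext j
      refine Fin.cases ?_ (fun j => ?_) j <;> simp
  exact LinearMap.congr_fun this z

theorem exists_cone_eq (k : ℕ) (v : Fin (k + 1) → Y) :
    cone (v 0) k (Finsupp.single (Fin.tail v) 1) =
      (Finsupp.single v 1 : (tuples Y).Chain (k + 1)) := by
  rw [cone_single, Fin.cons_self_tail]

/-- A tuple is the cone from its first entry over its tail, so the cone formula lowers the degree by
one. -/
theorem boundary_boundary (k : ℕ) (z : (tuples Y).Chain (k + 2)) :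
    (tuples Y).boundary k ((tuples Y).boundary (k + 1) z) = 0 := by
  induction k with
  | zero =>
    have : (tuples Y).boundary 0 ∘ₗ (tuples Y).boundary 1 = 0 := by
      refine Finsupp.lhom_ext' fun v => LinearMap.ext_ring ?_
      simp only [LinearMap.comp_apply, Finsupp.lsingle_apply]
      rw [← exists_cone_eq, boundary_cone_succ, map_sub, boundary_cone_zero, sub_self]
      rfl
    exact LinearMap.congr_fun this z
  | succ k ih =>
    have : (tuples Y).boundary (k + 1) ∘ₗ (tuples Y).boundary (k + 2) = 0 := by
      refine Finsupp.lhom_ext' fun v => LinearMap.ext_ring ?_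
      simp only [LinearMap.comp_apply, Finsupp.lsingle_apply]
      rw [← exists_cone_eq, boundary_cone_succ, map_sub, boundary_cone_succ, ih, map_zero, sub_zero,
        sub_self]
      rfl
    exact LinearMap.congr_fun this z

/-- The tuples all of whose entries belong to `s`. -/
def tuplesIn (s : Set Y) (k : ℕ) : Set (Fin k → Y) := {v | ∀ i, v i ∈ s}

theorem tuplesIn_mono {s t : Set Y} (h : s ⊆ t) (k : ℕ) : tuplesIn s k ⊆ tuplesIn t k :=
  fun _ hv i => h (hv i)

theorem cone_mem_supported {s : Set Y} {b : Y} (hb : b ∈ s) {k : ℕ} {z : (tuples Y).Chain k}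
    (hz : z ∈ Finsupp.supported ℤ ℤ (tuplesIn s k)) :
    cone b k z ∈ Finsupp.supported ℤ ℤ (tuplesIn s (k + 1)) :=
  mapDomain_mem_supported _
    (fun _ hv i => Fin.cases (by simpa using hb) (fun j => by simpa using hv j) i) hz

/-- The chain homotopy between two augmentation preserving chain maps obtained by coning from the
points `b`. -/
def homotopyOp (b : ∀ k, (Fin k → Y) → Y')
    (φ ψ : ∀ k, (tuples Y).Chain k →ₗ[ℤ] (tuples Y').Chain k) :
    ∀ k, (tuples Y).Chain k →ₗ[ℤ] (tuples Y').Chain (k + 1)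
  | 0 => 0
  | k + 1 => Finsupp.linearCombination ℤ fun v : Fin (k + 1) → Y =>
      cone (b _ v) (k + 1) (ψ (k + 1) (Finsupp.single v 1) - φ (k + 1) (Finsupp.single v 1) -
        homotopyOp b φ ψ k ((tuples Y).boundary k (Finsupp.single v 1)))

theorem homotopyOp_single_succ (b : ∀ k, (Fin k → Y) → Y')
    (φ ψ : ∀ k, (tuples Y).Chain k →ₗ[ℤ] (tuples Y').Chain k) (k : ℕ) (v : Fin (k + 1) → Y) :
    homotopyOp b φ ψ (k + 1) (Finsupp.single v 1) =
      cone (b _ v) (k + 1) (ψ (k + 1) (Finsupp.single v 1) - φ (k + 1) (Finsupp.single v 1) -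
        homotopyOp b φ ψ k ((tuples Y).boundary k (Finsupp.single v 1))) := by
  rw [homotopyOp, Finsupp.linearCombination_single, one_smul]

/-- By induction `ψ - φ - h ∂` sends a tuple to a cycle, and coning fills it. The induction starts
at the empty tuple, where `φ` and `ψ` agree and the homotopy is zero. -/
theorem boundary_homotopyOp (b : ∀ k, (Fin k → Y) → Y')
    (φ ψ : ∀ k, (tuples Y).Chain k →ₗ[ℤ] (tuples Y').Chain k)
    (hφ : ∀ k z, (tuples Y').boundary k (φ (k + 1) z) = φ k ((tuples Y).boundary k z))
    (hψ : ∀ k z, (tuples Y').boundary k (ψ (k + 1) z) = ψ k ((tuples Y).boundary k z))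
    (h0 : φ 0 = ψ 0) (k : ℕ) (z : (tuples Y).Chain (k + 1)) :
    (tuples Y').boundary (k + 1) (homotopyOp b φ ψ (k + 1) z) =
      ψ (k + 1) z - φ (k + 1) z - homotopyOp b φ ψ k ((tuples Y).boundary k z) := by
  induction k with
  | zero =>
    have : (tuples Y').boundary 1 ∘ₗ homotopyOp b φ ψ 1 =
        ψ 1 - φ 1 - homotopyOp b φ ψ 0 ∘ₗ (tuples Y).boundary 0 := by
      refine Finsupp.lhom_ext' fun v => LinearMap.ext_ring ?_
      simp only [LinearMap.comp_apply, Finsupp.lsingle_apply, LinearMap.sub_apply]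
      rw [homotopyOp_single_succ, boundary_cone_succ, map_sub, map_sub, map_sub, map_sub, hφ, hψ, h0]
      simp [homotopyOp]
    exact LinearMap.congr_fun this z
  | succ k ih =>
    have : (tuples Y').boundary (k + 2) ∘ₗ homotopyOp b φ ψ (k + 2) =
        ψ (k + 2) - φ (k + 2) - homotopyOp b φ ψ (k + 1) ∘ₗ (tuples Y).boundary (k + 1) := by
      refine Finsupp.lhom_ext' fun v => LinearMap.ext_ring ?_
      simp only [LinearMap.comp_apply, Finsupp.lsingle_apply, LinearMap.sub_apply]
      rw [homotopyOp_single_succ, boundary_cone_succ, map_sub, map_sub, map_sub, map_sub, hφ, hψ, ih,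
        boundary_boundary]
      simp
    exact LinearMap.congr_fun this z

theorem mem_supported_boundary {c : ∀ k, (Fin k → Y) → Set Y'} (k r : ℕ)
    (hc : ∀ (i : Fin (k + 1)) v, c k (v ∘ i.succAbove) ⊆ c (k + 1) v)
    (f : (tuples Y).Chain k →ₗ[ℤ] (tuples Y').Chain r)
    (hf : ∀ v, f (Finsupp.single v 1) ∈ Finsupp.supported ℤ ℤ (tuplesIn (c k v) r))
    (v : Fin (k + 1) → Y) : f ((tuples Y).boundary k (Finsupp.single v 1)) ∈
      Finsupp.supported ℤ ℤ (tuplesIn (c (k + 1) v) r) := by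
  rw [boundary_single, map_sum]
  refine Submodule.sum_mem _ fun i _ => ?_
  rw [map_smul]
  exact Submodule.smul_mem _ _ (Finsupp.supported_mono (tuplesIn_mono (hc i v) r) (hf _))

/-- This is the acyclic carrier argument: `c v` contains the carriers of the faces of `v` and the
apex, so coning never leaves it. It keeps homotopies inside convex hulls and inside subcomplexes. -/
theorem homotopyOp_mem_supported (b : ∀ k, (Fin k → Y) → Y')
    (φ ψ : ∀ k, (tuples Y).Chain k →ₗ[ℤ] (tuples Y').Chain k)
    (c : ∀ k, (Fin k → Y) → Set Y')
    (hc : ∀ k (i : Fin (k + 1)) v, c k (v ∘ i.succAbove) ⊆ c (k + 1) v)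
    (hb : ∀ k v, b (k + 1) v ∈ c (k + 1) v)
    (hφ : ∀ k v, φ k (Finsupp.single v 1) ∈ Finsupp.supported ℤ ℤ (tuplesIn (c k v) k))
    (hψ : ∀ k v, ψ k (Finsupp.single v 1) ∈ Finsupp.supported ℤ ℤ (tuplesIn (c k v) k))
    (k : ℕ) (v : Fin k → Y) : homotopyOp b φ ψ k (Finsupp.single v 1) ∈
      Finsupp.supported ℤ ℤ (tuplesIn (c k v) (k + 1)) := by
  induction k with
  | zero => simp [homotopyOp]
  | succ k ih =>
    rw [homotopyOp_single_succ]
    exact cone_mem_supported (hb k v) (Submodule.sub_mem _ (Submodule.sub_mem _ (hψ _ v) (hφ _ v))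
      (mem_supported_boundary k (k + 1) (hc k) _ ih v))

/-- Cones commute with induced maps as soon as the apexes correspond. Applied to linear face
inclusions, this makes homotopies built on standard simplices natural. -/
theorem mapTuples_homotopyOp (m : Y → Z) (m' : Y' → Z')
    (b : ∀ k, (Fin k → Y) → Y') (b' : ∀ k, (Fin k → Z) → Z')
    (φ ψ : ∀ k, (tuples Y).Chain k →ₗ[ℤ] (tuples Y').Chain k)
    (φ' ψ' : ∀ k, (tuples Z).Chain k →ₗ[ℤ] (tuples Z').Chain k)
    (hb : ∀ k v, m' (b (k + 1) v) = b' (k + 1) (m ∘ v))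
    (hφ : ∀ k z, mapTuples m' k (φ k z) = φ' k (mapTuples m k z))
    (hψ : ∀ k z, mapTuples m' k (ψ k z) = ψ' k (mapTuples m k z))
    (k : ℕ) (z : (tuples Y).Chain k) :
    mapTuples m' (k + 1) (homotopyOp b φ ψ k z) = homotopyOp b' φ' ψ' k (mapTuples m k z) := by
  induction k with
  | zero => simp [homotopyOp]
  | succ k ih =>
    have : mapTuples m' (k + 2) ∘ₗ homotopyOp b φ ψ (k + 1) =
        homotopyOp b' φ' ψ' (k + 1) ∘ₗ mapTuples m (k + 1) := by
      refine Finsupp.lhom_ext' fun v => LinearMap.ext_ring ?_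
      simp only [LinearMap.comp_apply, Finsupp.lsingle_apply]
      rw [homotopyOp_single_succ, mapTuples_cone, map_sub, map_sub, map_sub, map_sub, hφ, hψ, ih,
        ← boundary_mapTuples, mapTuples_single, homotopyOp_single_succ, hb,
        map_sub, map_sub]
    exact LinearMap.congr_fun this z

end Tuples

/-- Contiguous maps of tuples send a relative cycle to homologous relative cycles. -/
theorem mapTuples_sub_mem_boundaries {Y Y' : Type} [Nonempty Y'] {P : (tuples Y).Pair}
    {Q : (tuples Y').Pair} (f g : Y → Y')
    (ht : ∀ k, ∀ v ∈ P.total k,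
      tuplesIn (Set.range (f ∘ v) ∪ Set.range (g ∘ v)) (k + 1) ⊆ Q.total (k + 1))
    (hs : ∀ k, ∀ v ∈ P.sub k,
      tuplesIn (Set.range (f ∘ v) ∪ Set.range (g ∘ v)) (k + 1) ⊆ Q.sub (k + 1))
    {ℓ : ℕ} {z : (tuples Y).Chain (ℓ + 1)} (hz : z ∈ P.cycles ℓ) :
    mapTuples g (ℓ + 1) z - mapTuples f (ℓ + 1) z ∈ Q.boundaries ℓ := by
  -- The apex is the image of the first entry. The arbitrary value on the empty tuple is never coned
  -- from.
  let b : ∀ k, (Fin k → Y) → Y' := fun k v =>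
    if h : 0 < k then f (v ⟨0, h⟩) else Classical.arbitrary Y'
  have hsupp := homotopyOp_mem_supported b (mapTuples f) (mapTuples g)
    (fun k v => Set.range (f ∘ v) ∪ Set.range (g ∘ v))
    (fun k i v => Set.union_subset_union (Set.range_comp_subset_range _ (f ∘ v))
      (Set.range_comp_subset_range _ (g ∘ v)))
    (fun k v => Or.inl ⟨0, by simp [b]⟩)
    (fun k v => by
      rw [mapTuples_single]
      exact single_mem_supported fun i => Or.inl ⟨i, rfl⟩)
    (fun k v => by
      rw [mapTuples_single]
      exact single_mem_supported fun i => Or.inr ⟨i, rfl⟩)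
  refine Pair.sub_mem_boundaries (P := P) _ _ (homotopyOp b (mapTuples f) (mapTuples g))
    (boundary_homotopyOp b (mapTuples f) (mapTuples g) (boundary_mapTuples f)
      (boundary_mapTuples g) ?_ ℓ)
    (fun k v hv => Finsupp.supported_mono (ht k v hv) (hsupp k v))
    (fun k v hv => Finsupp.supported_mono (hs k v hv) (hsupp k v)) hz
  refine Finsupp.lhom_ext' fun v => LinearMap.ext_ring ?_
  simp only [LinearMap.comp_apply, Finsupp.lsingle_apply]
  rw [mapTuples_single, mapTuples_single]
  congr 1
  exact Subsingleton.elim (α := Fin 0 → Y') _ _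

/-! ### Barycentric subdivision of tuples. -/

section Subdivision

variable {V V' : Type} [AddCommGroup V] [Module ℝ V] [AddCommGroup V'] [Module ℝ V']

/-- The barycenter of a tuple. -/
def tupleBarycenter (k : ℕ) (v : Fin k → V) : V := (k : ℝ)⁻¹ • ∑ i, v i

theorem map_tupleBarycenter (m : V →ₗ[ℝ] V') (k : ℕ) (v : Fin k → V) :
    m (tupleBarycenter k v) = tupleBarycenter k (m ∘ v) := by
  simp [tupleBarycenter]

theorem tupleBarycenter_mem_convexHull (k : ℕ) (v : Fin (k + 1) → V) :
    tupleBarycenter (k + 1) v ∈ convexHull ℝ (Set.range v) := by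
  rw [tupleBarycenter, Finset.smul_sum]
  refine (convex_convexHull ℝ _).sum_mem (fun _ _ => by positivity) ?_
    (fun i _ => subset_convexHull ℝ _ ⟨i, rfl⟩)
  simp only [Finset.sum_const, Finset.card_univ, Fintype.card_fin, nsmul_eq_mul]
  exact mul_inv_cancel₀ (by positivity)

/-- Barycentric subdivision of tuples of points in a real vector space. -/
def sd : ∀ k, (tuples V).Chain k →ₗ[ℤ] (tuples V).Chain k
  | 0 => LinearMap.id
  | k + 1 => Finsupp.linearCombination ℤ fun v : Fin (k + 1) → V =>
      cone (tupleBarycenter _ v) k (sd k ((tuples V).boundary k (Finsupp.single v 1)))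

theorem sd_single_succ (k : ℕ) (v : Fin (k + 1) → V) : sd (k + 1) (Finsupp.single v 1) =
    cone (tupleBarycenter _ v) k (sd k ((tuples V).boundary k (Finsupp.single v 1))) := by
  rw [sd, Finsupp.linearCombination_single, one_smul]

/-- The cone is taken over a subdivided boundary, which is a cycle by induction and `∂∂ = 0`, so the
correction term of the cone formula vanishes. -/
theorem boundary_sd (k : ℕ) (z : (tuples V).Chain (k + 1)) :
    (tuples V).boundary k (sd (k + 1) z) = sd k ((tuples V).boundary k z) := by
  induction k with
  | zero =>
    have : (tuples V).boundary 0 ∘ₗ sd 1 = sd 0 ∘ₗ (tuples V).boundary 0 := by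
      refine Finsupp.lhom_ext' fun v => LinearMap.ext_ring ?_
      simp only [LinearMap.comp_apply, Finsupp.lsingle_apply]
      rw [sd_single_succ, boundary_cone_zero]
    exact LinearMap.congr_fun this z
  | succ k ih =>
    have : (tuples V).boundary (k + 1) ∘ₗ sd (k + 2) = sd (k + 1) ∘ₗ (tuples V).boundary (k + 1) := by
      refine Finsupp.lhom_ext' fun v => LinearMap.ext_ring ?_
      simp only [LinearMap.comp_apply, Finsupp.lsingle_apply]
      rw [sd_single_succ, boundary_cone_succ, ih, boundary_boundary]
      simp
    exact LinearMap.congr_fun this z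

theorem mapTuples_sd (m : V →ₗ[ℝ] V') (k : ℕ) (z : (tuples V).Chain k) :
    mapTuples m k (sd k z) = sd k (mapTuples m k z) := by
  induction k with
  | zero => rfl
  | succ k ih =>
    have : mapTuples m (k + 1) ∘ₗ sd (k + 1) = sd (k + 1) ∘ₗ mapTuples m (k + 1) := by
      refine Finsupp.lhom_ext' fun v => LinearMap.ext_ring ?_
      simp only [LinearMap.comp_apply, Finsupp.lsingle_apply]
      rw [sd_single_succ, mapTuples_cone, ih, ← boundary_mapTuples, mapTuples_single,
        sd_single_succ, map_tupleBarycenter]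
    exact LinearMap.congr_fun this z

theorem sd_single_mem_supported (k : ℕ) (v : Fin k → V) : sd k (Finsupp.single v 1) ∈
    Finsupp.supported ℤ ℤ (tuplesIn (convexHull ℝ (Set.range v)) k) := by
  induction k with
  | zero => exact single_mem_supported (fun i => i.elim0)
  | succ k ih =>
    rw [sd_single_succ]
    exact cone_mem_supported (tupleBarycenter_mem_convexHull k v)
      (mem_supported_boundary (c := fun k v => convexHull ℝ (Set.range v)) k k
        (fun i v => convexHull_mono (Set.range_comp_subset_range _ _)) _ ih v)

/-- The chain homotopy from barycentric subdivision to the identity. -/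
def sdHomotopy : ∀ k, (tuples V).Chain k →ₗ[ℤ] (tuples V).Chain (k + 1) :=
  homotopyOp tupleBarycenter (fun _ => LinearMap.id) sd

theorem boundary_sdHomotopy (k : ℕ) (z : (tuples V).Chain (k + 1)) :
    (tuples V).boundary (k + 1) (sdHomotopy (k + 1) z) =
      sd (k + 1) z - z - sdHomotopy k ((tuples V).boundary k z) :=
  boundary_homotopyOp tupleBarycenter (fun _ => LinearMap.id) sd (fun _ _ => rfl) boundary_sd rfl k z

theorem mapTuples_sdHomotopy (m : V →ₗ[ℝ] V') (k : ℕ) (z : (tuples V).Chain k) :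
    mapTuples m (k + 1) (sdHomotopy k z) = sdHomotopy k (mapTuples m k z) :=
  mapTuples_homotopyOp m m tupleBarycenter tupleBarycenter (fun _ => LinearMap.id) sd
    (fun _ => LinearMap.id) sd (fun _ _ => map_tupleBarycenter m _ _) (fun _ _ => rfl)
    (mapTuples_sd m) k z

theorem sdHomotopy_single_mem_supported (k : ℕ) (v : Fin k → V) :
    sdHomotopy k (Finsupp.single v 1) ∈
      Finsupp.supported ℤ ℤ (tuplesIn (convexHull ℝ (Set.range v)) (k + 1)) :=
  homotopyOp_mem_supported tupleBarycenter (fun _ => LinearMap.id) sd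
    (fun _ v => convexHull ℝ (Set.range v))
    (fun _ _ _ => convexHull_mono (Set.range_comp_subset_range _ _))
    tupleBarycenter_mem_convexHull
    (fun k v => single_mem_supported (s := tuplesIn (convexHull ℝ (Set.range v)) k)
      fun i => subset_convexHull ℝ _ (Set.mem_range_self i))
    sd_single_mem_supported k v

end Subdivision

/-! ### Mesh of iterated subdivisions. -/

section Mesh

variable {V : Type} [SeminormedAddCommGroup V] [NormedSpace ℝ V]

/-- The vector from the barycenter to a vertex is the average of its `k + 1` differences with all
vertices, one of which is zero; hence the factor `k / (k + 1)`. -/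
theorem dist_tupleBarycenter_le {k : ℕ} (v : Fin (k + 1) → V) {D : ℝ}
    (hD : ∀ i j, dist (v i) (v j) ≤ D) (i : Fin (k + 1)) :
    dist (v i) (tupleBarycenter (k + 1) v) ≤ (1 - ((k + 1 : ℕ) : ℝ)⁻¹) * D := by
  have hk : ((k + 1 : ℕ) : ℝ) ≠ 0 := by positivity
  have : v i - tupleBarycenter (k + 1) v = ((k + 1 : ℕ) : ℝ)⁻¹ • ∑ j, (v i - v j) := by
    rw [Finset.sum_sub_distrib, smul_sub, Finset.sum_const, Finset.card_univ, Fintype.card_fin,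
      ← Nat.cast_smul_eq_nsmul ℝ, smul_smul, inv_mul_cancel₀ hk, one_smul, tupleBarycenter]
  have h2 : ‖∑ j, (v i - v j)‖ ≤ k * D := by
    rw [Fin.sum_univ_succAbove _ i, sub_self, zero_add]
    refine (norm_sum_le_of_le _ (fun j _ => (dist_eq_norm (v i) _).symm.trans_le (hD _ _))).trans ?_
    simp
  rw [dist_eq_norm, this, norm_smul, Real.norm_of_nonneg (by positivity)]
  calc _ ≤ ((k + 1 : ℕ) : ℝ)⁻¹ * (k * D) := by gcongr
    _ = _ := by
      push_cast at hk ⊢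
      field_simp
      ring

/-- Tuples of points of `C` at distance at most `D` from each other. -/
def smallTuples (C : Set V) (D : ℝ) (k : ℕ) : Set (Fin k → V) :=
  {w | (∀ i, w i ∈ C) ∧ ∀ i j, dist (w i) (w j) ≤ D}

/-- Distances to the new apex contract by the barycenter estimate, the other distances by induction
on the faces. A fixed `n ≥ k` provides one contraction factor for all dimensions met in the
induction. -/
theorem sd_single_mem_smallTuples {n : ℕ} {D : ℝ} (hD : 0 ≤ D) (k : ℕ) (hk : k ≤ n)
    (v : Fin k → V) (hv : ∀ i j, dist (v i) (v j) ≤ D) : sd k (Finsupp.single v 1) ∈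
      Finsupp.supported ℤ ℤ
        (smallTuples (convexHull ℝ (Set.range v)) ((1 - (n : ℝ)⁻¹) * D) k) := by
  induction k with
  | zero => exact single_mem_supported ⟨fun i => i.elim0, fun i => i.elim0⟩
  | succ k ih =>
    have hn : ((k + 1 : ℕ) : ℝ) ≤ n := by exact_mod_cast hk
    have hinv : (n : ℝ)⁻¹ ≤ ((k + 1 : ℕ) : ℝ)⁻¹ := inv_anti₀ (by positivity) hn
    have hle1 : (n : ℝ)⁻¹ ≤ 1 := hinv.trans (inv_le_one_of_one_le₀ (by simp))
    have hbd : ∀ q ∈ convexHull ℝ (Set.range v),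
        dist q (tupleBarycenter (k + 1) v) ≤ (1 - (n : ℝ)⁻¹) * D := by
      intro q hq
      have : convexHull ℝ (Set.range v) ⊆
          Metric.closedBall (tupleBarycenter (k + 1) v) ((1 - (n : ℝ)⁻¹) * D) := by
        refine convexHull_min ?_ (convex_closedBall _ _)
        rintro _ ⟨i, rfl⟩
        exact (dist_tupleBarycenter_le v hv i).trans (by gcongr)
      exact this hq
    rw [sd_single_succ]
    refine mapDomain_mem_supported (s := smallTuples (convexHull ℝ (Set.range v))
      ((1 - (n : ℝ)⁻¹) * D) k) _ ?_ ?_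
    · rintro w ⟨hw, hw'⟩
      refine ⟨fun i => Fin.cases (tupleBarycenter_mem_convexHull k v) hw i, fun i j => ?_⟩
      have h0 : 0 ≤ (1 - (n : ℝ)⁻¹) * D := mul_nonneg (sub_nonneg.2 hle1) hD
      refine Fin.cases (Fin.cases ?_ (fun j => ?_) j) (fun i => Fin.cases ?_ (fun j => ?_) j) i
      · simpa using h0
      · rw [dist_comm]; simpa using hbd _ (hw j)
      · simpa using hbd _ (hw i)
      · simpa using hw' i j
    · rw [boundary_single, map_sum]
      refine Submodule.sum_mem _ fun i _ => ?_
      rw [map_smul]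
      refine Submodule.smul_mem _ _ (Finsupp.supported_mono ?_ (ih (Nat.le_of_succ_le hk) _ ?_))
      · rintro w ⟨hw, hw'⟩
        exact ⟨fun i => convexHull_mono (Set.range_comp_subset_range _ _) (hw i), hw'⟩
      · exact fun a b => hv _ _

theorem pow_sd_single_mem_smallTuples {k : ℕ} {D : ℝ} (hD : 0 ≤ D)
    (v : Fin (k + 1) → V) (hv : ∀ i j, dist (v i) (v j) ≤ D) (N : ℕ) :
    (sd (k + 1) ^ N) (Finsupp.single v 1) ∈ Finsupp.supported ℤ ℤ
      (smallTuples (convexHull ℝ (Set.range v)) ((1 - ((k + 1 : ℕ) : ℝ)⁻¹) ^ N * D) (k + 1)) := by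
  have hle1 : 0 ≤ 1 - ((k + 1 : ℕ) : ℝ)⁻¹ := sub_nonneg.2 (inv_le_one_of_one_le₀ (by simp))
  induction N with
  | zero =>
    exact single_mem_supported ⟨fun i => subset_convexHull ℝ _ ⟨i, rfl⟩, fun i j => by
      simpa using hv i j⟩
  | succ N ih =>
    rw [pow_succ' (sd (k + 1)) N, Module.End.mul_apply]
    refine map_mem_of_mem_supported _ ?_ ih
    rintro w ⟨hw, hw'⟩
    refine Finsupp.supported_mono ?_
      (sd_single_mem_smallTuples (by positivity) (k + 1) le_rfl w hw')
    rintro u ⟨hu, hu'⟩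
    refine ⟨fun i => convexHull_min (Set.range_subset_iff.2 hw) (convex_convexHull ℝ _) (hu i),
      fun i j => (hu' i j).trans_eq ?_⟩
    ring

theorem eventually_pow_sd_mem_smallTuples {k : ℕ} (v : Fin (k + 1) → V) {η : ℝ} (hη : 0 < η) :
    ∀ᶠ N in atTop, (sd (k + 1) ^ N) (Finsupp.single v 1) ∈ Finsupp.supported ℤ ℤ
      (smallTuples (convexHull ℝ (Set.range v)) η (k + 1)) := by
  obtain ⟨D, hD⟩ : ∃ D, ∀ p : Fin (k + 1) × Fin (k + 1), dist (v p.1) (v p.2) ≤ D :=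
    ⟨_, fun p => le_ciSup (Set.finite_range fun p : Fin (k + 1) × Fin (k + 1) =>
      dist (v p.1) (v p.2)).bddAbove p⟩
  have hD0 : 0 ≤ D := dist_nonneg.trans (hD (0, 0))
  have hle1 : 0 ≤ 1 - ((k + 1 : ℕ) : ℝ)⁻¹ := sub_nonneg.2 (inv_le_one_of_one_le₀ (by simp))
  have hlt : 1 - ((k + 1 : ℕ) : ℝ)⁻¹ < 1 := by
    have : 0 < ((k + 1 : ℕ) : ℝ)⁻¹ := by positivity
    linarith
  have hlim := (tendsto_pow_atTop_nhds_zero_of_lt_one hle1 hlt).mul_const D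
  rw [zero_mul] at hlim
  filter_upwards [hlim.eventually (ge_mem_nhds hη)] with N hN
  refine Finsupp.supported_mono ?_
    (pow_sd_single_mem_smallTuples hD0 v (fun i j => hD (i, j)) N)
  rintro w ⟨hw, hw'⟩
  exact ⟨hw, fun i j => (hw' i j).trans hN⟩

end Mesh

/-! ### Singular simplices as functions on the standard simplices -/

open FaceSystem Filter

/-- The linear extension of the `i`-th face of the standard simplex. -/
abbrev faceMap {k : ℕ} (i : Fin (k + 1)) : (Fin k → ℝ) →ₗ[ℝ] (Fin (k + 1) → ℝ) :=
  FunOnFinite.linearMap ℝ ℝ i.succAbove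

theorem faceMap_succAbove {k : ℕ} (i : Fin (k + 1)) (a : Fin k → ℝ) (j : Fin k) :
    faceMap i a (i.succAbove j) = a j := by
  rw [FunOnFinite.linearMap_apply_apply]
  simp [Finset.filter_eq']

theorem faceMap_self {k : ℕ} (i : Fin (k + 1)) (a : Fin k → ℝ) : faceMap i a i = 0 := by
  rw [FunOnFinite.linearMap_apply_apply]
  simp [Fin.succAbove_ne]

theorem faceMap_mem_stdSimplex {k : ℕ} (i : Fin (k + 1)) (a : Fin k → ℝ) :
    faceMap i a ∈ stdSimplex ℝ (Fin (k + 1)) ↔ a ∈ stdSimplex ℝ (Fin k) := by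
  simp only [stdSimplex, Set.mem_ofPred_eq]
  rw [Fin.sum_univ_succAbove _ i, Fin.forall_iff_succAbove i]
  simp [faceMap_succAbove, faceMap_self]

/-- The vertices of the standard simplex. -/
def vertexTuple (k : ℕ) : Fin k → (Fin k → ℝ) := fun i => Pi.single i 1

theorem faceMap_comp_vertexTuple {k : ℕ} (i : Fin (k + 1)) :
    faceMap i ∘ vertexTuple k = vertexTuple (k + 1) ∘ i.succAbove := by
  funext j
  exact FunOnFinite.linearMap_piSingle ..

theorem sum_smul_vertexTuple {k : ℕ} (a : Fin k → ℝ) : ∑ i, a i • vertexTuple k i = a := by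
  funext j
  simp [vertexTuple, Finset.sum_apply, Pi.single_apply]

theorem convexHull_vertexTuple_subset (k : ℕ) :
    convexHull ℝ (Set.range (vertexTuple k)) ⊆ stdSimplex ℝ (Fin k) :=
  convexHull_min (Set.range_subset_iff.2 fun i => single_mem_stdSimplex ℝ i)
    (convex_stdSimplex ℝ _)

/-- The face system of all functions, continuous or not, from standard simplices to `E`. -/
abbrev singularSystem (E : Type) : FaceSystem where
  simplex k := stdSimplex ℝ (Fin k) → E
  face i σ := σ ∘ stdSimplex.map i.succAbove

/-! ### Affine simplices composed with a function. -/

section Push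

variable {E V V' : Type} [AddCommGroup V] [Module ℝ V] [AddCommGroup V'] [Module ℝ V']

/-- The composition of the affine simplex spanned by a tuple with a function. -/
def push (s : V → E) {k : ℕ} (v : Fin k → V) : stdSimplex ℝ (Fin k) → E :=
  fun a => s (∑ i, a i • v i)

theorem push_face (s : V → E) {k : ℕ} (i : Fin (k + 1)) (v : Fin (k + 1) → V) :
    push s (v ∘ i.succAbove) = push s v ∘ stdSimplex.map i.succAbove := by
  funext a
  simp only [push, Function.comp_apply]
  congr 1
  rw [Fin.sum_univ_succAbove _ i]
  have h1 := faceMap_self i a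
  have h2 := faceMap_succAbove i a
  simp only [stdSimplex.map_coe]
  rw [h1, zero_smul, zero_add]
  exact Finset.sum_congr rfl fun j _ => by rw [h2]

theorem push_comp (s : V' → E) (m : V →ₗ[ℝ] V') {k : ℕ} (v : Fin k → V) :
    push (s ∘ m) v = push s (m ∘ v) := by
  funext a
  simp [push]

theorem sum_smul_mem_convexHull {k : ℕ} (v : Fin k → V) (a : stdSimplex ℝ (Fin k)) :
    ∑ i, a i • v i ∈ convexHull ℝ (Set.range v) :=
  (convex_convexHull ℝ _).sum_mem (fun i _ => a.2.1 i) a.2.2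
    (fun i _ => subset_convexHull ℝ _ ⟨i, rfl⟩)

theorem sum_smul_mem {C : Set V} (hC : Convex ℝ C) {k : ℕ} {v : Fin k → V} (hv : ∀ i, v i ∈ C)
    (a : stdSimplex ℝ (Fin k)) : ∑ i, a i • v i ∈ C :=
  hC.sum_mem (fun i _ => a.2.1 i) a.2.2 (fun i _ => hv i)

/-- The chain map from tuples to singular chains. -/
def pushChain (s : V → E) (k : ℕ) : (tuples V).Chain k →ₗ[ℤ] (singularSystem E).Chain k :=
  Finsupp.lmapDomain ℤ ℤ (fun v : Fin k → V => push s v)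

@[simp]
theorem pushChain_single (s : V → E) {k : ℕ} (v : Fin k → V) (c : ℤ) :
    pushChain s k (Finsupp.single v c) =
      Finsupp.single (α := stdSimplex ℝ (Fin k) → E) (push s v) c := by
  simp [pushChain]

theorem boundary_pushChain (s : V → E) (k : ℕ) (z : (tuples V).Chain (k + 1)) :
    (singularSystem E).boundary k (pushChain s (k + 1) z) =
      pushChain s k ((tuples V).boundary k z) :=
  boundary_lmapDomain (X := tuples V) (Y := singularSystem E) (fun _ v => push s v)
    (fun _ i v => push_face s i v) k z

theorem pushChain_comp (s : V' → E) (m : V →ₗ[ℝ] V') (k : ℕ) (z : (tuples V).Chain k) :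
    pushChain (s ∘ m) k z = pushChain s k (mapTuples m k z) := by
  have : pushChain (s ∘ m) k = pushChain s k ∘ₗ mapTuples m k := by
    refine Finsupp.lhom_ext' fun v => LinearMap.ext_ring ?_
    simp only [LinearMap.comp_apply, Finsupp.lsingle_apply]
    rw [mapTuples_single, pushChain_single, pushChain_single, push_comp]
  exact LinearMap.congr_fun this z

end Push

/-! ### Natural operators determined by one chain in each dimension. -/

section Universal

variable {E : Type} {W : ℕ → Type} [∀ k, AddCommGroup (W k)] [∀ k, Module ℝ (W k)] {r : ℕ → ℕ}

/-- The natural operator on singular chains given by universal chains `u k` of tuples. -/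
def universalOp (u : ∀ k, (tuples (W k)).Chain (r k))
    (s : ∀ k, (stdSimplex ℝ (Fin k) → E) → W k → E) (k : ℕ) :
    (singularSystem E).Chain k →ₗ[ℤ] (singularSystem E).Chain (r k) :=
  Finsupp.linearCombination ℤ fun σ : stdSimplex ℝ (Fin k) → E => pushChain (s k σ) (r k) (u k)

theorem universalOp_single (u : ∀ k, (tuples (W k)).Chain (r k))
    (s : ∀ k, (stdSimplex ℝ (Fin k) → E) → W k → E) (k : ℕ) (σ : stdSimplex ℝ (Fin k) → E) :
    universalOp u s k (Finsupp.single σ 1) = pushChain (s k σ) (r k) (u k) := by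
  rw [universalOp, Finsupp.linearCombination_single, one_smul]

/-- Each face of `σ` is represented by the function of `σ` itself after a linear face map, so all
terms of the boundary can be pushed forward by a single function. -/
theorem universalOp_boundary_single (u : ∀ k, (tuples (W k)).Chain (r k))
    (s : ∀ k, (stdSimplex ℝ (Fin k) → E) → W k → E)
    (m : ∀ k, Fin (k + 1) → (W k →ₗ[ℝ] W (k + 1)))
    (hs : ∀ k i σ, s k (σ ∘ stdSimplex.map i.succAbove) = s (k + 1) σ ∘ m k i)
    (k : ℕ) (σ : stdSimplex ℝ (Fin (k + 1)) → E) :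
    universalOp u s k ((singularSystem E).boundary k (Finsupp.single σ 1)) =
      pushChain (s (k + 1) σ) (r k)
        (∑ i : Fin (k + 1), (-1 : ℤ) ^ (i : ℕ) • mapTuples (m k i) (r k) (u k)) := by
  rw [boundary_single, map_sum, map_sum]
  refine Finset.sum_congr rfl fun i _ => ?_
  rw [map_smul, map_smul, universalOp_single, hs, pushChain_comp]

/-- The alternating sum of the images of a natural chain under the face maps. -/
theorem sum_mapTuples_eq (Φ : ∀ k j, (tuples (Fin j → ℝ)).Chain k →ₗ[ℤ] (tuples (W j)).Chain (r k))
    (m : ∀ k, Fin (k + 1) → (W k →ₗ[ℝ] W (k + 1)))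
    (hΦ : ∀ k i (z : (tuples (Fin k → ℝ)).Chain k),
      mapTuples (m k i) (r k) (Φ k k z) = Φ k (k + 1) (mapTuples (faceMap i) k z)) (k : ℕ) :
    (∑ i : Fin (k + 1), (-1 : ℤ) ^ (i : ℕ) •
      mapTuples (m k i) (r k) (Φ k k (Finsupp.single (vertexTuple k) 1))) =
      Φ k (k + 1) ((tuples (Fin (k + 1) → ℝ)).boundary k
        (Finsupp.single (vertexTuple (k + 1)) 1)) := by
  rw [boundary_single, map_sum]
  refine Finset.sum_congr rfl fun i _ => ?_
  rw [map_smul, hΦ, mapTuples_single, faceMap_comp_vertexTuple]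

end Universal

section Subdivision

variable {E : Type} [Zero E]

open Classical in
/-- The extension by zero of a function on the standard simplex. -/
def extend {k : ℕ} (σ : stdSimplex ℝ (Fin k) → E) : (Fin k → ℝ) → E :=
  fun a => if h : a ∈ stdSimplex ℝ (Fin k) then σ ⟨a, h⟩ else 0

theorem extend_apply {k : ℕ} (σ : stdSimplex ℝ (Fin k) → E) (a : stdSimplex ℝ (Fin k)) :
    extend σ a = σ a :=
  dif_pos a.2

/-- The face map takes a point into the large simplex exactly when the point lies in the small one,
so the two extensions by zero also agree off the simplex. -/
theorem extend_face {k : ℕ} (i : Fin (k + 1)) (σ : stdSimplex ℝ (Fin (k + 1)) → E) :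
    extend (σ ∘ stdSimplex.map i.succAbove) = extend σ ∘ faceMap i := by
  funext a
  by_cases h : a ∈ stdSimplex ℝ (Fin k)
  · have h' := (faceMap_mem_stdSimplex i a).2 h
    simp only [extend, h, h', Function.comp_apply, dite_true]
    rfl
  · have h' := mt (faceMap_mem_stdSimplex i a).1 h
    simp only [extend, h, h', Function.comp_apply, dite_false]

theorem push_extend_vertexTuple {k : ℕ} (σ : stdSimplex ℝ (Fin k) → E) :
    push (extend σ) (vertexTuple k) = σ := by
  funext a
  simp only [push]
  exact (congrArg (extend σ) (sum_smul_vertexTuple a)).trans (extend_apply σ a)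

/-- Barycentric subdivision of singular chains. -/
def singularSd (E : Type) [Zero E] (k : ℕ) :
    (singularSystem E).Chain k →ₗ[ℤ] (singularSystem E).Chain k :=
  universalOp (r := fun k => k) (W := fun k => Fin k → ℝ)
    (fun k => sd k (Finsupp.single (vertexTuple k) 1)) (fun _ => extend) k

/-- The chain homotopy from barycentric subdivision of singular chains to the identity. -/
def singularSdHomotopy (E : Type) [Zero E] (k : ℕ) :
    (singularSystem E).Chain k →ₗ[ℤ] (singularSystem E).Chain (k + 1) :=
  universalOp (r := fun k => k + 1) (W := fun k => Fin k → ℝ)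
    (fun k => sdHomotopy k (Finsupp.single (vertexTuple k) 1)) (fun _ => extend) k

theorem singularSd_single {k : ℕ} (σ : stdSimplex ℝ (Fin k) → E) :
    singularSd E k (Finsupp.single σ 1) =
      pushChain (extend σ) k (sd k (Finsupp.single (vertexTuple k) 1)) :=
  universalOp_single (r := fun k => k) (W := fun k => Fin k → ℝ) _ _ k σ

theorem singularSdHomotopy_single {k : ℕ} (σ : stdSimplex ℝ (Fin k) → E) :
    singularSdHomotopy E k (Finsupp.single σ 1) =
      pushChain (extend σ) (k + 1) (sdHomotopy k (Finsupp.single (vertexTuple k) 1)) :=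
  universalOp_single (r := fun k => k + 1) (W := fun k => Fin k → ℝ) _ _ k σ

theorem boundary_singularSd (k : ℕ) (z : (singularSystem E).Chain (k + 1)) :
    (singularSystem E).boundary k (singularSd E (k + 1) z) =
      singularSd E k ((singularSystem E).boundary k z) := by
  have : (singularSystem E).boundary k ∘ₗ singularSd E (k + 1) =
      singularSd E k ∘ₗ (singularSystem E).boundary k := by
    refine Finsupp.lhom_ext' fun σ => LinearMap.ext_ring ?_
    simp only [LinearMap.comp_apply, Finsupp.lsingle_apply]
    rw [singularSd_single, boundary_pushChain, boundary_sd, singularSd,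
      universalOp_boundary_single (r := fun k => k) (W := fun k => Fin k → ℝ) _ _
        (fun _ i => faceMap i) (fun _ i σ => extend_face i σ),
      sum_mapTuples_eq (r := fun k => k) (W := fun k => Fin k → ℝ) (fun k j => sd k)
        (fun _ i => faceMap i) (fun k i z => mapTuples_sd (faceMap i) k z)]
  exact LinearMap.congr_fun this z

theorem boundary_singularSdHomotopy (k : ℕ) (z : (singularSystem E).Chain (k + 1)) :
    (singularSystem E).boundary (k + 1) (singularSdHomotopy E (k + 1) z) =
      singularSd E (k + 1) z - z - singularSdHomotopy E k ((singularSystem E).boundary k z) := by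
  have : (singularSystem E).boundary (k + 1) ∘ₗ singularSdHomotopy E (k + 1) =
      singularSd E (k + 1) - LinearMap.id -
        singularSdHomotopy E k ∘ₗ (singularSystem E).boundary k := by
    refine Finsupp.lhom_ext' fun σ => LinearMap.ext_ring ?_
    simp only [LinearMap.comp_apply, Finsupp.lsingle_apply, LinearMap.sub_apply]
    rw [singularSdHomotopy_single, boundary_pushChain, boundary_sdHomotopy, map_sub, map_sub,
      singularSd_single, pushChain_single, push_extend_vertexTuple, singularSdHomotopy,
      universalOp_boundary_single (r := fun k => k + 1) (W := fun k => Fin k → ℝ) _ _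
        (fun _ i => faceMap i) (fun _ i σ => extend_face i σ),
      sum_mapTuples_eq (r := fun k => k + 1) (W := fun k => Fin k → ℝ) (fun k j => sdHomotopy k)
        (fun _ i => faceMap i) (fun k i z => mapTuples_sdHomotopy (faceMap i) k z)]
    rfl
  exact LinearMap.congr_fun this z

/-- Subdividing an affine simplex commutes with composing it with `s`. Mesh estimates for tuples
thereby control iterated singular subdivisions. -/
theorem singularSd_pushChain {V : Type} [AddCommGroup V] [Module ℝ V] (s : V → E) (k : ℕ)
    (z : (tuples V).Chain k) : singularSd E k (pushChain s k z) = pushChain s k (sd k z) := by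
  have : singularSd E k ∘ₗ pushChain s k = pushChain s k ∘ₗ sd k := by
    refine Finsupp.lhom_ext' fun v => LinearMap.ext_ring ?_
    simp only [LinearMap.comp_apply, Finsupp.lsingle_apply]
    -- A linear map taking the standard vertices to `v`; naturality of `sd` along it reduces the
    -- claim to the standard simplex.
    let rv : (Fin k → ℝ) →ₗ[ℝ] V := Fintype.linearCombination ℝ v
    have hrv : ∀ a, rv a = ∑ i, a i • v i := fun a => Fintype.linearCombination_apply ..
    have hv : rv ∘ vertexTuple k = v := by
      funext i
      simp [hrv, vertexTuple, Pi.single_apply]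
    rw [pushChain_single, singularSd_single,
      show (Finsupp.single v 1 : (tuples V).Chain k) =
        mapTuples rv k (Finsupp.single (vertexTuple k) 1) by rw [mapTuples_single, hv],
      ← mapTuples_sd, ← LinearMap.comp_apply (pushChain s k)]
    -- The extension by zero agrees with `s ∘ rv` only on the standard simplex, which suffices
    -- because subdivision stays inside it.
    refine map_eq_of_mem_supported _ _ (fun w hw => ?_)
      (sd_single_mem_supported k (vertexTuple k))
    simp only [LinearMap.comp_apply]
    rw [mapTuples_single, pushChain_single, pushChain_single, ← push_comp]
    congr 1
    funext a
    have ha := sum_smul_mem (convex_stdSimplex ℝ (Fin k))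
      (fun i => convexHull_vertexTuple_subset k (hw i)) a
    exact (extend_apply (push s v) ⟨_, ha⟩).trans (congrArg s (hrv _).symm)
  exact LinearMap.congr_fun this z

theorem pow_singularSd_pushChain {V : Type} [AddCommGroup V] [Module ℝ V] (s : V → E) (k N : ℕ)
    (z : (tuples V).Chain k) :
    (singularSd E k ^ N) (pushChain s k z) = pushChain s k ((sd k ^ N) z) := by
  induction N with
  | zero => rfl
  | succ N ih =>
    rw [pow_succ', pow_succ', Module.End.mul_apply, Module.End.mul_apply, ih, singularSd_pushChain]

theorem boundary_pow_singularSd (k N : ℕ) (z : (singularSystem E).Chain (k + 1)) :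
    (singularSystem E).boundary k ((singularSd E (k + 1) ^ N) z) =
      (singularSd E k ^ N) ((singularSystem E).boundary k z) := by
  induction N with
  | zero => rfl
  | succ N ih =>
    rw [pow_succ', pow_succ', Module.End.mul_apply, Module.End.mul_apply, boundary_singularSd, ih]

end Subdivision

/-! ### Prism operators of natural families of homotopies. -/

section Prism

variable {E : Type}

/-- The inclusion of the level `c` in the cylinder. -/
def levelMap {V : Type} (c : ℝ) : V → V × ℝ := fun v => (v, c)

/-- The prism chains of a tuple. -/
def tuplePrism {V : Type} [AddCommGroup V] [Module ℝ V] (k : ℕ) :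
    (tuples V).Chain k →ₗ[ℤ] (tuples (V × ℝ)).Chain (k + 1) :=
  homotopyOp (fun k v => (tupleBarycenter k v, 0)) (mapTuples (levelMap 0))
    (mapTuples (levelMap 1)) k

theorem boundary_tuplePrism {V : Type} [AddCommGroup V] [Module ℝ V] (k : ℕ)
    (z : (tuples V).Chain (k + 1)) :
    (tuples (V × ℝ)).boundary (k + 1) (tuplePrism (k + 1) z) =
      mapTuples (levelMap 1) (k + 1) z - mapTuples (levelMap 0) (k + 1) z -
        tuplePrism k ((tuples V).boundary k z) := by
  refine boundary_homotopyOp (fun k v => (tupleBarycenter k v, 0)) (mapTuples (levelMap 0))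
    (mapTuples (levelMap 1)) (boundary_mapTuples _) (boundary_mapTuples _) ?_ k z
  refine Finsupp.lhom_ext' fun v => LinearMap.ext_ring ?_
  simp only [LinearMap.comp_apply, Finsupp.lsingle_apply]
  rw [mapTuples_single, mapTuples_single]
  congr 1
  exact Subsingleton.elim (α := Fin 0 → V × ℝ) _ _

theorem mapTuples_tuplePrism {V V' : Type} [AddCommGroup V] [Module ℝ V] [AddCommGroup V']
    [Module ℝ V'] (m : V →ₗ[ℝ] V') (k : ℕ) (z : (tuples V).Chain k) :
    mapTuples (m.prodMap (LinearMap.id : ℝ →ₗ[ℝ] ℝ)) (k + 1) (tuplePrism k z) =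
      tuplePrism k (mapTuples m k z) := by
  have hl : ∀ (c : ℝ) (k) (z : (tuples V).Chain k),
      mapTuples (m.prodMap (LinearMap.id : ℝ →ₗ[ℝ] ℝ)) k (mapTuples (levelMap c) k z) =
        mapTuples (levelMap c) k (mapTuples m k z) := by
    intro c k z
    have : mapTuples (m.prodMap (LinearMap.id : ℝ →ₗ[ℝ] ℝ)) k ∘ₗ mapTuples (levelMap c) k =
        mapTuples (levelMap c) k ∘ₗ mapTuples m k := by
      refine Finsupp.lhom_ext' fun v => LinearMap.ext_ring ?_
      simp only [LinearMap.comp_apply, Finsupp.lsingle_apply]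
      rw [mapTuples_single, mapTuples_single, mapTuples_single, mapTuples_single]
      rfl
    exact LinearMap.congr_fun this z
  exact mapTuples_homotopyOp m _ (fun k v => (tupleBarycenter k v, 0))
    (fun k v => (tupleBarycenter k v, 0)) _ _ _ _
    (fun k v => Prod.ext (map_tupleBarycenter m _ _) rfl) (hl 0) (hl 1) k z

theorem tuplePrism_single_mem_supported {V : Type} [AddCommGroup V] [Module ℝ V] (k : ℕ)
    (v : Fin k → V) : tuplePrism k (Finsupp.single v 1) ∈ Finsupp.supported ℤ ℤ
      (tuplesIn (convexHull ℝ (Set.range v) ×ˢ Set.Icc (0 : ℝ) 1) (k + 1)) :=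
  homotopyOp_mem_supported (fun k v => (tupleBarycenter k v, 0)) (mapTuples (levelMap 0))
    (mapTuples (levelMap 1)) (fun k v => convexHull ℝ (Set.range v) ×ˢ Set.Icc (0 : ℝ) 1)
    (fun _ _ _ => Set.prod_mono (convexHull_mono (Set.range_comp_subset_range _ _)) subset_rfl)
    (fun k v => ⟨tupleBarycenter_mem_convexHull k v, by simp⟩)
    (fun k v => by
      rw [mapTuples_single]
      exact single_mem_supported fun i => ⟨subset_convexHull ℝ _ ⟨i, rfl⟩, by simp [levelMap]⟩)
    (fun k v => by
      rw [mapTuples_single]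
      exact single_mem_supported fun i => ⟨subset_convexHull ℝ _ ⟨i, rfl⟩, by simp [levelMap]⟩)
    k v

/-- The chain homotopy given by a natural family of homotopies `F` of singular simplices. -/
def prism (F : ∀ k, (stdSimplex ℝ (Fin k) → E) → (Fin k → ℝ) × ℝ → E) (k : ℕ) :
    (singularSystem E).Chain k →ₗ[ℤ] (singularSystem E).Chain (k + 1) :=
  universalOp (r := fun k => k + 1) (W := fun k => (Fin k → ℝ) × ℝ)
    (fun k => tuplePrism k (Finsupp.single (vertexTuple k) 1)) F k

theorem prism_single (F : ∀ k, (stdSimplex ℝ (Fin k) → E) → (Fin k → ℝ) × ℝ → E) {k : ℕ}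
    (σ : stdSimplex ℝ (Fin k) → E) : prism F k (Finsupp.single σ 1) =
      pushChain (F k σ) (k + 1) (tuplePrism k (Finsupp.single (vertexTuple k) 1)) :=
  universalOp_single (r := fun k => k + 1) (W := fun k => (Fin k → ℝ) × ℝ) _ _ k σ

/-- The level `c` of a natural family of homotopies. -/
def levelChain (F : ∀ k, (stdSimplex ℝ (Fin k) → E) → (Fin k → ℝ) × ℝ → E) (c : ℝ) (k : ℕ) :
    (singularSystem E).Chain k →ₗ[ℤ] (singularSystem E).Chain k :=
  Finsupp.lmapDomain ℤ ℤ fun (σ : stdSimplex ℝ (Fin k) → E) (a : stdSimplex ℝ (Fin k)) =>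
    F k σ (a, c)

theorem levelChain_single (F : ∀ k, (stdSimplex ℝ (Fin k) → E) → (Fin k → ℝ) × ℝ → E) (c : ℝ)
    {k : ℕ} (σ : stdSimplex ℝ (Fin k) → E) : levelChain F c k (Finsupp.single σ 1) =
      Finsupp.single (α := stdSimplex ℝ (Fin k) → E) (fun a => F k σ (a, c)) 1 := by
  simp [levelChain]

theorem push_levelMap {k : ℕ} (s : (Fin k → ℝ) × ℝ → E) (c : ℝ) :
    push s (levelMap c ∘ vertexTuple k) = fun a : stdSimplex ℝ (Fin k) => s (a, c) := by
  funext a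
  simp only [push, levelMap, Function.comp_apply]
  congr 1
  refine Prod.ext ?_ ?_
  · simp only [Prod.fst_sum, Prod.smul_fst]
    exact sum_smul_vertexTuple a
  · simp only [Prod.snd_sum, Prod.smul_snd, smul_eq_mul, ← Finset.sum_mul]
    rw [stdSimplex.sum_eq_one, one_mul]

theorem boundary_prism (F : ∀ k, (stdSimplex ℝ (Fin k) → E) → (Fin k → ℝ) × ℝ → E)
    (hF : ∀ k i σ, F k (σ ∘ stdSimplex.map i.succAbove) =
      F (k + 1) σ ∘ (faceMap i).prodMap LinearMap.id) (k : ℕ)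
    (z : (singularSystem E).Chain (k + 1)) :
    (singularSystem E).boundary (k + 1) (prism F (k + 1) z) =
      levelChain F 1 (k + 1) z - levelChain F 0 (k + 1) z -
        prism F k ((singularSystem E).boundary k z) := by
  have : (singularSystem E).boundary (k + 1) ∘ₗ prism F (k + 1) =
      levelChain F 1 (k + 1) - levelChain F 0 (k + 1) -
        prism F k ∘ₗ (singularSystem E).boundary k := by
    refine Finsupp.lhom_ext' fun σ => LinearMap.ext_ring ?_
    simp only [LinearMap.comp_apply, Finsupp.lsingle_apply, LinearMap.sub_apply]
    rw [prism_single, boundary_pushChain, boundary_tuplePrism, map_sub, map_sub,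
      mapTuples_single, mapTuples_single, pushChain_single, pushChain_single, push_levelMap,
      push_levelMap, levelChain_single, levelChain_single, prism,
      universalOp_boundary_single (r := fun k => k + 1) (W := fun k => (Fin k → ℝ) × ℝ) _ _
        (fun _ i => (faceMap i).prodMap LinearMap.id) hF,
      sum_mapTuples_eq (r := fun k => k + 1) (W := fun k => (Fin k → ℝ) × ℝ)
        (fun k j => tuplePrism k) (fun _ i => (faceMap i).prodMap LinearMap.id)
        (fun k i z => mapTuples_tuplePrism (faceMap i) k z)]
  exact LinearMap.congr_fun this z

end Prism

/-! ### Singular pairs and small simplices -/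

open FaceSystem Filter

section Singular

variable {E : Type} [NormedAddCommGroup E]

/-- The continuous singular simplices with values in `A`. -/
def singularSimplices (A : Set E) (k : ℕ) : Set (stdSimplex ℝ (Fin k) → E) :=
  {σ | Continuous σ ∧ ∀ a, σ a ∈ A}

/-- The continuous singular simplices of diameter at most `δ` with values in `A`. -/
def smallSimplices (A : Set E) (δ : ℝ) (k : ℕ) : Set (stdSimplex ℝ (Fin k) → E) :=
  {σ | σ ∈ singularSimplices A k ∧ ∀ a b, dist (σ a) (σ b) ≤ δ}

/-- The singular chains of `K` modulo those of `A`. -/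
def singularPair (K A : Set E) : (singularSystem E).Pair where
  total := singularSimplices K
  sub := singularSimplices A

/-- The small singular chains of `K` modulo those of `A`. -/
def smallPair (K A : Set E) (δ : ℝ) : (singularSystem E).Pair where
  total := smallSimplices K δ
  sub := smallSimplices A δ

theorem singularSimplices_mono {A B : Set E} (h : A ⊆ B) (k : ℕ) :
    singularSimplices A k ⊆ singularSimplices B k :=
  fun _ hσ => ⟨hσ.1, fun a => h (hσ.2 a)⟩

theorem smallSimplices_subset (A : Set E) (δ : ℝ) (k : ℕ) :
    smallSimplices A δ k ⊆ singularSimplices A k :=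
  fun _ hσ => hσ.1

section Push

variable {V : Type} [AddCommGroup V] [Module ℝ V] [TopologicalSpace V] [ContinuousAdd V]
  [ContinuousSMul ℝ V]

theorem push_mem_singularSimplices {C : Set V} (hC : Convex ℝ C) {s : V → E} {A : Set E}
    (hs : ContinuousOn s C) (hA : Set.MapsTo s C A) {k : ℕ} {v : Fin k → V}
    (hv : v ∈ tuplesIn C k) : push s v ∈ singularSimplices A k := by
  refine ⟨hs.comp_continuous ?_ fun a => sum_smul_mem hC hv a, fun a => hA (sum_smul_mem hC hv a)⟩
  exact continuous_finsetSum _ fun i _ =>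
    ((continuous_apply i).comp continuous_subtype_val).smul continuous_const

theorem pushChain_mem_supported {C : Set V} (hC : Convex ℝ C) {s : V → E} {A : Set E}
    (hs : ContinuousOn s C) (hA : Set.MapsTo s C A) {k : ℕ} {z : (tuples V).Chain k}
    (hz : z ∈ Finsupp.supported ℤ ℤ (tuplesIn C k)) :
    pushChain s k z ∈ Finsupp.supported ℤ ℤ (singularSimplices A k) :=
  mapDomain_mem_supported _ (fun _ hv => push_mem_singularSimplices hC hs hA hv) hz

theorem pushChain_mem_supported_small {C : Set V} (hC : Convex ℝ C) {s : V → E} {A : Set E}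
    (hs : ContinuousOn s C) (hA : Set.MapsTo s C A) {δ : ℝ}
    (hδ : ∀ a ∈ C, ∀ b ∈ C, dist (s a) (s b) ≤ δ) {k : ℕ} {z : (tuples V).Chain k}
    (hz : z ∈ Finsupp.supported ℤ ℤ (tuplesIn C k)) :
    pushChain s k z ∈ Finsupp.supported ℤ ℤ (smallSimplices A δ k) :=
  mapDomain_mem_supported (t := smallSimplices A δ k) _ (fun _ hv => ⟨push_mem_singularSimplices hC hs hA hv,
    fun a b => hδ _ (sum_smul_mem hC hv a) _ (sum_smul_mem hC hv b)⟩) hz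

end Push

theorem continuousOn_extend {k : ℕ} {σ : stdSimplex ℝ (Fin k) → E} (hσ : Continuous σ) :
    ContinuousOn (extend σ) (stdSimplex ℝ (Fin k)) := by
  rw [continuousOn_iff_continuous_domRestrict]
  exact hσ.congr fun a => (extend_apply σ a).symm

theorem mapsTo_extend {k : ℕ} {σ : stdSimplex ℝ (Fin k) → E} {A : Set E} (hσ : ∀ a, σ a ∈ A) :
    Set.MapsTo (extend σ) (stdSimplex ℝ (Fin k)) A := by
  intro a ha
  rw [show extend σ a = σ ⟨a, ha⟩ from extend_apply σ ⟨a, ha⟩]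
  exact hσ _

theorem dist_extend_le {k : ℕ} {σ : stdSimplex ℝ (Fin k) → E} {δ : ℝ}
    (hσ : ∀ a b, dist (σ a) (σ b) ≤ δ) :
    ∀ a ∈ stdSimplex ℝ (Fin k), ∀ b ∈ stdSimplex ℝ (Fin k), dist (extend σ a) (extend σ b) ≤ δ := by
  intro a ha b hb
  rw [show extend σ a = σ ⟨a, ha⟩ from extend_apply σ ⟨a, ha⟩,
    show extend σ b = σ ⟨b, hb⟩ from extend_apply σ ⟨b, hb⟩]
  exact hσ _ _

theorem sd_vertexTuple_mem_supported (k : ℕ) : sd k (Finsupp.single (vertexTuple k) 1) ∈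
    Finsupp.supported ℤ ℤ (tuplesIn (stdSimplex ℝ (Fin k)) k) :=
  Finsupp.supported_mono (tuplesIn_mono (convexHull_vertexTuple_subset k) k)
    (sd_single_mem_supported k _)

theorem sdHomotopy_vertexTuple_mem_supported (k : ℕ) :
    sdHomotopy k (Finsupp.single (vertexTuple k) 1) ∈
      Finsupp.supported ℤ ℤ (tuplesIn (stdSimplex ℝ (Fin k)) (k + 1)) :=
  Finsupp.supported_mono (tuplesIn_mono (convexHull_vertexTuple_subset k) (k + 1))
    (sdHomotopy_single_mem_supported k _)

theorem singularSd_single_mem {A : Set E} {k : ℕ} {σ : stdSimplex ℝ (Fin k) → E}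
    (hσ : σ ∈ singularSimplices A k) :
    singularSd E k (Finsupp.single σ 1) ∈ Finsupp.supported ℤ ℤ (singularSimplices A k) := by
  rw [singularSd_single]
  exact pushChain_mem_supported (convex_stdSimplex ℝ _) (continuousOn_extend hσ.1)
    (mapsTo_extend hσ.2) (sd_vertexTuple_mem_supported k)

theorem singularSd_single_mem_small {A : Set E} {δ : ℝ} {k : ℕ} {σ : stdSimplex ℝ (Fin k) → E}
    (hσ : σ ∈ smallSimplices A δ k) :
    singularSd E k (Finsupp.single σ 1) ∈ Finsupp.supported ℤ ℤ (smallSimplices A δ k) := by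
  rw [singularSd_single]
  exact pushChain_mem_supported_small (convex_stdSimplex ℝ _) (continuousOn_extend hσ.1.1)
    (mapsTo_extend hσ.1.2) (dist_extend_le hσ.2) (sd_vertexTuple_mem_supported k)

theorem singularSdHomotopy_single_mem {A : Set E} {k : ℕ} {σ : stdSimplex ℝ (Fin k) → E}
    (hσ : σ ∈ singularSimplices A k) : singularSdHomotopy E k (Finsupp.single σ 1) ∈
      Finsupp.supported ℤ ℤ (singularSimplices A (k + 1)) := by
  rw [singularSdHomotopy_single]
  exact pushChain_mem_supported (convex_stdSimplex ℝ _) (continuousOn_extend hσ.1)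
    (mapsTo_extend hσ.2) (sdHomotopy_vertexTuple_mem_supported k)

theorem singularSdHomotopy_single_mem_small {A : Set E} {δ : ℝ} {k : ℕ}
    {σ : stdSimplex ℝ (Fin k) → E} (hσ : σ ∈ smallSimplices A δ k) :
    singularSdHomotopy E k (Finsupp.single σ 1) ∈
      Finsupp.supported ℤ ℤ (smallSimplices A δ (k + 1)) := by
  rw [singularSdHomotopy_single]
  exact pushChain_mem_supported_small (convex_stdSimplex ℝ _) (continuousOn_extend hσ.1.1)
    (mapsTo_extend hσ.1.2) (dist_extend_le hσ.2) (sdHomotopy_vertexTuple_mem_supported k)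

/-- Barycentric subdivision of a singular pair. -/
def singularSdHom (K A : Set E) : Pair.Hom (singularPair K A) (singularPair K A) where
  toFun := singularSd E
  comm := boundary_singularSd
  total _ _ := singularSd_single_mem
  sub _ _ := singularSd_single_mem

/-- Barycentric subdivision of a pair of small singular chains. -/
def smallSdHom (K A : Set E) (δ : ℝ) : Pair.Hom (smallPair K A δ) (smallPair K A δ) where
  toFun := singularSd E
  comm := boundary_singularSd
  total _ _ := singularSd_single_mem_small
  sub _ _ := singularSd_single_mem_small

theorem pow_singularSd_cycles {K A : Set E} {ℓ : ℕ} {z : (singularSystem E).Chain (ℓ + 1)}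
    (hz : z ∈ (singularPair K A).cycles ℓ) (N : ℕ) :
    (singularSd E (ℓ + 1) ^ N) z ∈ (singularPair K A).cycles ℓ ∧
      (singularSd E (ℓ + 1) ^ N) z - z ∈ (singularPair K A).boundaries ℓ :=
  (singularSdHom K A).pow_cycles (fun _ hz =>
    Pair.sub_mem_boundaries LinearMap.id (singularSd E (ℓ + 1)) (singularSdHomotopy E)
      (boundary_singularSdHomotopy ℓ) (fun _ _ => singularSdHomotopy_single_mem)
      (fun _ _ => singularSdHomotopy_single_mem) hz) hz N

theorem pow_singularSd_cycles_small {K A : Set E} {δ : ℝ} {ℓ : ℕ}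
    {z : (singularSystem E).Chain (ℓ + 1)} (hz : z ∈ (smallPair K A δ).cycles ℓ) (N : ℕ) :
    (singularSd E (ℓ + 1) ^ N) z ∈ (smallPair K A δ).cycles ℓ ∧
      (singularSd E (ℓ + 1) ^ N) z - z ∈ (smallPair K A δ).boundaries ℓ :=
  (smallSdHom K A δ).pow_cycles (fun _ hz =>
    Pair.sub_mem_boundaries LinearMap.id (singularSd E (ℓ + 1)) (singularSdHomotopy E)
      (boundary_singularSdHomotopy ℓ) (fun _ _ => singularSdHomotopy_single_mem_small)
      (fun _ _ => singularSdHomotopy_single_mem_small) hz) hz N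

/-- A continuous simplex is uniformly continuous, so it is small on all pieces of a sufficiently
fine subdivision of its domain. -/
theorem eventually_pow_singularSd_single_mem_small {A : Set E} {δ : ℝ} (hδ : 0 < δ) {k : ℕ}
    {σ : stdSimplex ℝ (Fin k) → E} (hσ : σ ∈ singularSimplices A k) :
    ∀ᶠ N in atTop, (singularSd E k ^ N) (Finsupp.single σ 1) ∈
      Finsupp.supported ℤ ℤ (smallSimplices A δ k) := by
  cases k with
  -- The standard simplex on no vertices is empty, so every function on it is a small simplex.
  | zero =>
    have hempty : IsEmpty (stdSimplex ℝ (Fin 0)) :=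
      ⟨fun a => by simpa using a.2.2⟩
    refine Eventually.of_forall fun N => ?_
    have : smallSimplices A δ 0 = Set.univ :=
      Set.eq_univ_of_forall fun τ => ⟨⟨continuous_of_const fun a => hempty.elim a,
        fun a => hempty.elim a⟩, fun a => hempty.elim a⟩
    rw [this, Finsupp.supported_univ]
    trivial
  | succ k =>
    have huc : UniformContinuous σ := CompactSpace.uniformContinuous_of_continuous hσ.1
    obtain ⟨η, hη, hση⟩ := Metric.uniformContinuous_iff.1 huc δ hδ
    filter_upwards [eventually_pow_sd_mem_smallTuples (vertexTuple (k + 1)) (half_pos hη)]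
      with N hN
    rw [← push_extend_vertexTuple σ, ← pushChain_single, pow_singularSd_pushChain]
    refine mapDomain_mem_supported _ ?_ hN
    rintro w ⟨hw, hw'⟩
    have hwΔ : ∀ i, w i ∈ stdSimplex ℝ (Fin (k + 1)) :=
      fun i => convexHull_vertexTuple_subset _ (hw i)
    refine ⟨push_mem_singularSimplices (convex_stdSimplex ℝ _) (continuousOn_extend hσ.1)
      (mapsTo_extend hσ.2) hwΔ, fun a b => ?_⟩
    have ha := sum_smul_mem (convex_stdSimplex ℝ _) hwΔ a
    have hb := sum_smul_mem (convex_stdSimplex ℝ _) hwΔ b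
    have hab : dist (∑ i, a i • w i) (∑ i, b i • w i) ≤ η / 2 := by
      -- Two points of a convex hull are no further apart than some pair of vertices.
      obtain ⟨_, ⟨i, rfl⟩, _, ⟨j, rfl⟩, hij⟩ := convexHull_exists_dist_ge2
        (sum_smul_mem_convexHull w a) (sum_smul_mem_convexHull w b)
      exact hij.trans (hw' i j)
    have := hση (a := ⟨_, ha⟩) (b := ⟨_, hb⟩) (lt_of_le_of_lt hab (half_lt_self hη))
    simp only [push]
    rw [show extend σ (∑ i, a i • w i) = σ ⟨_, ha⟩ from extend_apply σ ⟨_, ha⟩,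
      show extend σ (∑ i, b i • w i) = σ ⟨_, hb⟩ from extend_apply σ ⟨_, hb⟩]
    exact this.le

theorem eventually_pow_singularSd_mem_small {A : Set E} {δ : ℝ} (hδ : 0 < δ) {k : ℕ}
    {z : (singularSystem E).Chain k} (hz : z ∈ Finsupp.supported ℤ ℤ (singularSimplices A k)) :
    ∀ᶠ N in atTop, (singularSd E k ^ N) z ∈ Finsupp.supported ℤ ℤ (smallSimplices A δ k) :=
  eventually_map_mem_of_mem_supported (fun N => singularSd E k ^ N)
    (fun _ hσ => eventually_pow_singularSd_single_mem_small hδ hσ) hz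

theorem eventually_pow_singularSd_mem_cycles {K A : Set E} {δ : ℝ} (hδ : 0 < δ) {ℓ : ℕ}
    {z : (singularSystem E).Chain (ℓ + 1)} (hz : z ∈ (singularPair K A).cycles ℓ) :
    ∀ᶠ N in atTop, (singularSd E (ℓ + 1) ^ N) z ∈ (smallPair K A δ).cycles ℓ := by
  filter_upwards [eventually_pow_singularSd_mem_small hδ hz.1,
    eventually_pow_singularSd_mem_small hδ hz.2] with N h1 h2
  refine ⟨h1, ?_⟩
  rw [SetLike.mem_coe, Submodule.mem_comap, boundary_pow_singularSd]
  exact h2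

/-- The inclusion of small chains. -/
def smallInclusion (K A : Set E) (δ : ℝ) : Pair.Hom (smallPair K A δ) (singularPair K A) :=
  Pair.Hom.ofLE (fun k => smallSimplices_subset K δ k) (fun k => smallSimplices_subset A δ k)

/-- Small singular chains compute singular homology. -/
theorem smallInclusion_bijective (K A : Set E) {δ : ℝ} (hδ : 0 < δ) (ℓ : ℕ) :
    Function.Bijective ((smallInclusion K A δ).map ℓ) := by
  constructor
  · refine (Pair.Hom.map_ofLE_injective_iff _ _ ℓ).2 fun z hz hz' => ?_
    obtain ⟨s, hs, y, hy, rfl⟩ := Pair.mem_boundaries.1 hz'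
    -- Subdividing both parts of the filling until they are small makes the subdivided cycle a small
    -- boundary; it differs from the original cycle by another small boundary.
    obtain ⟨N, h1, h2⟩ := ((eventually_pow_singularSd_mem_small hδ hs).and
      (eventually_pow_singularSd_mem_small hδ hy)).exists
    have h3 := (pow_singularSd_cycles_small hz N).2
    refine (Submodule.sub_mem_iff_right _ ?_).1 h3
    rw [map_add, ← boundary_pow_singularSd]
    exact Pair.mem_boundaries.2 ⟨_, h1, _, h2, rfl⟩
  · refine (Pair.Hom.map_ofLE_surjective_iff _ _ ℓ).2 fun z hz => ?_
    obtain ⟨N, hN⟩ := (eventually_pow_singularSd_mem_cycles hδ hz).exists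
    exact ⟨_, hN, (pow_singularSd_cycles hz N).2⟩

/-- A natural family of homotopies of singular simplices, compatible with a pair. -/
theorem levelChain_sub_mem_boundaries {P : (singularSystem E).Pair} {K A : Set E}
    (F : ∀ k, (stdSimplex ℝ (Fin k) → E) → (Fin k → ℝ) × ℝ → E)
    (hF : ∀ k i σ, F k (σ ∘ stdSimplex.map i.succAbove) =
      F (k + 1) σ ∘ (faceMap i).prodMap LinearMap.id)
    (ht : ∀ k, ∀ σ ∈ P.total k, ContinuousOn (F k σ) (stdSimplex ℝ (Fin k) ×ˢ Set.Icc 0 1) ∧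
      Set.MapsTo (F k σ) (stdSimplex ℝ (Fin k) ×ˢ Set.Icc 0 1) K)
    (hs : ∀ k, ∀ σ ∈ P.sub k, ContinuousOn (F k σ) (stdSimplex ℝ (Fin k) ×ˢ Set.Icc 0 1) ∧
      Set.MapsTo (F k σ) (stdSimplex ℝ (Fin k) ×ˢ Set.Icc 0 1) A)
    {ℓ : ℕ} {z : (singularSystem E).Chain (ℓ + 1)} (hz : z ∈ P.cycles ℓ) :
    levelChain F 1 (ℓ + 1) z - levelChain F 0 (ℓ + 1) z ∈ (singularPair K A).boundaries ℓ := by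
  have hC : ∀ k, Convex ℝ (stdSimplex ℝ (Fin k) ×ˢ Set.Icc (0 : ℝ) 1) :=
    fun k => (convex_stdSimplex ℝ _).prod (convex_Icc 0 1)
  have hsupp : ∀ k, tuplePrism k (Finsupp.single (vertexTuple k) 1) ∈
      Finsupp.supported ℤ ℤ (tuplesIn (stdSimplex ℝ (Fin k) ×ˢ Set.Icc (0 : ℝ) 1) (k + 1)) :=
    fun k => Finsupp.supported_mono (tuplesIn_mono
      (Set.prod_mono (convexHull_vertexTuple_subset k) subset_rfl) _)
      (tuplePrism_single_mem_supported k (vertexTuple k))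
  refine Pair.sub_mem_boundaries _ _ (prism F) (boundary_prism F hF ℓ)
    (fun k σ hσ => ?_) (fun k σ hσ => ?_) hz
  · rw [prism_single]
    exact pushChain_mem_supported (hC k) (ht k σ hσ).1 (ht k σ hσ).2 (hsupp k)
  · rw [prism_single]
    exact pushChain_mem_supported (hC k) (hs k σ hσ).1 (hs k σ hσ).2 (hsupp k)

end Singular

/-! ### Comparison with the relative homology of chain complexes of modules -/

open FaceSystem

section Cokernel

variable {C D : Chains} (φ : C ⟶ D)

theorem cokernel_π_surjective (i : ℕ) : Function.Surjective ((cokernel.π φ).f i).hom :=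
  (ModuleCat.epi_iff_surjective _).1 inferInstance

/-- Evaluation in a degree preserves the exactness of `C ⟶ D ⟶ D / C` at `D`. -/
theorem cokernel_π_apply_eq_zero {i : ℕ} {x : D.X i} :
    ((cokernel.π φ).f i).hom x = 0 ↔ ∃ y, (φ.f i).hom y = x := by
  constructor
  · exact (ShortComplex.moduleCat_exact_iff _).1 ((ShortComplex.exact_cokernel φ).map
      (HomologicalComplex.eval (ModuleCat.{0} ℤ) (ComplexShape.down ℕ) i)) x
  · rintro ⟨y, rfl⟩
    rw [← ModuleCat.comp_apply, ← HomologicalComplex.comp_f, cokernel.condition]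
    rfl

theorem cokernel_π_d (i j : ℕ) (x : D.X i) :
    ((cokernel φ).d i j).hom (((cokernel.π φ).f i).hom x) =
      ((cokernel.π φ).f j).hom ((D.d i j).hom x) := by
  rw [← ModuleCat.comp_apply, ← ModuleCat.comp_apply, HomologicalComplex.Hom.comm]

end Cokernel

section Homology

variable (K : Chains) (ℓ : ℕ)

theorem homologyπ_surjective : Function.Surjective (K.homologyπ ℓ).hom :=
  (ModuleCat.epi_iff_surjective _).1 inferInstance

theorem iCycles_injective : Function.Injective (K.iCycles ℓ).hom :=
  (ModuleCat.mono_iff_injective _).1 inferInstance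

theorem d_iCycles (j : ℕ) (c : K.cycles ℓ) : (K.d ℓ j).hom ((K.iCycles ℓ).hom c) = 0 := by
  rw [← ModuleCat.comp_apply, HomologicalComplex.iCycles_d]
  rfl

/-- Homology is the cokernel of the map into cycles, and cycles embed in the complex, so vanishing
of a class can be tested in the complex itself. -/
theorem homologyπ_apply_eq_zero {c : K.cycles ℓ} :
    (K.homologyπ ℓ).hom c = 0 ↔ ∃ y, (K.d (ℓ + 1) ℓ).hom y = (K.iCycles ℓ).hom c := by
  have hi : ∀ y, (K.iCycles ℓ).hom ((K.toCycles (ℓ + 1) ℓ).hom y) = (K.d (ℓ + 1) ℓ).hom y := by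
    intro y
    rw [← ModuleCat.comp_apply, HomologicalComplex.toCycles_i]
  constructor
  · intro h
    obtain ⟨y, hy⟩ := (ShortComplex.moduleCat_exact_iff _).1
      (ShortComplex.exact_of_g_is_cokernel
        (ShortComplex.mk (K.toCycles (ℓ + 1) ℓ) (K.homologyπ ℓ) (by simp))
        (K.homologyIsCokernel (ℓ + 1) ℓ (by simp))) c h
    exact ⟨y, by rw [← hi, ← hy]⟩
  · rintro ⟨y, hy⟩
    rw [← hi] at hy
    rw [← iCycles_injective K ℓ hy, ← ModuleCat.comp_apply,
      HomologicalComplex.toCycles_comp_homologyπ]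
    rfl

end Homology

/-- An identification of the inclusion of chain complexes `φ` with a pair of face systems. -/
structure PairModel {C D : Chains} (φ : C ⟶ D) {X : FaceSystem} (P : X.Pair) where
  toChain : ∀ m, D.X m →ₗ[ℤ] X.Chain (m + 1)
  injective : ∀ m, Function.Injective (toChain m)
  range_eq : ∀ m, LinearMap.range (toChain m) = Finsupp.supported ℤ ℤ (P.total (m + 1))
  map_range : ∀ m, (LinearMap.range (φ.f m).hom).map (toChain m) =
    Finsupp.supported ℤ ℤ (P.sub (m + 1))
  comm : ∀ m y, X.boundary (m + 1) (toChain (m + 1) y) = toChain m ((D.d (m + 1) m).hom y)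
  sub_zero : P.sub 0 = Set.univ

namespace PairModel

variable {C D : Chains} {φ : C ⟶ D} {X : FaceSystem} {P : X.Pair} (E : PairModel φ P)

theorem mem_sub_iff {m : ℕ} {y : D.X m} :
    E.toChain m y ∈ Finsupp.supported ℤ ℤ (P.sub (m + 1)) ↔
      ((cokernel.π φ).f m).hom y = 0 := by
  rw [cokernel_π_apply_eq_zero, ← E.map_range, Submodule.mem_map]
  constructor
  · rintro ⟨_, ⟨c, rfl⟩, hc⟩
    exact ⟨c, E.injective m hc⟩
  · rintro ⟨c, rfl⟩
    exact ⟨_, ⟨c, rfl⟩, rfl⟩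

theorem mem_cycles_iff {ℓ : ℕ} {w : D.X ℓ} : E.toChain ℓ w ∈ P.cycles ℓ ↔
    ((cokernel φ).d ℓ ((ComplexShape.down ℕ).next ℓ)).hom
      (((cokernel.π φ).f ℓ).hom w) = 0 := by
  have h1 : E.toChain ℓ w ∈ Finsupp.supported ℤ ℤ (P.total (ℓ + 1)) := by
    rw [← E.range_eq]; exact ⟨w, rfl⟩
  rw [Pair.cycles, Submodule.mem_inf, and_iff_right h1, Submodule.mem_comap]
  cases ℓ with
  -- Here the augmentation must be harmless: the empty simplex belongs to the subobject, so the
  -- condition on the augmented boundary is void, as is the one on the zero differential.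
  | zero =>
    rw [E.sub_zero, Finsupp.supported_univ, HomologicalComplex.shape _ _ _ (by simp)]
    simp
  | succ ℓ =>
    rw [E.comm, E.mem_sub_iff, ← cokernel_π_d, ChainComplex.next_nat_succ]

/-- The chain of `D` corresponding to a relative cycle. -/
def ofCycle (ℓ : ℕ) : P.cycles ℓ →ₗ[ℤ] D.X ℓ :=
  (LinearEquiv.ofInjective (E.toChain ℓ) (E.injective ℓ)).symm.toLinearMap ∘ₗ
    Submodule.inclusion (inf_le_left.trans_eq (E.range_eq ℓ).symm)

theorem toChain_ofCycle (ℓ : ℕ) (z : P.cycles ℓ) : E.toChain ℓ (E.ofCycle ℓ z) = z :=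
  congrArg Subtype.val ((LinearEquiv.ofInjective (E.toChain ℓ) (E.injective ℓ)).apply_symm_apply
    (Submodule.inclusion (inf_le_left.trans_eq (E.range_eq ℓ).symm) z))

/-- The cycle of the cokernel corresponding to a relative cycle. -/
def toCycles (ℓ : ℕ) : ModuleCat.of ℤ (P.cycles ℓ) ⟶ (cokernel φ).cycles ℓ :=
  (cokernel φ).liftCycles (ModuleCat.ofHom (E.ofCycle ℓ) ≫ (cokernel.π φ).f ℓ) _ rfl (by
    ext z
    exact E.mem_cycles_iff.1 ((E.toChain_ofCycle ℓ z).symm ▸ z.2))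

theorem iCycles_toCycles (ℓ : ℕ) (z : P.cycles ℓ) :
    ((cokernel φ).iCycles ℓ).hom ((E.toCycles ℓ).hom z) =
      ((cokernel.π φ).f ℓ).hom (E.ofCycle ℓ z) := by
  rw [← ModuleCat.comp_apply, toCycles, HomologicalComplex.liftCycles_i]
  rfl

/-- A chain bounds in the quotient complex exactly when it bounds in `D` up to a chain from `C`;
that discrepancy is the summand supported on `P.sub`. -/
theorem ker_eq (ℓ : ℕ) :
    LinearMap.ker (E.toCycles ℓ ≫ (cokernel φ).homologyπ ℓ).hom =
      (P.boundaries ℓ).submoduleOf (P.cycles ℓ) := by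
  ext z
  rw [LinearMap.mem_ker, ModuleCat.comp_apply, homologyπ_apply_eq_zero, E.iCycles_toCycles,
    Submodule.submoduleOf, Submodule.mem_comap, Pair.mem_boundaries]
  constructor
  · rintro ⟨y, hy⟩
    obtain ⟨y, rfl⟩ := cokernel_π_surjective φ _ y
    rw [cokernel_π_d, eq_comm, ← sub_eq_zero, ← map_sub, ← E.mem_sub_iff] at hy
    refine ⟨_, hy, E.toChain _ y, ?_, ?_⟩
    · rw [← E.range_eq]; exact ⟨y, rfl⟩
    · rw [map_sub, E.comm, sub_add_cancel, E.toChain_ofCycle]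
      rfl
  · rintro ⟨s, hs, y, hy, hsy⟩
    rw [← E.range_eq] at hy
    obtain ⟨y, rfl⟩ := hy
    refine ⟨((cokernel.π φ).f _).hom y, ?_⟩
    rw [cokernel_π_d, eq_comm, ← sub_eq_zero, ← map_sub, ← E.mem_sub_iff, map_sub,
      E.toChain_ofCycle, ← E.comm]
    rw [show (z : X.Chain (ℓ + 1)) = s + X.boundary (ℓ + 1) (E.toChain (ℓ + 1) y) from hsy.symm,
      add_sub_cancel_right]
    exact hs

/-- A cycle of the quotient lifts to a chain of `D`, and being a cycle in the quotient makes the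
lift a relative cycle. -/
theorem toHomology_surjective (ℓ : ℕ) :
    Function.Surjective (E.toCycles ℓ ≫ (cokernel φ).homologyπ ℓ).hom := by
  intro h
  obtain ⟨c, rfl⟩ := homologyπ_surjective _ ℓ h
  obtain ⟨w, hw⟩ := cokernel_π_surjective φ ℓ (((cokernel φ).iCycles ℓ).hom c)
  have hcyc : E.toChain ℓ w ∈ P.cycles ℓ := by
    rw [E.mem_cycles_iff, hw]
    exact d_iCycles _ ℓ _ c
  refine ⟨⟨_, hcyc⟩, ?_⟩
  rw [ModuleCat.comp_apply]
  congr 1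
  apply iCycles_injective
  rw [E.iCycles_toCycles, ← hw]
  congr 1
  exact E.injective ℓ (E.toChain_ofCycle ℓ _)

/-- The homology of a pair is the relative homology of its model. -/
def homologyEquiv (ℓ : ℕ) : P.Homology ℓ ≃ₗ[ℤ] relativeHomology φ ℓ :=
  (Submodule.quotEquivOfEq _ _ (E.ker_eq ℓ).symm).trans
    (LinearMap.quotKerEquivOfSurjective _ (E.toHomology_surjective ℓ))

theorem homologyEquiv_mk (ℓ : ℕ) {z : X.Chain (ℓ + 1)} (hz : z ∈ P.cycles ℓ) :
    E.homologyEquiv ℓ (P.homologyMk z hz) =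
      ((cokernel φ).homologyπ ℓ).hom ((E.toCycles ℓ).hom ⟨z, hz⟩) := rfl

theorem homologyEquiv_naturality {C' D' : Chains} {φ' : C' ⟶ D'} {P' : X.Pair}
    (E' : PairModel φ' P') (f : C ⟶ C') (g : D ⟶ D') (w : φ ≫ g = f ≫ φ')
    (hg : ∀ m y, E'.toChain m ((g.f m).hom y) = E.toChain m y)
    (ht : ∀ k, P.total k ⊆ P'.total k) (hs : ∀ k, P.sub k ⊆ P'.sub k) (ℓ : ℕ)
    (h : P.Homology ℓ) : (relativeHomologyMap f g w ℓ).hom (E.homologyEquiv ℓ h) =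
      E'.homologyEquiv ℓ ((Pair.Hom.ofLE ht hs).map ℓ h) := by
  obtain ⟨z, hz, rfl⟩ := Pair.exists_homologyMk h
  rw [Pair.Hom.map_mk, homologyEquiv_mk, homologyEquiv_mk]
  have h1 : ∀ c, (relativeHomologyMap f g w ℓ).hom (((cokernel φ).homologyπ ℓ).hom c) =
      ((cokernel φ').homologyπ ℓ).hom
        ((HomologicalComplex.cyclesMap (cokernel.map φ φ' f g w) ℓ).hom c) := by
    intro c
    rw [← ModuleCat.comp_apply, ← HomologicalComplex.homologyπ_naturality]
    rfl
  rw [h1]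
  congr 1
  apply iCycles_injective
  rw [← ModuleCat.comp_apply, HomologicalComplex.cyclesMap_i, ModuleCat.comp_apply,
    E.iCycles_toCycles, E'.iCycles_toCycles, ← ModuleCat.comp_apply, ← HomologicalComplex.comp_f,
    cokernel.π_desc, HomologicalComplex.comp_f, ModuleCat.comp_apply]
  congr 1
  apply E'.injective
  rw [hg, E.toChain_ofCycle, E'.toChain_ofCycle]
  rfl

end PairModel

/-! ### Chains of a simplicial set as finitely supported functions. -/

section SimplicialSets

theorem sum_zsmul_hom_apply {A B : ModuleCat.{0} ℤ} {ι : Type} [Fintype ι] (n : ι → ℤ)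
    (f : ι → (A ⟶ B)) (a : A) : (∑ i, n i • f i).hom a = ∑ i, n i • (f i).hom a := by
  rw [ModuleCat.hom_sum, LinearMap.sum_apply]
  rfl

variable (Z : SSet.{0})

/-- The generator of the chains of a simplicial set given by a simplex. -/
def generator {m : ℕ} (x : Z.obj (Opposite.op (SimplexCategory.mk m))) :
    (Z.chainComplex (ModuleCat.of ℤ ℤ)).X m :=
  (Z.ιChainComplex (R := ModuleCat.of ℤ ℤ) x).hom (1 : ℤ)

/-- The linear map from chains of a simplicial set induced by a map of sets. -/
def ssetToChain {α : Type} {m : ℕ} (e : Z.obj (Opposite.op (SimplexCategory.mk m)) → α) :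
    (Z.chainComplex (ModuleCat.of ℤ ℤ)).X m →ₗ[ℤ] (α →₀ ℤ) :=
  ((Z.isColimitChainComplexXCofan (ModuleCat.of ℤ ℤ) m).desc
    (Cofan.mk (ModuleCat.of ℤ (α →₀ ℤ)) (fun x => ModuleCat.ofHom
      (LinearMap.toSpanSingleton ℤ (α →₀ ℤ) (Finsupp.single (e x) 1))))).hom

theorem ssetToChain_generator {α : Type} {m : ℕ}
    (e : Z.obj (Opposite.op (SimplexCategory.mk m)) → α) (x) :
    ssetToChain Z e (generator Z x) = Finsupp.single (e x) 1 := by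
  have := (Z.isColimitChainComplexXCofan (ModuleCat.of ℤ ℤ) m).fac
    (Cofan.mk (ModuleCat.of ℤ (α →₀ ℤ)) (fun x => ModuleCat.ofHom
      (LinearMap.toSpanSingleton ℤ (α →₀ ℤ) (Finsupp.single (e x) 1)))) ⟨x⟩
  have h2 := LinearMap.congr_fun (congrArg ModuleCat.Hom.hom this) (1 : ℤ)
  refine Eq.trans h2 ?_
  exact one_smul ℤ _

variable {Z}

/-- The chains are a coproduct of copies of `ℤ` indexed by the simplices, and a map out of `ℤ` is
determined at `1`. -/
theorem sset_linearMap_ext {m : ℕ} {M : Type} [AddCommGroup M] [Module ℤ M]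
    {f g : (Z.chainComplex (ModuleCat.of ℤ ℤ)).X m →ₗ[ℤ] M}
    (h : ∀ x, f (generator Z x) = g (generator Z x)) : f = g := by
  have : ModuleCat.ofHom f = ModuleCat.ofHom (Y := M) g := by
    refine SSet.chainComplex_hom_ext fun x => ?_
    ext
    exact h x
  exact congrArg ModuleCat.Hom.hom this

theorem linearCombination_generator {m : ℕ}
    (y : (Z.chainComplex (ModuleCat.of ℤ ℤ)).X m) :
    Finsupp.linearCombination ℤ (generator Z (m := m)) (ssetToChain Z id y) = y := by
  have h2 : Finsupp.linearCombination ℤ (generator Z (m := m)) ∘ₗ ssetToChain Z id =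
      LinearMap.id := by
    refine sset_linearMap_ext fun x => ?_
    rw [LinearMap.comp_apply, ssetToChain_generator, Finsupp.linearCombination_single]
    exact @one_smul ℤ _ _ (_) _
  exact LinearMap.congr_fun h2 y

theorem generator_span (m : ℕ) : Submodule.span ℤ (Set.range (generator Z (m := m))) = ⊤ := by
  rw [eq_top_iff]
  intro y _
  rw [← Finsupp.range_linearCombination]
  exact ⟨_, linearCombination_generator y⟩

theorem range_ssetToChain {α : Type} {m : ℕ}
    (e : Z.obj (Opposite.op (SimplexCategory.mk m)) → α) :
    LinearMap.range (ssetToChain Z e) = Finsupp.supported ℤ ℤ (Set.range e) := by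
  rw [LinearMap.range_eq_map, ← generator_span, Submodule.map_span, Finsupp.supported_eq_span_single,
    ← Set.range_comp, ← Set.range_comp]
  congr 2
  funext x
  exact ssetToChain_generator Z e x

/-- For the identity indexing, recombining the generators is a left inverse; an injective
relabelling of the basis keeps injectivity. -/
theorem injective_ssetToChain {α : Type} {m : ℕ}
    {e : Z.obj (Opposite.op (SimplexCategory.mk m)) → α} (he : Function.Injective e) :
    Function.Injective (ssetToChain Z e) := by
  have h1 : ssetToChain Z e = Finsupp.lmapDomain ℤ ℤ e ∘ₗ ssetToChain Z id :=
    sset_linearMap_ext fun x => by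
      rw [LinearMap.comp_apply, ssetToChain_generator, ssetToChain_generator]
      simp
  rw [h1, LinearMap.coe_comp]
  exact (Finsupp.mapDomain_injective he).comp
    (Function.LeftInverse.injective (g := Finsupp.linearCombination ℤ (generator Z (m := m)))
      linearCombination_generator)

theorem ssetToChain_chainComplexMap {Y : SSet.{0}} (i : Y ⟶ Z) {α : Type} {m : ℕ}
    (e : Z.obj (Opposite.op (SimplexCategory.mk m)) → α) :
    ssetToChain Z e ∘ₗ ((SSet.chainComplexMap i (ModuleCat.of ℤ ℤ)).f m).hom =
      ssetToChain Y (e ∘ i.app _) :=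
  sset_linearMap_ext fun y => by
    rw [LinearMap.comp_apply, ssetToChain_generator, generator, ← ModuleCat.comp_apply,
      SSet.ι_chainComplexMap_f]
    exact ssetToChain_generator Z e _

theorem d_generator {m : ℕ} (x : Z.obj (Opposite.op (SimplexCategory.mk (m + 1)))) :
    ((Z.chainComplex (ModuleCat.of ℤ ℤ)).d (m + 1) m).hom (generator Z x) =
      ∑ i : Fin (m + 2), (-1 : ℤ) ^ (i : ℕ) • generator Z (SimplicialObject.δ Z i x) := by
  rw [generator, ← ModuleCat.comp_apply, SSet.ιChainComplex_d]
  exact sum_zsmul_hom_apply _ _ _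

/-- A pair of face systems as a model of an inclusion of simplicial sets. -/
def PairModel.ofSSet {Y : SSet.{0}} (i : Y ⟶ Z) {X : FaceSystem} (P : X.Pair)
    (e : ∀ m, Z.obj (Opposite.op (SimplexCategory.mk m)) → X.simplex (m + 1))
    (he : ∀ m, Function.Injective (e m))
    (htotal : ∀ m, Set.range (e m) = P.total (m + 1))
    (hsub : ∀ m, Set.range (e m ∘ i.app (Opposite.op (SimplexCategory.mk m))) = P.sub (m + 1))
    (hface : ∀ m (j : Fin (m + 2)) x,
      X.face j (e (m + 1) x) = e m (SimplicialObject.δ Z j x))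
    (hzero : P.sub 0 = Set.univ) :
    PairModel (SSet.chainComplexMap i (ModuleCat.of ℤ ℤ)) P where
  toChain m := ssetToChain Z (e m)
  injective m := injective_ssetToChain (he m)
  range_eq m := by rw [range_ssetToChain, htotal]
  map_range m := by
    rw [← LinearMap.range_comp, ssetToChain_chainComplexMap, range_ssetToChain, hsub]
  comm m y := by
    have : X.boundary (m + 1) ∘ₗ ssetToChain Z (e (m + 1)) =
        ssetToChain Z (e m) ∘ₗ ((Z.chainComplex (ModuleCat.of ℤ ℤ)).d (m + 1) m).hom :=
      sset_linearMap_ext fun x => by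
        rw [LinearMap.comp_apply, LinearMap.comp_apply, ssetToChain_generator, boundary_single,
          d_generator, map_sum]
        refine Finset.sum_congr rfl fun j _ => ?_
        rw [map_zsmul, ssetToChain_generator, hface]
    exact LinearMap.congr_fun this y
  sub_zero := hzero

end SimplicialSets

/-! ### Models of the singular chains and of the ordered chains -/

open FaceSystem

section Singular

variable {E : Type} [NormedAddCommGroup E] (K : Set E)

/-- The function underlying a singular simplex of a subset of `E`. -/
def underlyingSimplex (m : ℕ)
    (σ : (TopCat.toSSet.obj (TopCat.of K)).obj (Opposite.op (SimplexCategory.mk m))) :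
    (singularSystem E).simplex (m + 1) :=
  fun a => ((TopCat.toSSetObjEquiv _ _ σ a : K) : E)

theorem underlyingSimplex_injective (m : ℕ) : Function.Injective (underlyingSimplex K m) := by
  intro σ τ h
  apply (TopCat.toSSetObjEquiv _ _).injective
  ext a
  exact congrFun h a

/-- Singular homology of a subset of `E` in terms of functions with values in `E`. -/
def singularModel (A : Set K) {B : Set E} (hB : Subtype.val '' A = B) :
    PairModel (((AlgebraicTopology.singularChainComplexFunctor (ModuleCat.{0} ℤ)).obj
      (ModuleCat.of ℤ ℤ)).map (TopPair.ofSubset (X := TopCat.of K) A).map) (singularPair K B) :=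
  PairModel.ofSSet (TopCat.toSSet.map (TopPair.ofSubset (X := TopCat.of K) A).map) _
    (underlyingSimplex K) (underlyingSimplex_injective K)
    (fun m => by
      ext σ
      constructor
      · rintro ⟨σ, rfl⟩
        exact ⟨continuous_subtype_val.comp (TopCat.toSSetObjEquiv _ _ σ).continuous,
          fun a => Subtype.coe_prop _⟩
      · rintro ⟨h1, h2⟩
        exact ⟨(TopCat.toSSetObjEquiv (TopCat.of K) _).symm
          ⟨fun a => ⟨σ a, h2 a⟩, h1.subtype_mk _⟩, rfl⟩)
    (fun m => by
      subst hB
      ext σ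
      constructor
      · rintro ⟨σ, rfl⟩
        refine ⟨continuous_subtype_val.comp (continuous_subtype_val.comp
          (TopCat.toSSetObjEquiv (TopCat.of A) _ σ).continuous), fun a => ?_⟩
        exact ⟨(TopCat.toSSetObjEquiv (TopCat.of A) _ σ a).1,
          (TopCat.toSSetObjEquiv (TopCat.of A) _ σ a).2, rfl⟩
      · rintro ⟨h1, h2⟩
        choose f hf hfσ using h2
        have hc : Continuous f :=
          Topology.IsInducing.subtypeVal.continuous_iff.2 (by simpa [Function.comp_def, hfσ])
        exact ⟨(TopCat.toSSetObjEquiv (TopCat.of A) _).symm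
          ⟨fun a => ⟨f a, hf a⟩, hc.subtype_mk _⟩, funext hfσ⟩)
    (fun _ _ _ => rfl)
    (by
      have : IsEmpty (stdSimplex ℝ (Fin 0)) := ⟨fun a => by simpa using a.2.2⟩
      ext σ
      exact ⟨fun _ => trivial, fun _ => ⟨continuous_of_discreteTopology, fun a => isEmptyElim a⟩⟩)

end Singular

section Ordered

variable {V : Type}

/-- A pair of sets of tuples consisting of the ordered simplices of a pair of complexes. -/
structure IsOrderedPair (S : ComplexPair V) (Q : (tuples V).Pair) : Prop where
  total : ∀ m (v : Fin (m + 1) → V),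
    v ∈ Q.total (m + 1) ↔ (Set.finite_range v).toFinset ∈ S.total.faces
  sub : ∀ m (v : Fin (m + 1) → V),
    v ∈ Q.sub (m + 1) ↔ (Set.finite_range v).toFinset ∈ S.sub.faces
  sub_zero : Q.sub 0 = Set.univ

/-- Simplicial homology of a pair of complexes in terms of tuples of vertices. -/
def orderedModel {S : ComplexPair V} {Q : (tuples V).Pair} (h : IsOrderedPair S Q) :
    PairModel (orderedChainsMap S.sub_le) Q :=
  PairModel.ofSSet (orderedInclusion S.sub_le) Q (fun _ v => v.1)
    (fun _ => Subtype.val_injective)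
    (fun m => by
      ext v
      exact ⟨by rintro ⟨v, rfl⟩; exact (h.total m _).2 v.2,
        fun hv => ⟨⟨v, (h.total m v).1 hv⟩, rfl⟩⟩)
    (fun m => by
      ext v
      exact ⟨by rintro ⟨v, rfl⟩; exact (h.sub m _).2 v.2,
        fun hv => ⟨⟨v, (h.sub m v).1 hv⟩, rfl⟩⟩)
    (fun _ _ _ => rfl) h.sub_zero

/-- The image of a map induced by an inclusion of pairs of complexes, in terms of tuples. -/
theorem IsOrderedPair.rangeEquiv {S S' : ComplexPair V} (h : S ≤ S') {Q Q' : (tuples V).Pair}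
    (hQ : IsOrderedPair S Q) (hQ' : IsOrderedPair S' Q')
    (hT : ∀ k, Q.total k ⊆ Q'.total k) (hS : ∀ k, Q.sub k ⊆ Q'.sub k) (ℓ : ℕ) :
    Nonempty (LinearMap.range (ComplexPair.homologyMap h ℓ).hom ≃+
      LinearMap.range ((Pair.Hom.ofLE hT hS).map ℓ)) := by
  let M := orderedModel hQ
  let M' := orderedModel hQ'
  have key : ∀ y, (ComplexPair.homologyMap h ℓ).hom (M.homologyEquiv ℓ y) =
      M'.homologyEquiv ℓ ((Pair.Hom.ofLE hT hS).map ℓ y) :=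
    M.homologyEquiv_naturality M' (orderedChainsMap h.2) (orderedChainsMap h.1) _
      (fun m y => LinearMap.congr_fun (ssetToChain_chainComplexMap (orderedInclusion h.1) _) y)
      hT hS ℓ
  let e : Q'.Homology ℓ ≃ₗ[ℤ] S'.homology ℓ := M'.homologyEquiv ℓ
  have hr : (LinearMap.range ((Pair.Hom.ofLE hT hS).map ℓ)).map
      e.toLinearMap =
      LinearMap.range (ComplexPair.homologyMap h ℓ).hom := by
    ext z
    constructor
    · rintro ⟨_, ⟨y, rfl⟩, rfl⟩
      exact ⟨_, key y⟩
    · rintro ⟨y, rfl⟩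
      obtain ⟨y, rfl⟩ := (M.homologyEquiv ℓ).surjective y
      exact ⟨_, ⟨y, rfl⟩, (key y).symm⟩
  rw [← hr]
  exact ⟨(e.toAddEquiv.addSubmonoidMap
    (LinearMap.range ((Pair.Hom.ofLE hT hS).map ℓ)).toAddSubmonoid).symm⟩

end Ordered

/-! ### Nearest points on a submanifold -/

open Filter Topology

/-- By compactness only cluster points of `π` at `q` matter. Passing to the limit in `dist q' (π q')
= infDist q' K` shows that such a point is nearest to `q`, hence equals `π q`. -/
theorem continuousOn_of_unique_nearest {X : Type} [MetricSpace X] {K : Set X}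
    (hK : IsCompact K) {α : ℝ} {π : X → X}
    (mem : ∀ q, π q ∈ K) (dist_eq : ∀ q, dist q (π q) = Metric.infDist q K)
    (unique : ∀ q y, Metric.infDist q K < α → y ∈ K → dist q y = Metric.infDist q K → π q = y) :
    ContinuousOn π {q | Metric.infDist q K < α} := by
  intro q hq
  refine ContinuousAt.continuousWithinAt ?_
  refine hK.tendsto_nhds_of_unique_mapClusterPt (Eventually.of_forall mem) fun z hz hzq => ?_
  obtain ⟨U, hU, hUz⟩ := mapClusterPt_iff_ultrafilter.1 hzq
  refine (unique q z hq hz ?_).symm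
  have h1 : Tendsto (fun q' => dist q' (π q')) U (𝓝 (dist q z)) :=
    Tendsto.dist (tendsto_id.mono_left hU) hUz
  simp only [dist_eq] at h1
  exact tendsto_nhds_unique h1 (((Metric.continuous_infDist_pt K).tendsto q).mono_left hU)

/-! ### Tangent curves and the normality of nearest point displacements. -/

section Normal

variable {E : Type} [NormedAddCommGroup E] [InnerProductSpace ℝ E] [FiniteDimensional ℝ E]

theorem tangentConeAt_submodule_subset (W : Submodule ℝ E) {y : E} (hy : y ∈ W) :
    tangentConeAt ℝ (W : Set E) y ⊆ W := by
  intro w hw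
  obtain ⟨ι, l, hl, c, d, -, hd, hcd⟩ := exists_fun_of_mem_tangentConeAt hw
  refine (Submodule.closed_of_finiteDimensional W).mem_of_tendsto hcd ?_
  filter_upwards [hd] with n hn
  exact W.smul_mem _ (by simpa using W.sub_mem hn hy)

/-- A tangent vector of a submanifold is the velocity of a curve in the submanifold. -/
theorem IsClosedSubmanifold.exists_curve {K : Set E} (hK : IsClosedSubmanifold K) {y w : E}
    (hy : y ∈ K) (hw : w ∈ tangentConeAt ℝ K y) :
    ∃ γ : ℝ → E, γ 0 = y ∧ (∀ᶠ s in 𝓝 0, γ s ∈ K) ∧ HasDerivAt γ w 0 := by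
  obtain ⟨φ, W, hys, hφ, hφ', hW⟩ := hK.locally_flat y hy
  have hyt : φ y ∈ φ.target := φ.map_source hys
  have hKs : ∀ z ∈ φ.source ∩ K, φ z ∈ W := fun z hz => (hW ▸ Set.mem_image_of_mem φ hz).2
  have hd : DifferentiableAt ℝ φ y :=
    (hφ.contDiffAt (φ.open_source.mem_nhds hys)).differentiableAt (by simp)
  have hd' : DifferentiableAt ℝ φ.symm (φ y) :=
    (hφ'.contDiffAt (φ.open_target.mem_nhds hyt)).differentiableAt (by simp)
  -- The chart straightens `K` to `W`, so `w` becomes a vector of the subspace; the curve is the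
  -- inverse image of the line in that direction.
  have hu : fderiv ℝ φ y w ∈ W := by
    refine tangentConeAt_submodule_subset W (hKs y ⟨hys, hy⟩) ?_
    have h1 : w ∈ tangentConeAt ℝ (K ∩ φ.source) y := by
      rwa [tangentConeAt_inter_nhds (φ.open_source.mem_nhds hys)]
    refine tangentConeAt_mono ?_ (hd.hasFDerivAt.hasFDerivWithinAt.mapsTo_tangent_cone h1)
    rintro _ ⟨z, hz, rfl⟩
    exact hKs z hz.symm
  have hinv : fderiv ℝ φ.symm (φ y) (fderiv ℝ φ y w) = w := by
    have h1 : HasFDerivAt (φ.symm ∘ φ) ((fderiv ℝ φ.symm (φ y)).comp (fderiv ℝ φ y)) y :=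
      hd'.hasFDerivAt.comp y hd.hasFDerivAt
    have h2 : HasFDerivAt (φ.symm ∘ φ) (ContinuousLinearMap.id ℝ E) y :=
      (hasFDerivAt_id y).congr_of_eventuallyEq (φ.eventually_left_inverse hys)
    exact DFunLike.congr_fun (h1.unique h2) w
  have hl : HasDerivAt (fun s : ℝ => φ y + s • fderiv ℝ φ y w) (fderiv ℝ φ y w) 0 := by
    simpa using ((hasDerivAt_id (0 : ℝ)).smul_const (fderiv ℝ φ y w)).const_add (φ y)
  refine ⟨fun s => φ.symm (φ y + s • fderiv ℝ φ y w), by simp [φ.left_inv hys], ?_, ?_⟩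
  · have h1 : ∀ᶠ s : ℝ in 𝓝 0, φ y + s • fderiv ℝ φ y w ∈ φ.target :=
      hl.continuousAt.eventually_mem (φ.open_target.mem_nhds (by simpa using hyt))
    filter_upwards [h1] with s hs
    have h2 : φ y + s • fderiv ℝ φ y w ∈ φ '' (φ.source ∩ K) :=
      hW ▸ ⟨hs, W.add_mem (hKs y ⟨hys, hy⟩) (W.smul_mem _ hu)⟩
    obtain ⟨z, hz, hz'⟩ := h2
    rw [← hz', φ.left_inv hz.1]
    exact hz.2
  · have h1 : HasFDerivAt φ.symm (fderiv ℝ φ.symm (φ y)) (φ y + (0 : ℝ) • fderiv ℝ φ y w) := by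
      simpa using hd'.hasFDerivAt
    simpa [hinv, Function.comp_def] using h1.comp_hasDerivAt (0 : ℝ) hl

/-- The difference of a point and a closest point of a submanifold is normal. -/
theorem IsClosedSubmanifold.sub_mem_normalSpace {K : Set E} (hK : IsClosedSubmanifold K) {q y : E}
    (hy : y ∈ K) (h : ∀ z ∈ K, dist q y ≤ dist q z) : q - y ∈ normalSpace K y := by
  rw [normalSpace, Submodule.mem_orthogonal]
  intro w hw
  induction hw using Submodule.span_induction with
  | zero => simp
  | add u v _ _ hu hv => rw [inner_add_left, hu, hv, add_zero]
  | smul a u _ hu => rw [inner_smul_left, hu, mul_zero]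
  | mem w hw =>
    obtain ⟨γ, h0, hγ, hγ'⟩ := hK.exists_curve hy hw
    -- The squared distance to `q` along a curve in `K` is minimal at `0`, and its derivative there
    -- is `-2⟪q - y, w⟫`.
    have hmin : IsLocalMin (fun s => ‖q - γ s‖ ^ 2) 0 := by
      filter_upwards [hγ] with s hs
      rw [h0, ← dist_eq_norm, ← dist_eq_norm]
      exact pow_le_pow_left₀ dist_nonneg (h _ hs) 2
    have hd := hmin.hasDerivAt_eq_zero (hγ'.const_sub q).norm_sq
    simp only [h0, inner_neg_right] at hd
    rw [real_inner_comm]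
    linarith

end Normal

/-! ### The nearest point projection on a tube, and stretching. -/

section Tube

variable {E : Type} [NormedAddCommGroup E] [InnerProductSpace ℝ E]

/-- A function `π` which is the nearest point projection to `K`, well behaved on the open tube of
radius `α` about `K`. -/
structure IsTube (K : Set E) (α : ℝ) (π : E → E) : Prop where
  mem : ∀ q, π q ∈ K
  dist_eq : ∀ q, dist q (π q) = Metric.infDist q K
  unique : ∀ q y, Metric.infDist q K < α → y ∈ K → dist q y = Metric.infDist q K → π q = y
  continuousOn : ContinuousOn π {q | Metric.infDist q K < α}
  fiber : ∀ (q : E) (s : ℝ), Metric.infDist q K < α → |s| * dist q (π q) < α →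
    π (π q + s • (q - π q)) = π q

/-- Embeddedness says that a point is the tip of at most one normal vector shorter than `α`. A
nearest point is the foot of such a vector, which gives uniqueness. For a point moved along its
normal line, the old foot and its own nearest point are two such feet, so they coincide. -/
theorem IsClosedSubmanifold.exists_tube [FiniteDimensional ℝ E] {K : Set E}
    (hK : IsClosedSubmanifold K) (hne : K.Nonempty) {m : ℝ} (hm : ENNReal.ofReal m < reach K) :
    ∃ α π, m < α ∧ IsTube K α π := by
  obtain ⟨α, hα⟩ := lt_iSup_iff.1 hm
  obtain ⟨⟨hα0, hemb⟩, hmα⟩ := lt_iSup_iff.1 hα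
  choose π mem dist_eq using fun q => hK.isCompact.exists_infDist_eq_dist hne q
  have hinj : ∀ y ∈ K, ∀ z ∈ K, ∀ q, q - y ∈ normalSpace K y → q - z ∈ normalSpace K z →
      dist q y < α → dist q z < α → y = z := by
    intro y hy z hz q hqy hqz h1 h2
    have := @hemb.injective ⟨(y, q - y), hy, hqy, by rwa [← dist_eq_norm]⟩
      ⟨(z, q - z), hz, hqz, by rwa [← dist_eq_norm]⟩ (by simp)
    exact congrArg Prod.fst (congrArg Subtype.val this)
  have hnormal : ∀ q y, y ∈ K → dist q y = Metric.infDist q K → q - y ∈ normalSpace K y :=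
    fun q y hy h => hK.sub_mem_normalSpace hy fun z hz => h ▸ Metric.infDist_le_dist_of_mem hz
  have unique : ∀ q y, Metric.infDist q K < α → y ∈ K → dist q y = Metric.infDist q K →
      π q = y := fun q y hq hy h =>
    hinj _ (mem q) _ hy q (hnormal q _ (mem q) (dist_eq q).symm) (hnormal q y hy h)
      (dist_eq q ▸ hq) (h ▸ hq)
  refine ⟨α, π, ?_, mem, fun q => (dist_eq q).symm, unique,
    continuousOn_of_unique_nearest hK.isCompact mem (fun q => (dist_eq q).symm) unique, ?_⟩
  · rw [← ENNReal.ofReal_coe_nnreal] at hmα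
    exact (ENNReal.ofReal_lt_ofReal_iff'.1 hmα).1
  · intro q s hq hs
    set q' := π q + s • (q - π q) with hq'
    have hd : dist q' (π q) < α := by
      rw [dist_eq_norm, hq', add_sub_cancel_left, norm_smul, ← dist_eq_norm]
      exact hs
    refine hinj _ (mem q') _ (mem q) q' (hnormal q' _ (mem q') (dist_eq q').symm) ?_ ?_ hd
    · rw [hq', add_sub_cancel_left]
      exact Submodule.smul_mem _ _ (hnormal q _ (mem q) (dist_eq q).symm)
    · rw [← dist_eq q']
      exact (Metric.infDist_le_dist_of_mem (mem q)).trans_lt hd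

namespace IsTube

variable {K : Set E} {α : ℝ} {π : E → E}

theorem dist_le (h : IsTube K α π) (q : E) {y : E} (hy : y ∈ K) : dist q (π q) ≤ dist q y :=
  h.dist_eq q ▸ Metric.infDist_le_dist_of_mem hy

theorem apply_of_mem (h : IsTube K α π) {y : E} (hy : y ∈ K) : π y = y := by
  have := h.dist_le y hy
  rw [dist_self] at this
  exact (dist_le_zero.1 this).symm

/-- The retraction of `K` away from `x` which stretches distances to `x` and projects back. -/
theorem dist_le_dist_stretch (h : IsTube K α π) {x y : E} (hy : y ∈ K) {τ : ℝ} (hτ : 0 ≤ τ) :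
    dist y x ≤ dist (π (x + (1 + τ) • (y - x))) x := by
  set q := x + (1 + τ) • (y - x) with hq
  have h1 : dist q x = (1 + τ) * dist y x := by
    rw [dist_eq_norm, dist_eq_norm, hq, add_sub_cancel_left, norm_smul, Real.norm_eq_abs,
      abs_of_nonneg (by linarith)]
  have h2 : dist q y = τ * dist y x := by
    rw [dist_eq_norm, dist_eq_norm, hq, show x + (1 + τ) • (y - x) - y = τ • (y - x) by module,
      norm_smul, Real.norm_eq_abs, abs_of_nonneg hτ]
  have h3 := h.dist_le q hy
  have h4 := dist_triangle q (π q) x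
  linarith

/-- Equality in the triangle estimate forces `π q = y`, so `q - y` is a normal displacement. The
midpoint of `x` and `y` lies on that normal line at distance less than `α`, so it projects to `y`;
but `x` is equally near. -/
theorem dist_lt_dist_stretch (h : IsTube K α π) {x y : E} (hx : x ∈ K) (hy : y ∈ K) {τ : ℝ}
    (hτ : 0 < τ) (hτα : τ * dist y x < α) (hxy : x ≠ y) (hd : dist y x < 2 * α) :
    dist y x < dist (π (x + (1 + τ) • (y - x))) x := by
  refine lt_of_le_of_ne (h.dist_le_dist_stretch hy hτ.le) fun heq => hxy ?_
  set q := x + (1 + τ) • (y - x) with hq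
  have h1 : dist q x = (1 + τ) * dist y x := by
    rw [dist_eq_norm, dist_eq_norm, hq, add_sub_cancel_left, norm_smul, Real.norm_eq_abs,
      abs_of_nonneg (by linarith)]
  have hqy : q - y = τ • (y - x) := by rw [hq]; module
  have h2 : dist q y = τ * dist y x := by
    rw [dist_eq_norm, hqy, norm_smul, Real.norm_eq_abs, abs_of_nonneg hτ.le, ← dist_eq_norm]
  have h3 := h.dist_le q hy
  have h4 := dist_triangle q (π q) x
  have h5 : dist q y = Metric.infDist q K := by
    rw [← h.dist_eq]
    linarith
  have hq : Metric.infDist q K < α := by rw [← h5, h2]; exact hτα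
  have hπ : π q = y := h.unique q y hq hy h5
  -- Since `q - y = τ • (y - x)`, this multiplier moves from `y` to the midpoint of `x` and `y`.
  have hm := h.fiber q (-(2 * τ)⁻¹) hq (by
    rw [hπ, h2, abs_neg, abs_of_pos (by positivity)]
    field_simp
    linarith)
  rw [hπ, hqy, smul_smul, show -(2 * τ)⁻¹ * τ = -2⁻¹ by field_simp] at hm
  set m := y + (-2⁻¹ : ℝ) • (y - x) with hmdef
  have h6 : dist m y = 2⁻¹ * dist y x := by
    rw [dist_eq_norm, hmdef, add_sub_cancel_left, norm_smul, dist_eq_norm]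
    norm_num
  have h7 : dist m x = 2⁻¹ * dist y x := by
    rw [dist_eq_norm, hmdef, show y + (-2⁻¹ : ℝ) • (y - x) - x = (2⁻¹ : ℝ) • (y - x) by module,
      norm_smul, dist_eq_norm]
    norm_num
  have h8 : dist m y = Metric.infDist m K := by rw [← h.dist_eq, hm]
  rw [← h.unique m x (by rw [← h8, h6]; linarith) hx (by rw [h7, ← h6, h8]), hm]

end IsTube

end Tube

/-! ### Families of vertex sets at a scale -/

open FaceSystem

theorem cechPair_le {X : Type} [MetricSpace X] (P : Set X) (p : X) {a a' b b' : ℝ} (ha : a ≤ a') (hb : b' ≤ b) :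
    cechPair P p a b ≤ cechPair P p a' b' := by
  have h : ∀ {Q Q' : Set X}, Q ⊆ Q' → cechComplex Q a ≤ cechComplex Q' a' := by
    rintro Q Q' hQ σ ⟨h1, h2, y, hy⟩
    refine ⟨h1, h2.trans hQ, y, ?_⟩
    simp only [Set.mem_iInter] at hy ⊢
    exact fun q hq => Metric.closedBall_subset_closedBall ha (hy q hq)
  exact ⟨h subset_rfl, h (Set.sdiff_subset_sdiff_right (Metric.ball_subset_ball hb))⟩

theorem ripsPair_le {X : Type} [MetricSpace X] (P : Set X) (p : X) {a a' b b' : ℝ} (ha : a ≤ a') (hb : b' ≤ b) :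
    ripsPair P p a b ≤ ripsPair P p a' b' := by
  have h : ∀ {Q Q' : Set X}, Q ⊆ Q' → ripsComplex Q a ≤ ripsComplex Q' a' := by
    rintro Q Q' hQ σ ⟨h1, h2, h3⟩
    refine ⟨h1, h2.trans hQ, fun e he hc => ?_⟩
    obtain ⟨h4, h5, y, hy⟩ := h3 e he hc
    refine ⟨h4, h5.trans hQ, y, ?_⟩
    simp only [Set.mem_iInter] at hy ⊢
    exact fun q hq => Metric.closedBall_subset_closedBall ha (hy q hq)
  exact ⟨h subset_rfl, h (Set.sdiff_subset_sdiff_right (Metric.ball_subset_ball hb))⟩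

/-- Sets contained in a closed ball of radius `a`. -/
def cechFamily {X : Type} [MetricSpace X] (a : ℝ) (s : Set X) : Prop := ∃ y, ∀ q ∈ s, dist q y ≤ a

/-- Sets of diameter at most `2 * a`. -/
def ripsFamily {X : Type} [MetricSpace X] (a : ℝ) (s : Set X) : Prop := ∀ u ∈ s, ∀ v ∈ s, dist u v ≤ 2 * a

theorem mem_cechComplex_iff {X : Type} [MetricSpace X] {P : Set X} {a : ℝ} {m : ℕ}
    (v : Fin (m + 1) → X) :
    (Set.finite_range v).toFinset ∈ (cechComplex P a).faces ↔
      Set.range v ⊆ P ∧ cechFamily a (Set.range v) := by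
  simp only [cechComplex, Set.mem_ofPred_eq, Set.Finite.toFinset_nonempty, Set.range_nonempty,
    true_and, Set.Finite.coe_toFinset, Set.Finite.mem_toFinset]
  refine and_congr_right fun _ => exists_congr fun y => ?_
  simp [dist_comm y]

section ScaleFamily

variable {E : Type} [NormedAddCommGroup E] [InnerProductSpace ℝ E]

/-- Properties of the family of vertex sets of simplices at the scales `a`. -/
structure IsScaleFamily (c : ℝ) (S : ℝ → Set E → Prop) : Prop where
  near : ∀ {a s} (y : E), (∀ q ∈ s, dist q y ≤ a) → S a s
  exists_dist_le : ∀ {a s q}, S a s → q ∈ convexHull ℝ s → ∃ v ∈ s, dist q v ≤ c * a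
  convexHull : ∀ {a s}, S a s → S a (convexHull ℝ s)
  thicken : ∀ {a b s s'}, S a s → (∀ q ∈ s', ∃ v ∈ s, dist q v ≤ b) → S (a + b) s'

/-- Some vertex sees `z` at a non-acute angle at `q`. Otherwise all vertices, hence their hull, lie
in an open half-space whose bounding hyperplane passes through `q`. -/
theorem exists_sq_dist_add_sq_dist_le {s : Set E} {q : E} (hq : q ∈ convexHull ℝ s) (z : E) :
    ∃ v ∈ s, dist q v ^ 2 + dist q z ^ 2 ≤ dist v z ^ 2 := by
  by_contra! h
  have h1 : s ⊆ {v | 0 < inner ℝ (z - q) (v - q)} := by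
    intro v hv
    have h2 := h v hv
    rw [dist_comm q v, dist_comm q z, dist_eq_norm, dist_eq_norm, dist_eq_norm,
      show v - z = (v - q) - (z - q) by abel, norm_sub_sq_real, real_inner_comm] at h2
    simp only [Set.mem_ofPred_eq]
    linarith
  have h2 : Convex ℝ {v | 0 < inner ℝ (z - q) (v - q)} := by
    simp only [inner_sub_right, sub_pos]
    exact convex_halfSpace_gt (innerSL ℝ (z - q)).isLinear _
  have := convexHull_min h1 h2 hq
  simp at this

/-- The obtuse angle taken towards the centre of the enclosing ball gives a vertex `v` no further
from `q` than from that centre. -/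
theorem isScaleFamily_cech : IsScaleFamily 1 (cechFamily (X := E)) where
  near y h := ⟨y, h⟩
  exists_dist_le := by
    rintro a s q ⟨y, hy⟩ hq
    obtain ⟨v, hv, h⟩ := exists_sq_dist_add_sq_dist_le hq y
    refine ⟨v, hv, ?_⟩
    rw [one_mul]
    refine le_trans ?_ (hy v hv)
    exact le_of_sq_le_sq (by nlinarith [sq_nonneg (dist q y)]) dist_nonneg
  convexHull := by
    rintro a s ⟨y, hy⟩
    exact ⟨y, fun q hq => convexHull_min hy (convex_closedBall y a) hq⟩
  thicken := by
    rintro a b s s' ⟨y, hy⟩ h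
    refine ⟨y, fun q hq => ?_⟩
    obtain ⟨v, hv, hqv⟩ := h q hq
    linarith [hy v hv, dist_triangle q v y]

/-- The obtuse angle taken towards a vertex `u` gives `v` with `dist q v ^ 2 + dist q u ^ 2 ≤ 4 * a
^ 2`, so one of the two is within `√2 * a` of `q`. -/
theorem isScaleFamily_rips : IsScaleFamily (√2) (ripsFamily (X := E)) where
  near y h u hu v hv := by
    linarith [h u hu, h v hv, dist_triangle_right u v y]
  exists_dist_le := by
    intro a s q hs hq
    obtain ⟨u, hu⟩ := convexHull_nonempty_iff.1 ⟨q, hq⟩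
    have ha : 0 ≤ a := by simpa using hs u hu u hu
    by_contra! h
    obtain ⟨v, hv, h1⟩ := exists_sq_dist_add_sq_dist_le hq u
    have h2 := hs v hv u hu
    have h3 : ∀ w ∈ s, 2 * a ^ 2 < dist q w ^ 2 := by
      intro w hw
      have := pow_lt_pow_left₀ (h w hw) (by positivity) two_ne_zero
      rwa [mul_pow, Real.sq_sqrt zero_le_two] at this
    have h4 := pow_le_pow_left₀ dist_nonneg h2 2
    linarith [h3 u hu, h3 v hv]
  convexHull := by
    intro a s hs u hu v hv
    obtain ⟨u', hu', v', hv', h⟩ := convexHull_exists_dist_ge2 hu hv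
    exact h.trans (hs u' hu' v' hv')
  thicken := by
    intro a b s s' hs h u hu v hv
    obtain ⟨u', hu', h1⟩ := h u hu
    obtain ⟨v', hv', h2⟩ := h v hv
    linarith [hs u' hu' v' hv', dist_triangle4_right u v u' v']

/-- Tuples in `P` at the scale `a`, modulo those which avoid the ball of radius `b` about `p`. -/
def scalePair (S : ℝ → Set E → Prop) (P : Set E) (p : E) (a b : ℝ) : (tuples E).Pair where
  total _ := {v | Set.range v ⊆ P ∧ S a (Set.range v)}
  sub _ := {v | Set.range v ⊆ P \ Metric.ball p b ∧ S a (Set.range v)}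

theorem IsScaleFamily.empty {c : ℝ} {S : ℝ → Set E → Prop} (hS : IsScaleFamily c S) (a : ℝ) :
    S a ∅ :=
  hS.near 0 (by simp)

theorem IsScaleFamily.scalePair_sub_zero {c : ℝ} {S : ℝ → Set E → Prop}
    (hS : IsScaleFamily c S) (P : Set E) (p : E) (a b : ℝ) :
    (scalePair S P p a b).sub 0 = Set.univ :=
  Set.eq_univ_of_forall fun v =>
    ⟨by simp [Set.range_eq_empty v], (Set.range_eq_empty v).symm ▸ hS.empty a⟩

theorem isOrderedPair_cech (P : Set E) (p : E) (a b : ℝ) :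
    IsOrderedPair (cechPair P p a b) (scalePair cechFamily P p a b) where
  total _ v := (mem_cechComplex_iff v).symm
  sub _ v := (mem_cechComplex_iff v).symm
  sub_zero := isScaleFamily_cech.scalePair_sub_zero P p a b

/-- The midpoint witnesses an edge of length at most `2 * a`. Nonnegativity of `a` covers repeated
entries, which form no edge. -/
theorem mem_ripsComplex_iff {P : Set E} {a : ℝ} (ha : 0 ≤ a) {m : ℕ} (v : Fin (m + 1) → E) :
    (Set.finite_range v).toFinset ∈ (ripsComplex P a).faces ↔
      Set.range v ⊆ P ∧ ripsFamily a (Set.range v) := by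
  classical
  simp only [ripsComplex, Set.mem_ofPred_eq, Set.Finite.toFinset_nonempty, Set.range_nonempty,
    true_and, Set.Finite.coe_toFinset]
  refine and_congr_right fun hP => ⟨fun h u hu w hw => ?_, fun h e he hc => ?_⟩
  · rcases eq_or_ne u w with rfl | huw
    · simpa using ha
    · obtain ⟨-, -, y, hy⟩ := h {u, w} (by
        simpa [Finset.insert_subset_iff] using ⟨hu, hw⟩) (Finset.card_pair huw)
      simp only [Finset.mem_insert, Finset.mem_singleton, Set.mem_iInter, Metric.mem_closedBall]
        at hy
      linarith [hy u (Or.inl rfl), hy w (Or.inr rfl), dist_triangle_left u w y]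
  · obtain ⟨u, w, -, rfl⟩ := Finset.card_eq_two.1 hc
    simp only [Finset.insert_subset_iff, Finset.singleton_subset_iff, Set.Finite.mem_toFinset] at he
    refine ⟨by simp, ?_, midpoint ℝ u w, ?_⟩
    · intro z hz
      simp only [Finset.coe_insert, Finset.coe_singleton, Set.mem_insert_iff,
        Set.mem_singleton_iff] at hz
      rcases hz with rfl | rfl
      exacts [hP he.1, hP he.2]
    · have := h u he.1 w he.2
      simp [dist_midpoint_left, dist_midpoint_right]
      linarith

theorem isOrderedPair_rips (P : Set E) (p : E) {a : ℝ} (ha : 0 ≤ a) (b : ℝ) :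
    IsOrderedPair (ripsPair P p a b) (scalePair ripsFamily P p a b) where
  total _ v := (mem_ripsComplex_iff ha v).symm
  sub _ v := (mem_ripsComplex_iff ha v).symm
  sub_zero := isScaleFamily_rips.scalePair_sub_zero P p a b

end ScaleFamily

/-! ### Pushing relative cycles away from a point -/

open FaceSystem Filter Topology

section PostComp

variable {E : Type}

/-- Composition of singular simplices with a function. -/
def postComp (T : E → E) (k : ℕ) :
    (singularSystem E).Chain k →ₗ[ℤ] (singularSystem E).Chain k :=
  Finsupp.lmapDomain ℤ ℤ fun σ : stdSimplex ℝ (Fin k) → E => T ∘ σ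

theorem pow_postComp_single (T : E → E) {k : ℕ} (N : ℕ) (σ : stdSimplex ℝ (Fin k) → E) :
    (postComp T k ^ N) (Finsupp.single σ 1) =
      Finsupp.single (α := stdSimplex ℝ (Fin k) → E) (T^[N] ∘ σ) 1 := by
  induction N with
  | zero => rfl
  | succ N ih =>
    rw [pow_succ', Module.End.mul_apply, ih, Function.iterate_succ', postComp,
      Finsupp.lmapDomain_apply, Finsupp.mapDomain_single, Function.comp_assoc]

theorem boundary_postComp (T : E → E) (k : ℕ) (z : (singularSystem E).Chain (k + 1)) :
    (singularSystem E).boundary k (postComp T (k + 1) z) =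
      postComp T k ((singularSystem E).boundary k z) :=
  boundary_lmapDomain (X := singularSystem E) (Y := singularSystem E) (fun _ σ => T ∘ σ)
    (fun _ _ _ => rfl) k z

theorem boundary_pow_postComp (T : E → E) (k N : ℕ) (z : (singularSystem E).Chain (k + 1)) :
    (singularSystem E).boundary k ((postComp T (k + 1) ^ N) z) =
      (postComp T k ^ N) ((singularSystem E).boundary k z) := by
  induction N with
  | zero => rfl
  | succ N ih =>
    rw [pow_succ', pow_succ', Module.End.mul_apply, Module.End.mul_apply, boundary_postComp, ih]

variable [NormedAddCommGroup E]

theorem comp_mem_singularSimplices {T : E → E} {K A : Set E} (hA : A ⊆ K) (hT : ContinuousOn T K)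
    (hTA : Set.MapsTo T A A) {k : ℕ} {σ : stdSimplex ℝ (Fin k) → E}
    (hσ : σ ∈ singularSimplices A k) : T ∘ σ ∈ singularSimplices A k :=
  ⟨hT.comp_continuous hσ.1 fun a => hA (hσ.2 a), fun a => hTA (hσ.2 a)⟩

/-- The chain map of a pair induced by a continuous map. -/
def postCompHom {T : E → E} {K A : Set E} (hAK : A ⊆ K) (hT : ContinuousOn T K)
    (hK : Set.MapsTo T K K) (hA : Set.MapsTo T A A) :
    Pair.Hom (singularPair K A) (singularPair K A) :=
  Pair.Hom.ofSimplexMap (fun _ σ => T ∘ σ) (fun _ _ _ => rfl)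
    (fun _ _ => comp_mem_singularSimplices subset_rfl hT hK)
    (fun _ _ => comp_mem_singularSimplices hAK hT hA)

/-- Composing `G` with a simplex and the time coordinate gives a natural homotopy, so the prism
formula applies with the identity at time zero. -/
theorem postComp_sub_mem_boundaries {K A : Set E} {G : E × ℝ → E} (hAK : A ⊆ K)
    (hG : ContinuousOn G (K ×ˢ Set.Icc 0 1))
    (hK : Set.MapsTo G (K ×ˢ Set.Icc 0 1) K) (hA : Set.MapsTo G (A ×ˢ Set.Icc 0 1) A)
    (h0 : ∀ y ∈ K, G (y, 0) = y) {ℓ : ℕ} {z : (singularSystem E).Chain (ℓ + 1)}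
    (hz : z ∈ (singularPair K A).cycles ℓ) :
    postComp (fun y => G (y, 1)) (ℓ + 1) z - z ∈ (singularPair K A).boundaries ℓ := by
  let F : ∀ k, (stdSimplex ℝ (Fin k) → E) → (Fin k → ℝ) × ℝ → E :=
    fun k σ q => G (extend σ q.1, q.2)
  have hmaps : ∀ B : Set E, B ⊆ K → Set.MapsTo G (B ×ˢ Set.Icc 0 1) B → ∀ k,
      ∀ σ ∈ singularSimplices B k, ContinuousOn (F k σ) (stdSimplex ℝ (Fin k) ×ˢ Set.Icc 0 1) ∧
        Set.MapsTo (F k σ) (stdSimplex ℝ (Fin k) ×ˢ Set.Icc 0 1) B := by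
    intro B hB hGB k σ hσ
    have h1 : Set.MapsTo (fun q : (Fin k → ℝ) × ℝ => (extend σ q.1, q.2))
        (stdSimplex ℝ (Fin k) ×ˢ Set.Icc 0 1) (B ×ˢ Set.Icc 0 1) :=
      fun q hq => ⟨mapsTo_extend hσ.2 hq.1, hq.2⟩
    refine ⟨hG.comp ?_ (h1.mono_right (Set.prod_mono hB subset_rfl)), hGB.comp h1⟩
    exact ((continuousOn_extend hσ.1).comp continuousOn_fst fun q hq => hq.1).prodMk
      continuousOn_snd
  have h1 := levelChain_sub_mem_boundaries (P := singularPair K A) (K := K) (A := A) F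
    (fun k i σ => by
      funext q
      simp only [F, extend_face]
      rfl) (hmaps K subset_rfl hK) (hmaps A hAK hA) hz
  have h2 : levelChain F 0 (ℓ + 1) z = z := by
    refine map_eq_of_mem_supported _ LinearMap.id (s := singularSimplices K (ℓ + 1)) ?_ hz.1
    intro σ hσ
    rw [levelChain_single]
    congr 1
    funext a
    simp only [F, extend_apply]
    exact h0 _ (hσ.2 a)
  have h3 : levelChain F 1 (ℓ + 1) z = postComp (fun y => G (y, 1)) (ℓ + 1) z := by
    simp only [levelChain, postComp, F, extend_apply]
    rfl
  rwa [h2, h3] at h1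

/-- A deformation of `K` which eventually moves compact parts of `B` into `A` shows that the
homology of `K` relative to `A` is that of `K` relative to `B`. -/
theorem ofLE_map_bijective {K A B : Set E} (hAB : A ⊆ B) (hBK : B ⊆ K) {G : E × ℝ → E}
    (hG : ContinuousOn G (K ×ˢ Set.Icc 0 1))
    (hK : Set.MapsTo G (K ×ˢ Set.Icc 0 1) K) (hA : Set.MapsTo G (A ×ˢ Set.Icc 0 1) A)
    (hB : Set.MapsTo G (B ×ˢ Set.Icc 0 1) B) (h0 : ∀ y ∈ K, G (y, 0) = y)
    (hpush : ∀ C ⊆ B, IsCompact C →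
      ∀ᶠ N in atTop, Set.MapsTo (fun y => G (y, 1))^[N] C A) (ℓ : ℕ) :
    Function.Bijective ((Pair.Hom.ofLE (P := singularPair K A) (P' := singularPair K B)
      (fun _ => subset_rfl) (fun k => singularSimplices_mono hAB k)).map ℓ) := by
  set T : E → E := fun y => G (y, 1) with hTdef
  have hone : (1 : ℝ) ∈ Set.Icc (0 : ℝ) 1 := Set.right_mem_Icc.2 zero_le_one
  have hT : ContinuousOn T K :=
    hG.comp (continuousOn_id.prodMk continuousOn_const) fun y hy => ⟨hy, hone⟩
  have hTm : ∀ {C : Set E}, Set.MapsTo G (C ×ˢ Set.Icc 0 1) C → Set.MapsTo T C C :=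
    fun h y hy => h (x := (y, 1)) ⟨hy, hone⟩
  have hmapA : ∀ k, ∀ σ ∈ singularSimplices B k, ∀ᶠ N in atTop,
      (postComp T k ^ N) (Finsupp.single σ 1) ∈ Finsupp.supported ℤ ℤ (singularSimplices A k) := by
    intro k σ hσ
    filter_upwards [hpush (Set.range σ) (Set.range_subset_iff.2 hσ.2)
      (isCompact_range hσ.1)] with N hN
    rw [pow_postComp_single]
    refine single_mem_supported ⟨?_, fun a => hN ⟨a, rfl⟩⟩
    exact (hT.iterate (hTm hK) N).comp_continuous hσ.1 fun a => hBK (hσ.2 a)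
  have hmapA' : ∀ k, ∀ z ∈ Finsupp.supported ℤ ℤ (singularSimplices B k), ∀ᶠ N in atTop,
      (postComp T k ^ N) z ∈ Finsupp.supported ℤ ℤ (singularSimplices A k) :=
    fun k z hz => eventually_map_mem_of_mem_supported (fun N => postComp T k ^ N) (hmapA k) hz
  have hmapK : ∀ k N, ∀ z ∈ Finsupp.supported ℤ ℤ (singularSimplices K k),
      (postComp T k ^ N) z ∈ Finsupp.supported ℤ ℤ (singularSimplices K k) := by
    intro k N z hz
    refine map_mem_of_mem_supported _ (fun σ hσ => ?_) hz
    rw [pow_postComp_single]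
    exact single_mem_supported ⟨(hT.iterate (hTm hK) N).comp_continuous hσ.1 hσ.2,
      fun a => (hTm hK).iterate N (hσ.2 a)⟩
  constructor
  · refine (Pair.Hom.map_ofLE_injective_iff _ _ ℓ).2 fun z hz hz' => ?_
    obtain ⟨s, hs, y, hy, rfl⟩ := Pair.mem_boundaries.1 hz'
    -- Iterate until the part of the filling in `B` lies in `A`; the moved cycle then bounds
    -- relative to `A` and is homologous there to the original.
    obtain ⟨N, h1⟩ := (hmapA' _ s hs).exists
    have h3 := ((postCompHom (hAB.trans hBK) hT (hTm hK) (hTm hA)).pow_cycles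
      (fun z hz => postComp_sub_mem_boundaries (hAB.trans hBK) hG hK hA h0 hz) hz N).2
    refine (Submodule.sub_mem_iff_right _ ?_).1 h3
    change (postComp T (ℓ + 1) ^ N) _ ∈ _
    rw [map_add, ← boundary_pow_postComp]
    exact Pair.mem_boundaries.2 ⟨_, h1, _, hmapK _ N y hy, rfl⟩
  · refine (Pair.Hom.map_ofLE_surjective_iff _ _ ℓ).2 fun z hz => ?_
    -- Iterate until the boundary of the cycle has moved from `B` into `A`.
    obtain ⟨N, h1⟩ := (hmapA' _ _ hz.2).exists
    refine ⟨(postComp T (ℓ + 1) ^ N) z, ⟨hmapK _ N z hz.1, ?_⟩,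
      ((postCompHom hBK hT (hTm hK) (hTm hB)).pow_cycles
        (fun z hz => postComp_sub_mem_boundaries hBK hG hK hB h0 hz) hz N).2⟩
    rw [SetLike.mem_coe, Submodule.mem_comap, boundary_pow_postComp]
    exact h1

end PostComp

section Away

variable {E : Type} [NormedAddCommGroup E]

/-- The points of `K` at distance at least `s` from `x`. -/
def awayFrom (K : Set E) (x : E) (s : ℝ) : Set E := {y | y ∈ K ∧ s ≤ dist y x}

theorem awayFrom_subset_diff (K : Set E) (x : E) {s : ℝ} (hs : 0 < s) :
    awayFrom K x s ⊆ K \ {x} := by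
  rintro y ⟨hy, hys⟩
  refine ⟨hy, ?_⟩
  rintro rfl
  rw [dist_self] at hys
  exact absurd hs hys.not_gt

theorem awayFrom_subset_awayFrom (K : Set E) (x : E) {s s' : ℝ} (h : s' ≤ s) :
    awayFrom K x s ⊆ awayFrom K x s' :=
  fun _ hy => ⟨hy.1, h.trans hy.2⟩

/-- The set `C` keeps a distance `η` from `x`. On the compact shell between `η` and `s` the strict
increase is bounded below by some `κ > 0`, so at most `s / κ` steps, rounded up, reach distance `s`.
-/
theorem iterate_mapsTo_awayFrom {K : Set E} (hK : IsCompact K) {x : E} {T : E → E}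
    (hT : ContinuousOn T K) (hTK : Set.MapsTo T K K) {s : ℝ}
    (hle : ∀ y ∈ K, dist y x ≤ dist (T y) x)
    (hlt : ∀ y ∈ K, y ≠ x → dist y x ≤ s → dist y x < dist (T y) x) {C : Set E}
    (hC : IsCompact C) (hCK : C ⊆ K \ {x}) :
    ∀ᶠ N in atTop, Set.MapsTo T^[N] C (awayFrom K x s) := by
  obtain ⟨η, hη, hηC⟩ : ∃ η > 0, ∀ y ∈ C, η ≤ dist y x := by
    obtain rfl | hne := C.eq_empty_or_nonempty
    · exact ⟨1, one_pos, by simp⟩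
    · obtain ⟨y, hy, hmin⟩ := hC.exists_isMinOn hne
        (continuous_id.dist continuous_const : Continuous fun y => dist y x).continuousOn
      exact ⟨dist y x, dist_pos.2 fun h => (hCK hy).2 h, fun z hz => hmin hz⟩
  obtain ⟨κ, hκ, hκT⟩ : ∃ κ > 0, ∀ y ∈ K, η ≤ dist y x → dist y x ≤ s →
      dist y x + κ ≤ dist (T y) x := by
    have hd : Continuous fun y => dist y x := continuous_id.dist continuous_const
    have hL : IsCompact (K ∩ {y | η ≤ dist y x ∧ dist y x ≤ s}) :=
      hK.inter_right ((isClosed_le continuous_const hd).inter (isClosed_le hd continuous_const))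
    obtain h | hne := (K ∩ {y | η ≤ dist y x ∧ dist y x ≤ s}).eq_empty_or_nonempty
    · refine ⟨1, one_pos, fun y hy h1 h2 => ?_⟩
      exact absurd (h ▸ ⟨hy, h1, h2⟩ : y ∈ (∅ : Set E)) (Set.notMem_empty y)
    · obtain ⟨y, hy, hmin⟩ := hL.exists_isMinOn hne (f := fun y => dist (T y) x - dist y x)
        ((hd.comp_continuousOn (hT.mono Set.inter_subset_left)).sub hd.continuousOn)
      refine ⟨dist (T y) x - dist y x, sub_pos.2 (hlt y hy.1 ?_ hy.2.2), fun z hz h1 h2 => ?_⟩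
      · exact dist_pos.1 (hη.trans_le hy.2.1)
      · have := hmin ⟨hz, h1, h2⟩
        simp only at this
        linarith [show dist (T y) x - dist y x ≤ dist (T z) x - dist z x from this]
  have key : ∀ N : ℕ, ∀ y ∈ C, T^[N] y ∈ K ∧ η ≤ dist (T^[N] y) x ∧
      min s (η + N * κ) ≤ dist (T^[N] y) x := by
    intro N y hy
    induction N with
    | zero => exact ⟨(hCK hy).1, hηC y hy, by simp [hηC y hy]⟩
    | succ N ih =>
      obtain ⟨h1, h2, h3⟩ := ih
      rw [Function.iterate_succ_apply']
      refine ⟨hTK h1, h2.trans (hle _ h1), ?_⟩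
      rcases le_total (dist (T^[N] y) x) s with h4 | h4
      · have h5 := hκT _ h1 h2 h4
        rw [min_le_iff] at h3 ⊢
        push_cast
        rcases h3 with h3 | h3
        · left; linarith
        · right; linarith
      · exact (min_le_left _ _).trans (h4.trans (hle _ h1))
  obtain ⟨M, hM⟩ := exists_nat_ge (s / κ)
  filter_upwards [eventually_ge_atTop M] with N hN y hy
  obtain ⟨h1, -, h3⟩ := key N y hy
  refine ⟨h1, le_trans (le_min le_rfl ?_) h3⟩
  have : s / κ ≤ N := hM.trans (by exact_mod_cast hN)
  rw [div_le_iff₀ hκ] at this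
  linarith

end Away

section Stretch

variable {E : Type} [NormedAddCommGroup E] [InnerProductSpace ℝ E]

/-- The homology of `K` relative to the complement of a ball about `x` is the local homology. -/
theorem IsTube.away_bijective {K : Set E} {α : ℝ} {π : E → E} (h : IsTube K α π)
    (hK : IsCompact K) {x : E} (hx : x ∈ K) {s : ℝ} (hs : 0 < s) (hsα : s < 2 * α) (ℓ : ℕ) :
    Function.Bijective ((Pair.Hom.ofLE (P := singularPair K (awayFrom K x s))
      (P' := singularPair K (K \ {x})) (fun _ => subset_rfl)
      (fun k => singularSimplices_mono (awayFrom_subset_diff K x hs) k)).map ℓ) := by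
  obtain ⟨D, hD, hKD⟩ := hK.isBounded.subset_closedBall_lt 0 x
  have hα : 0 < α := by linarith
  -- `D` bounds distances to `x` on `K`, so stretched points stay within `α / 2` of `K`.
  set τ : ℝ := α / (2 * D) with hτ
  have hτ0 : 0 < τ := by positivity
  have hτα : ∀ y ∈ K, τ * dist y x < α := by
    intro y hy
    have h1 : τ * dist y x ≤ τ * D := mul_le_mul_of_nonneg_left (hKD hy) hτ0.le
    have h2 : τ * D = α / 2 := by rw [hτ]; field_simp
    linarith
  let G : E × ℝ → E := fun q => π (x + (1 + q.2 * τ) • (q.1 - x))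
  have hnear : ∀ y ∈ K, ∀ u ∈ Set.Icc (0 : ℝ) 1,
      Metric.infDist (x + (1 + u * τ) • (y - x)) K < α := by
    intro y hy u hu
    refine (Metric.infDist_le_dist_of_mem hy).trans_lt (lt_of_le_of_lt ?_ (hτα y hy))
    rw [dist_eq_norm, show x + (1 + u * τ) • (y - x) - y = (u * τ) • (y - x) by module,
      norm_smul, ← dist_eq_norm, Real.norm_eq_abs, abs_of_nonneg (mul_nonneg hu.1 hτ0.le)]
    exact mul_le_mul_of_nonneg_right (mul_le_of_le_one_left hτ0.le hu.2) dist_nonneg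
  have hle : ∀ y ∈ K, ∀ u ∈ Set.Icc (0 : ℝ) 1, dist y x ≤ dist (G (y, u)) x :=
    fun y hy u hu => h.dist_le_dist_stretch hy (mul_nonneg hu.1 hτ0.le)
  have hone : (1 : ℝ) ∈ Set.Icc (0 : ℝ) 1 := Set.right_mem_Icc.2 zero_le_one
  have hGc : ContinuousOn G (K ×ˢ Set.Icc 0 1) :=
    h.continuousOn.comp (by fun_prop) fun q hq => hnear q.1 hq.1 q.2 hq.2
  refine ofLE_map_bijective (awayFrom_subset_diff K x hs) Set.sdiff_subset hGc
    (fun q _ => h.mem _) ?_ ?_ ?_ ?_ ℓ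
  · rintro ⟨y, u⟩ ⟨⟨hy, hys⟩, hu⟩
    exact ⟨h.mem _, hys.trans (hle y hy u hu)⟩
  · rintro ⟨y, u⟩ ⟨⟨hy, hyx⟩, hu⟩
    refine ⟨h.mem _, ?_⟩
    have := (dist_pos.2 hyx).trans_le (hle y hy u hu)
    exact dist_pos.1 this
  · intro y hy
    simp only [G, zero_mul, add_zero, one_smul, add_sub_cancel]
    exact h.apply_of_mem hy
  · intro C hCK hC
    refine iterate_mapsTo_awayFrom hK (hGc.comp (continuousOn_id.prodMk continuousOn_const)
      fun y hy => ⟨hy, hone⟩) (fun y _ => h.mem _) (fun y hy => hle y hy 1 hone) ?_ hC hCK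
    intro y hy hyx hys
    have := h.dist_lt_dist_stretch hx hy hτ0 (hτα y hy) hyx.symm (by linarith)
    simpa [G] using this

end Stretch

/-! ### Comparison of a submanifold with a sample -/

open FaceSystem Filter Topology

section Vertices

variable {E : Type} [AddCommGroup E]

/-- The images of the vertices of singular simplices under a function. -/
def vertexMap (f : E → E) (k : ℕ) : (singularSystem E).Chain k →ₗ[ℤ] (tuples E).Chain k :=
  Finsupp.lmapDomain ℤ ℤ fun (σ : stdSimplex ℝ (Fin k) → E) (i : Fin k) =>
    f (extend σ (vertexTuple k i))

theorem vertexMap_single (f : E → E) {k : ℕ} (σ : stdSimplex ℝ (Fin k) → E) :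
    vertexMap f k (Finsupp.single σ 1) =
      Finsupp.single (α := Fin k → E) (fun i => f (extend σ (vertexTuple k i))) 1 := by
  rw [vertexMap, Finsupp.lmapDomain_apply, Finsupp.mapDomain_single]

theorem boundary_vertexMap (f : E → E) (k : ℕ) (z : (singularSystem E).Chain (k + 1)) :
    (tuples E).boundary k (vertexMap f (k + 1) z) =
      vertexMap f k ((singularSystem E).boundary k z) :=
  boundary_lmapDomain (X := singularSystem E) (Y := tuples E)
    (fun k σ i => f (extend σ (vertexTuple k i)))
    (fun k i σ => by
      funext j
      change f (extend (σ ∘ stdSimplex.map i.succAbove) (vertexTuple k j)) =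
        f (extend σ ((vertexTuple (k + 1) ∘ i.succAbove) j))
      rw [extend_face, ← faceMap_comp_vertexTuple]
      rfl) k z

theorem vertexMap_pushChain [Module ℝ E] (f s : E → E) (k : ℕ) (z : (tuples E).Chain k) :
    vertexMap f k (pushChain s k z) = mapTuples (f ∘ s) k z := by
  have : vertexMap f k ∘ₗ pushChain s k = mapTuples (f ∘ s) k := by
    refine Finsupp.lhom_ext' fun v => LinearMap.ext_ring ?_
    rw [LinearMap.comp_apply, Finsupp.lsingle_apply]
    refine ((congrArg (vertexMap f k) (pushChain_single s v 1)).trans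
      ((vertexMap_single f _).trans ?_)).trans (mapTuples_single (f ∘ s) v 1).symm
    congr 1
    funext i
    have h : vertexTuple k i ∈ stdSimplex ℝ (Fin k) := single_mem_stdSimplex ℝ i
    rw [show extend (push s v) (vertexTuple k i) = push s v ⟨_, h⟩ from
      extend_apply (push s v) ⟨_, h⟩]
    simp [push, vertexTuple, Pi.single_apply]
  exact LinearMap.congr_fun this z

end Vertices

/-! ### Maps between small singular chains of the submanifold and the sample. -/

section Setting

variable {E : Type} [NormedAddCommGroup E] [InnerProductSpace ℝ E]

/-- The data of a sample `P` of `K` with a nearest point projection `π` to `K` and a nearest point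
function `f` to `P`. -/
structure IsSetting (K P : Set E) (x p : E) (t ε δ α : ℝ) (π f : E → E) : Prop where
  tube : IsTube K α π
  compact : IsCompact K
  mem : x ∈ K
  dist_base : dist x p ≤ t * ε
  t_nonneg : 0 ≤ t
  pos : 0 < δ
  f_mem : ∀ q, f q ∈ P
  dist_f_le : ∀ q, ∀ v ∈ P, dist q (f q) ≤ dist q v
  dist_f_add_le : ∀ y ∈ K, dist y (f y) + δ ≤ ε
  infDist_le : ∀ v ∈ P, Metric.infDist v K ≤ t * ε

namespace IsSetting

variable {K P : Set E} {x p : E} {t ε δ α : ℝ} {π f : E → E}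

theorem eps_pos (H : IsSetting K P x p t ε δ α π f) : 0 < ε := by
  linarith [H.dist_f_add_le x H.mem, H.pos, dist_nonneg (x := x) (y := f x)]

theorem f_apply (H : IsSetting K P x p t ε δ α π f) {v : E} (hv : v ∈ P) : f v = v := by
  have := H.dist_f_le v v hv
  rw [dist_self] at this
  exact (dist_le_zero.1 this).symm

variable {c : ℝ} {S : ℝ → Set E → Prop}

/-- Sending a small singular simplex to the sample points next to its vertices. -/
def vertexHom (H : IsSetting K P x p t ε δ α π f) (hS : IsScaleFamily c S) {s a b : ℝ}
    (ha : ε ≤ a) (hs : b + (1 + t) * ε ≤ s) :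
    Pair.Hom (smallPair K (awayFrom K x s) δ) (scalePair S P p a b) :=
  -- All chosen sample points lie within `ε` of a single vertex: the slack `δ` in the sampling
  -- distance pays for the diameter of the simplex.
  have key : ∀ k, ∀ σ ∈ smallSimplices K δ k,
      S a (Set.range fun i : Fin k => f (extend σ (vertexTuple k i))) := by
    intro k σ hσ
    have hmem : ∀ i, vertexTuple k i ∈ stdSimplex ℝ (Fin k) := fun i => single_mem_stdSimplex ℝ i
    rcases isEmpty_or_nonempty (Fin k) with hk | ⟨⟨j⟩⟩
    · rw [Set.range_eq_empty]
      exact hS.empty a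
    · refine hS.near (extend σ (vertexTuple k j)) ?_
      rintro _ ⟨i, rfl⟩
      have h1 := H.dist_f_add_le _ (mapsTo_extend hσ.1.2 (hmem i))
      have h2 := dist_extend_le hσ.2 _ (hmem i) _ (hmem j)
      have h3 := dist_triangle_left (f (extend σ (vertexTuple k i))) (extend σ (vertexTuple k j))
        (extend σ (vertexTuple k i))
      linarith
  { toFun := vertexMap f
    comm := boundary_vertexMap f
    total := fun k σ hσ => by
      rw [vertexMap_single]
      exact single_mem_supported ⟨Set.range_subset_iff.2 fun _ => H.f_mem _, key k σ hσ⟩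
    sub := fun k σ hσ => by
      rw [vertexMap_single]
      refine single_mem_supported ⟨Set.range_subset_iff.2 fun i => ⟨H.f_mem _, ?_⟩,
        key k σ ⟨singularSimplices_mono (fun y hy => hy.1) k hσ.1, hσ.2⟩⟩
      have hmem : vertexTuple k i ∈ stdSimplex ℝ (Fin k) := single_mem_stdSimplex ℝ i
      have h1 := mapsTo_extend hσ.1.2 hmem
      have h2 := H.dist_f_add_le _ h1.1
      have h3 := dist_triangle4 (extend σ (vertexTuple k i)) (f (extend σ (vertexTuple k i))) p x
      have h4 := h1.2
      rw [Metric.mem_ball, not_lt]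
      linarith [H.pos, H.dist_base, dist_comm x p] }

theorem dist_proj_le (H : IsSetting K P x p t ε δ α π f) {v : E} (hv : v ∈ P) (q : E) :
    dist q (π q) ≤ dist q v + t * ε := by
  rw [H.tube.dist_eq]
  linarith [Metric.infDist_le_infDist_add_dist (s := K) (x := q) (y := v), H.infDist_le v hv]

/-- Projecting the affine simplices spanned by the simplices of the sample to `K`. -/
def projHom (H : IsSetting K P x p t ε δ α π f) (hS : IsScaleFamily c S) {s a b : ℝ}
    (hα : c * a + t * ε < α) (hs : s ≤ b - 2 * (c * a) - 2 * (t * ε)) :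
    Pair.Hom (scalePair S P p a b) (singularPair K (awayFrom K x s)) :=
  have key : ∀ s' ⊆ P, S a s' → ContinuousOn π (convexHull ℝ s') := by
    intro s' hs' hS'
    refine H.tube.continuousOn.mono fun q hq => ?_
    -- A hull point is within `c * a` of a vertex, which is within `t * ε` of `K`; so the hull lies
    -- in the tube.
    obtain ⟨v, hv, hqv⟩ := hS.exists_dist_le hS' hq
    have := H.dist_proj_le (hs' hv) q
    rw [H.tube.dist_eq] at this
    exact this.trans_lt (by linarith)
  { toFun := pushChain π
    comm := boundary_pushChain π
    total := fun k v hv => by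
      rw [pushChain_single]
      exact single_mem_supported (push_mem_singularSimplices (convex_convexHull ℝ (Set.range v))
        (key _ hv.1 hv.2) (fun q _ => H.tube.mem q)
        fun i => subset_convexHull ℝ _ (Set.mem_range_self i))
    sub := fun k v hv => by
      rw [pushChain_single]
      refine single_mem_supported (push_mem_singularSimplices (A := awayFrom K x s)
        (convex_convexHull ℝ (Set.range v)) (key _ (hv.1.trans Set.sdiff_subset) hv.2) (fun q hq => ⟨H.tube.mem q, ?_⟩)
        fun i => subset_convexHull ℝ _ (Set.mem_range_self i))
      -- Along `u, q, π q, x, p` the loss is `c * a`, then `c * a + t * ε`, then `t * ε` for the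
      -- change of base point.
      obtain ⟨u, hu, hqu⟩ := hS.exists_dist_le hv.2 hq
      have h1 := H.dist_proj_le (hv.1 hu).1 q
      have h2 := (hv.1 hu).2
      rw [Metric.mem_ball, not_lt] at h2
      have h3 := dist_triangle4 u q (π q) p
      have h4 := dist_triangle (π q) x p
      linarith [H.dist_base, dist_comm u q] }

/-- Passing to the sample and projecting back is homologous to the identity. -/
theorem pushChain_vertexMap_sub_mem (H : IsSetting K P x p t ε δ α π f) {s s' : ℝ}
    (hα : ε < α) (hs : s' ≤ s - 2 * ε) {ℓ : ℕ} {z : (singularSystem E).Chain (ℓ + 1)}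
    (hz : z ∈ (smallPair K (awayFrom K x s) δ).cycles ℓ) :
    pushChain π (ℓ + 1) (vertexMap f (ℓ + 1) z) - z ∈
      (singularPair K (awayFrom K x s')).boundaries ℓ := by
  -- The straight-line homotopy from `σ` to the affine simplex on its sample points, projected to
  -- `K`. Before projection it stays within `ε` of `σ`, hence in the tube, and the projection costs
  -- at most another `ε`.
  let F : ∀ k, (stdSimplex ℝ (Fin k) → E) → (Fin k → ℝ) × ℝ → E := fun k σ q =>
    π ((1 - q.2) • extend σ q.1 + q.2 • ∑ i, q.1 i • f (extend σ (vertexTuple k i)))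
  have hdist : ∀ k, ∀ σ ∈ smallSimplices K δ k, ∀ q ∈ stdSimplex ℝ (Fin k) ×ˢ Set.Icc (0 : ℝ) 1,
      dist ((1 - q.2) • extend σ q.1 + q.2 • ∑ i, q.1 i • f (extend σ (vertexTuple k i)))
        (extend σ q.1) ≤ ε := by
    intro k σ hσ q hq
    refine (convex_closedBall (extend σ q.1) ε) (Metric.mem_closedBall_self H.eps_pos.le) ?_
      (sub_nonneg.2 hq.2.2) hq.2.1 (by ring)
    refine (convex_closedBall (extend σ q.1) ε).sum_mem (fun i _ => hq.1.1 i) hq.1.2 fun i _ => ?_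
    have hmem : vertexTuple k i ∈ stdSimplex ℝ (Fin k) := single_mem_stdSimplex ℝ i
    have h1 := H.dist_f_add_le _ (mapsTo_extend hσ.1.2 hmem)
    have h2 := dist_extend_le hσ.2 _ hmem _ hq.1
    rw [Metric.mem_closedBall]
    have h3 := dist_triangle_left (f (extend σ (vertexTuple k i))) (extend σ q.1)
      (extend σ (vertexTuple k i))
    linarith
  have hcont : ∀ k, ∀ σ ∈ smallSimplices K δ k,
      ContinuousOn (F k σ) (stdSimplex ℝ (Fin k) ×ˢ Set.Icc 0 1) := by
    intro k σ hσ
    refine H.tube.continuousOn.comp ?_ fun q hq => ?_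
    · have h1 : ContinuousOn (fun q : (Fin k → ℝ) × ℝ => extend σ q.1)
          (stdSimplex ℝ (Fin k) ×ˢ Set.Icc 0 1) :=
        (continuousOn_extend hσ.1.1).comp continuousOn_fst fun q hq => hq.1
      fun_prop
    · exact (Metric.infDist_le_dist_of_mem (mapsTo_extend hσ.1.2 hq.1)).trans_lt
        ((hdist k σ hσ q hq).trans_lt hα)
  have hsub : ∀ k, smallSimplices (awayFrom K x s) δ k ⊆ smallSimplices K δ k :=
    fun k σ hσ => ⟨singularSimplices_mono (fun y hy => hy.1) k hσ.1, hσ.2⟩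
  have h1 := levelChain_sub_mem_boundaries (P := smallPair K (awayFrom K x s) δ) (K := K)
    (A := awayFrom K x s') F
    (fun k i σ => by
      funext q
      have h1 : ∀ j, extend (σ ∘ stdSimplex.map i.succAbove) (vertexTuple k j) =
          extend σ (vertexTuple (k + 1) (i.succAbove j)) := fun j => by
        rw [extend_face]
        exact congrArg (extend σ) (congrFun (faceMap_comp_vertexTuple i) j)
      simp only [F, Function.comp_apply, LinearMap.prodMap_apply, LinearMap.id_apply, h1,
        Fin.sum_univ_succAbove _ i, faceMap_self, faceMap_succAbove, zero_smul, zero_add,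
        extend_face])
    (fun k σ hσ => ⟨hcont k σ hσ, fun q _ => H.tube.mem _⟩)
    (fun k σ hσ => ⟨hcont k σ (hsub k hσ), fun q hq => ⟨H.tube.mem _, by
      have h1 := hdist k σ (hsub k hσ) q hq
      have h2 := mapsTo_extend hσ.1.2 hq.1
      have h3 := H.tube.dist_le ((1 - q.2) • extend σ q.1 +
        q.2 • ∑ i, q.1 i • f (extend σ (vertexTuple k i))) h2.1
      have h4 := h2.2
      have h5 := dist_triangle_left (extend σ q.1) x ((1 - q.2) • extend σ q.1 +
        q.2 • ∑ i, q.1 i • f (extend σ (vertexTuple k i)))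
      have h6 := dist_triangle ((1 - q.2) • extend σ q.1 +
        q.2 • ∑ i, q.1 i • f (extend σ (vertexTuple k i))) (F k σ q) x
      change dist _ (F k σ q) ≤ _ at h3
      linarith⟩⟩) hz
  have h2 : levelChain F 0 (ℓ + 1) z = z := by
    refine map_eq_of_mem_supported _ LinearMap.id (s := smallSimplices K δ (ℓ + 1)) ?_ hz.1
    intro σ hσ
    rw [levelChain_single]
    congr 1
    funext a
    simp only [F, extend_apply, sub_zero, one_smul, zero_smul, add_zero]
    exact H.tube.apply_of_mem (hσ.1.2 a)
  have h3 : levelChain F 1 (ℓ + 1) z = pushChain π (ℓ + 1) (vertexMap f (ℓ + 1) z) := by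
    refine map_eq_of_mem_supported _ (pushChain π (ℓ + 1) ∘ₗ vertexMap f (ℓ + 1))
      (s := Set.univ) (fun σ _ => ?_) (by rw [Finsupp.supported_univ]; trivial)
    rw [levelChain_single, LinearMap.comp_apply, vertexMap_single, pushChain_single]
    congr 1
    funext a
    simp [F, push]
  rwa [h2, h3] at h1

end IsSetting

end Setting

/-! ### Subdivision of the simplices of a sample -/

open FaceSystem Filter Topology

section Hull

variable {E : Type} [NormedAddCommGroup E] [InnerProductSpace ℝ E]

/-- Tuples in convex hulls of simplices of a sample. -/
def hullTuples (S : ℝ → Set E → Prop) (P : Set E) (a : ℝ) (k : ℕ) : Set (Fin k → E) :=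
  {v | ∃ s ⊆ P, S a s ∧ v ∈ tuplesIn (convexHull ℝ s) k}

/-- Tuples in convex hulls of simplices of a sample, modulo those away from `p`. -/
def hullPair (S : ℝ → Set E → Prop) (P : Set E) (p : E) (a b : ℝ) : (tuples E).Pair where
  total := hullTuples S P a
  sub := hullTuples S (P \ Metric.ball p b) a

/-- The tuples of diameter at most `η` in convex hulls of simplices of a sample. -/
def smallHullPair (S : ℝ → Set E → Prop) (P : Set E) (p : E) (a b η : ℝ) : (tuples E).Pair where
  total k := hullTuples S P a k ∩ {v | ∀ i j, dist (v i) (v j) ≤ η}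
  sub k := hullTuples S (P \ Metric.ball p b) a k ∩ {v | ∀ i j, dist (v i) (v j) ≤ η}

variable {S : ℝ → Set E → Prop} {P : Set E} {p : E} {a b : ℝ}

theorem mem_hullTuples {k : ℕ} {v : Fin k → E}
    (hv : Set.range v ⊆ P ∧ S a (Set.range v)) : v ∈ hullTuples S P a k :=
  ⟨_, hv.1, hv.2, fun i => subset_convexHull ℝ _ ⟨i, rfl⟩⟩

theorem convexHull_range_subset {k : ℕ} {s : Set E} {v : Fin k → E}
    (hv : v ∈ tuplesIn (convexHull ℝ s) k) : convexHull ℝ (Set.range v) ⊆ convexHull ℝ s :=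
  convexHull_min (Set.range_subset_iff.2 hv) (convex_convexHull ℝ s)

theorem sd_single_mem_hullTuples {k : ℕ} {v : Fin k → E} (hv : v ∈ hullTuples S P a k) :
    sd k (Finsupp.single v 1) ∈ Finsupp.supported ℤ ℤ (hullTuples S P a k) := by
  obtain ⟨s, hs, hS, hv⟩ := hv
  exact Finsupp.supported_mono (t := hullTuples S P a k) (fun w hw =>
    ⟨s, hs, hS, tuplesIn_mono (convexHull_range_subset hv) k hw⟩) (sd_single_mem_supported k v)

theorem sdHomotopy_single_mem_hullTuples {k : ℕ} {v : Fin k → E} (hv : v ∈ hullTuples S P a k) :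
    sdHomotopy k (Finsupp.single v 1) ∈ Finsupp.supported ℤ ℤ (hullTuples S P a (k + 1)) := by
  obtain ⟨s, hs, hS, hv⟩ := hv
  exact Finsupp.supported_mono (t := hullTuples S P a (k + 1)) (fun w hw =>
    ⟨s, hs, hS, tuplesIn_mono (convexHull_range_subset hv) (k + 1) hw⟩)
    (sdHomotopy_single_mem_supported k v)

/-- Barycentric subdivision in the convex hulls of simplices. -/
def hullSdHom (S : ℝ → Set E → Prop) (P : Set E) (p : E) (a b : ℝ) :
    Pair.Hom (hullPair S P p a b) (hullPair S P p a b) where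
  toFun := sd
  comm := boundary_sd
  total _ _ := sd_single_mem_hullTuples
  sub _ _ := sd_single_mem_hullTuples

/-- Subdivision leaves the vertex set `P` but not the convex hulls of simplices, so the comparison
with `w` takes place in the larger pair of hull tuples. -/
theorem pow_sd_sub_mem_boundaries {ℓ : ℕ} {w : (tuples E).Chain (ℓ + 1)}
    (hw : w ∈ (scalePair S P p a b).cycles ℓ) (N : ℕ) :
    (sd (ℓ + 1) ^ N) w - w ∈ (hullPair S P p a b).boundaries ℓ :=
  ((hullSdHom S P p a b).pow_cycles (fun _ hz =>
    Pair.sub_mem_boundaries LinearMap.id (sd (ℓ + 1)) sdHomotopy (boundary_sdHomotopy ℓ)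
      (fun _ _ => sdHomotopy_single_mem_hullTuples)
      (fun _ _ => sdHomotopy_single_mem_hullTuples) hz)
    ((Pair.Hom.ofLE (P := scalePair S P p a b) (P' := hullPair S P p a b)
      (fun _ _ => mem_hullTuples) (fun _ _ => mem_hullTuples)).map_cycles hw) N).2

theorem boundary_pow_sd (k N : ℕ) (z : (tuples E).Chain (k + 1)) :
    (tuples E).boundary k ((sd (k + 1) ^ N) z) = (sd k ^ N) ((tuples E).boundary k z) := by
  induction N with
  | zero => rfl
  | succ N ih =>
    rw [pow_succ', pow_succ', Module.End.mul_apply, Module.End.mul_apply, boundary_sd, ih]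

theorem eventually_pow_sd_mem_hullTuples (hempty : S a ∅) {η : ℝ} (hη : 0 < η) {k : ℕ}
    {w : (tuples E).Chain k}
    (hw : w ∈ Finsupp.supported ℤ ℤ {v : Fin k → E | Set.range v ⊆ P ∧ S a (Set.range v)}) :
    ∀ᶠ N in atTop, (sd k ^ N) w ∈ Finsupp.supported ℤ ℤ
      (hullTuples S P a k ∩ {v | ∀ i j, dist (v i) (v j) ≤ η}) := by
  refine eventually_map_mem_of_mem_supported (fun N => sd k ^ N) (fun v hv => ?_) hw
  cases k with
  | zero =>
    refine Eventually.of_forall fun N => ?_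
    rw [show hullTuples S P a 0 ∩ {v | ∀ i j, dist (v i) (v j) ≤ η} = Set.univ from
      Set.eq_univ_of_forall fun u =>
        ⟨⟨∅, Set.empty_subset _, hempty, fun i => i.elim0⟩, fun i => i.elim0⟩,
      Finsupp.supported_univ]
    trivial
  | succ k =>
    filter_upwards [eventually_pow_sd_mem_smallTuples v hη] with N hN
    exact Finsupp.supported_mono
      (t := hullTuples S P a (k + 1) ∩ {v | ∀ i j, dist (v i) (v j) ≤ η}) (fun u hu => ⟨⟨_, hv.1, hv.2, hu.1⟩, hu.2⟩) hN

theorem eventually_pow_sd_mem_cycles (hempty : S a ∅) {η : ℝ} (hη : 0 < η) {ℓ : ℕ}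
    {w : (tuples E).Chain (ℓ + 1)} (hw : w ∈ (scalePair S P p a b).cycles ℓ) :
    ∀ᶠ N in atTop, (sd (ℓ + 1) ^ N) w ∈ (smallHullPair S P p a b η).cycles ℓ := by
  filter_upwards [eventually_pow_sd_mem_hullTuples hempty hη hw.1,
    eventually_pow_sd_mem_hullTuples hempty hη hw.2] with N h1 h2
  refine ⟨h1, ?_⟩
  rw [SetLike.mem_coe, Submodule.mem_comap, boundary_pow_sd]
  exact h2

end Hull

namespace IsSetting

variable {E : Type} [NormedAddCommGroup E] [InnerProductSpace ℝ E]
  {K P : Set E} {x p : E} {t ε δ α : ℝ} {π f : E → E} {c : ℝ} {S : ℝ → Set E → Prop}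

/-- Moving points of convex hulls to the sample. -/
def hullHom (H : IsSetting K P x p t ε δ α π f) (hS : IsScaleFamily c S) {a a' b b' : ℝ}
    (ha : a + c * a ≤ a') (hb : b' ≤ b - 2 * (c * a)) :
    Pair.Hom (hullPair S P p a b) (scalePair S P p a' b') :=
  have key : ∀ {k : ℕ} {v : Fin k → E} {s : Set E}, s ⊆ P → S a s →
      v ∈ tuplesIn (convexHull ℝ s) k → ∀ i, ∃ u ∈ s, dist (v i) u ≤ c * a ∧
        dist (v i) (f (v i)) ≤ c * a := by
    intro k v s hs hSs hv i
    obtain ⟨u, hu, hvu⟩ := hS.exists_dist_le hSs (hv i)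
    exact ⟨u, hu, hvu, (H.dist_f_le _ u (hs hu)).trans hvu⟩
  have key' : ∀ {k : ℕ} {v : Fin k → E} {s : Set E}, s ⊆ P → S a s →
      v ∈ tuplesIn (convexHull ℝ s) k → S a' (Set.range (f ∘ v)) := by
    intro k v s hs hSs hv
    -- A hull is at the same scale as its simplex, and `f` moves its points by at most `c * a`.
    have := hS.thicken (b := a' - a) (s' := Set.range (f ∘ v)) (hS.convexHull hSs) (by
      rintro _ ⟨i, rfl⟩
      obtain ⟨u, hu, h1, h2⟩ := key hs hSs hv i
      exact ⟨v i, hv i, by rw [dist_comm]; exact h2.trans (by linarith)⟩)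
    rwa [add_sub_cancel] at this
  { toFun := mapTuples f
    comm := boundary_mapTuples f
    total := by
      rintro k v ⟨s, hs, hSs, hv⟩
      rw [mapTuples_single]
      exact single_mem_supported ⟨Set.range_subset_iff.2 fun i => H.f_mem _, key' hs hSs hv⟩
    sub := by
      rintro k v ⟨s, hs, hSs, hv⟩
      rw [mapTuples_single]
      refine single_mem_supported ⟨Set.range_subset_iff.2 fun i => ⟨H.f_mem _, ?_⟩,
        key' (hs.trans Set.sdiff_subset) hSs hv⟩
      obtain ⟨u, hu, h1, h2⟩ := key (hs.trans Set.sdiff_subset) hSs hv i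
      have h3 := (hs hu).2
      rw [Metric.mem_ball, not_lt] at h3 ⊢
      have h4 := dist_triangle4 u (v i) (f (v i)) p
      rw [dist_comm u (v i)] at h4
      change _ ≤ dist (f (v i)) p
      linarith }

theorem mapTuples_eq (H : IsSetting K P x p t ε δ α π f) {a b : ℝ} {ℓ : ℕ}
    {w : (tuples E).Chain (ℓ + 1)} (hw : w ∈ (scalePair S P p a b).cycles ℓ) :
    mapTuples f (ℓ + 1) w = w := by
  refine map_eq_of_mem_supported _ LinearMap.id (fun v hv => ?_) hw.1
  rw [mapTuples_single]
  congr 1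
  funext i
  exact H.f_apply (hv.1 ⟨i, rfl⟩)

/-- Moving small tuples to the sample, or first to `K` and then to the sample, gives the same
homology classes. -/
theorem mapTuples_comp_sub_mem (H : IsSetting K P x p t ε δ α π f) (hS : IsScaleFamily c S)
    {a a' b b' : ℝ} (ha : c * a + (1 + t) * ε ≤ a') (hδ : c * a + δ ≤ a')
    (hb : b' ≤ b - 2 * (c * a) - (1 + t) * ε) {ℓ : ℕ} {w : (tuples E).Chain (ℓ + 1)}
    (hw : w ∈ (smallHullPair S P p a b δ).cycles ℓ) :
    mapTuples (f ∘ π) (ℓ + 1) w - mapTuples f (ℓ + 1) w ∈ (scalePair S P p a' b').boundaries ℓ := by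
  -- Projecting `q` costs at most `c * a + t * ε`, and reaching the sample from there at most `ε -
  -- δ`; the spare `δ` covers the diameter of the tuple.
  have key : ∀ {s : Set E} {q : E}, s ⊆ P → S a s → q ∈ convexHull ℝ s →
      ∃ u ∈ s, dist q u ≤ c * a ∧ dist q (f q) ≤ c * a ∧
        dist q (f (π q)) + δ ≤ c * a + (1 + t) * ε := by
    intro s q hs hSs hq
    obtain ⟨u, hu, hqu⟩ := hS.exists_dist_le hSs hq
    refine ⟨u, hu, hqu, (H.dist_f_le _ u (hs hu)).trans hqu, ?_⟩
    have h1 := H.dist_proj_le (hs hu) q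
    have h2 := H.dist_f_add_le _ (H.tube.mem q)
    have h3 := dist_triangle q (π q) (f (π q))
    linarith
  have key' : ∀ {k : ℕ} {v : Fin k → E} {u : Fin (k + 1) → E}, v ∈ hullTuples S P a k →
      (∀ i j, dist (v i) (v j) ≤ δ) →
      u ∈ tuplesIn (Set.range (f ∘ v) ∪ Set.range ((f ∘ π) ∘ v)) (k + 1) →
      Set.range u ⊆ P ∧ S a' (Set.range u) := by
    rintro k v u ⟨s, hs, hSs, hv⟩ hvδ hu
    -- The tuple `u` has at least one entry, and it comes from an entry of `v`; so `v` is nonempty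
    -- and can supply a centre.
    have hk : ∃ i : Fin k, True := by
      rcases hu 0 with ⟨i, -⟩ | ⟨i, -⟩ <;> exact ⟨i, trivial⟩
    obtain ⟨i₀, -⟩ := hk
    refine ⟨Set.range_subset_iff.2 fun j => ?_, hS.near (v i₀) ?_⟩
    · rcases hu j with ⟨i, hi⟩ | ⟨i, hi⟩ <;> rw [← hi] <;> exact H.f_mem _
    · rintro _ ⟨j, rfl⟩
      rcases hu j with ⟨i, hi⟩ | ⟨i, hi⟩
      · obtain ⟨w, hw, h1, h2, h3⟩ := key hs hSs (hv i)
        have h4 := dist_triangle_left (f (v i)) (v i₀) (v i)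
        rw [← hi]
        change dist (f (v i)) _ ≤ _
        linarith [hvδ i i₀]
      · obtain ⟨w, hw, h1, h2, h3⟩ := key hs hSs (hv i)
        have h4 := dist_triangle_left (f (π (v i))) (v i₀) (v i)
        rw [← hi]
        change dist (f (π (v i))) _ ≤ _
        linarith [hvδ i i₀]
  have : Nonempty E := ⟨0⟩
  refine mapTuples_sub_mem_boundaries (P := smallHullPair S P p a b δ)
    (Q := scalePair S P p a' b') f (f ∘ π)
    (fun k v hv u hu => key' hv.1 hv.2 hu) (fun k v hv u hu => ?_) hw
  obtain ⟨s, hs, hSs, hvs⟩ := hv.1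
  have h := key' ⟨s, hs.trans Set.sdiff_subset, hSs, hvs⟩ hv.2 hu
  refine ⟨fun q hq => ⟨h.1 hq, ?_⟩, h.2⟩
  obtain ⟨j, rfl⟩ := hq
  rw [Metric.mem_ball, not_lt]
  rcases hu j with ⟨i, hi⟩ | ⟨i, hi⟩
  · obtain ⟨w, hw, h1, h2, h3⟩ := key (hs.trans Set.sdiff_subset) hSs (hvs i)
    have h4 := (hs hw).2
    rw [Metric.mem_ball, not_lt] at h4
    have h5 := dist_triangle4 w (v i) (f (v i)) p
    rw [← hi]
    change _ ≤ dist (f (v i)) _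
    have h6 : 0 ≤ (1 + t) * ε := mul_nonneg (by linarith [H.t_nonneg]) H.eps_pos.le
    linarith [dist_comm w (v i)]
  · obtain ⟨w, hw, h1, h2, h3⟩ := key (hs.trans Set.sdiff_subset) hSs (hvs i)
    have h4 := (hs hw).2
    rw [Metric.mem_ball, not_lt] at h4
    have h5 := dist_triangle4 w (v i) (f (π (v i))) p
    rw [← hi]
    change _ ≤ dist (f (π (v i))) _
    linarith [dist_comm w (v i), H.pos]

/-- Relative cycles of the sample come from small relative cycles of `K`. -/
theorem exists_vertexMap_sub_mem (H : IsSetting K P x p t ε δ α π f) (hS : IsScaleFamily c S)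
    {a a' b b' s : ℝ} (hα : c * a + t * ε < α) (hs : s ≤ b - 2 * (c * a) - 2 * (t * ε))
    (ha : c * a + (1 + t) * ε ≤ a') (hδ : c * a + δ ≤ a') (haa : a + c * a ≤ a')
    (hb : b' ≤ b - 2 * (c * a) - (1 + t) * ε) {ℓ : ℕ} {w : (tuples E).Chain (ℓ + 1)}
    (hw : w ∈ (scalePair S P p a b).cycles ℓ) :
    ∃ y ∈ (smallPair K (awayFrom K x s) δ).cycles ℓ,
      vertexMap f (ℓ + 1) y - w ∈ (scalePair S P p a' b').boundaries ℓ := by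
  -- One `N` serves both sides: the subdivided projection is small in `K`, and the subdivided cycle
  -- is small in the hulls. The two correspond because subdivision commutes with `pushChain`.
  obtain ⟨N, h1, h2⟩ := ((eventually_pow_singularSd_mem_cycles H.pos
    ((H.projHom hS hα hs).map_cycles hw)).and
    (eventually_pow_sd_mem_cycles (hS.empty a) H.pos hw)).exists
  refine ⟨_, h1, ?_⟩
  have h3 := (H.hullHom hS haa (b' := b') (by
    have h6 : 0 ≤ (1 + t) * ε := mul_nonneg (by linarith [H.t_nonneg]) H.eps_pos.le
    linarith)).map_boundaries (pow_sd_sub_mem_boundaries hw N)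
  have h4 := H.mapTuples_comp_sub_mem hS ha hδ hb h2
  change mapTuples f (ℓ + 1) _ ∈ _ at h3
  rw [map_sub, H.mapTuples_eq hw] at h3
  change vertexMap f (ℓ + 1) ((singularSd E (ℓ + 1) ^ N) (pushChain π (ℓ + 1) w)) - w ∈ _
  rw [pow_singularSd_pushChain, vertexMap_pushChain]
  -- On the subdivided cycle, `f ∘ π` agrees with `f` up to a boundary; applying `f` gives back `w`
  -- up to a boundary since `f` fixes `P`.
  have := Submodule.add_mem _ h4 h3
  rwa [sub_add_sub_cancel] at this

end IsSetting

/-! ### The image in the homology of the sample -/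

open FaceSystem Filter Topology

section Image

variable {E : Type} [NormedAddCommGroup E] [InnerProductSpace ℝ E]
  {K P : Set E} {x p : E} {t ε δ α : ℝ} {π f : E → E} {c : ℝ} {S : ℝ → Set E → Prop}

theorem IsScaleFamily.mono_scale (hS : IsScaleFamily c S) {a a' : ℝ} (h : a ≤ a') {s : Set E}
    (hs : S a s) : S a' s := by
  have := hS.thicken (b := a' - a) hs fun q hq => ⟨q, hq, by simpa using h⟩
  rwa [add_sub_cancel] at this

theorem IsScaleFamily.scalePair_total_subset (hS : IsScaleFamily c S) (P : Set E) (p : E)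
    {a a' b b' : ℝ} (ha : a ≤ a') (k : ℕ) :
    (scalePair S P p a b).total k ⊆ (scalePair S P p a' b').total k :=
  fun _ hv => ⟨hv.1, hS.mono_scale ha hv.2⟩

theorem IsScaleFamily.scalePair_sub_subset (hS : IsScaleFamily c S) (P : Set E) (p : E)
    {a a' b b' : ℝ} (ha : a ≤ a') (hb : b' ≤ b) (k : ℕ) :
    (scalePair S P p a b).sub k ⊆ (scalePair S P p a' b').sub k :=
  fun _ hv => ⟨hv.1.trans (Set.sdiff_subset_sdiff_right (Metric.ball_subset_ball hb)),
    hS.mono_scale ha hv.2⟩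

/-- The inclusion of small chains away from `x` in the chains which compute local homology. -/
def smallAwayInclusion (K : Set E) (x : E) {s : ℝ} (hs : 0 < s) (δ : ℝ) :
    Pair.Hom (smallPair K (awayFrom K x s) δ) (singularPair K (K \ {x})) :=
  Pair.Hom.ofLE (fun _ _ h => h.1)
    fun k _ h => singularSimplices_mono (awayFrom_subset_diff K x hs) k h.1

/-- The inclusion factors through all singular chains of `K` relative to `awayFrom K x s`;
subdivision handles the first factor and stretching the second. -/
theorem IsSetting.smallAwayInclusion_bijective (H : IsSetting K P x p t ε δ α π f) {s : ℝ}
    (hs : 0 < s) (hsα : s < 2 * α) (ℓ : ℕ) :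
    Function.Bijective ((smallAwayInclusion K x hs δ).map ℓ) := by
  have := (H.tube.away_bijective H.compact H.mem hs hsα ℓ).comp
    (smallInclusion_bijective K (awayFrom K x s) H.pos ℓ)
  convert this using 1
  funext h
  obtain ⟨z, hz, rfl⟩ := Pair.exists_homologyMk h
  rfl

/-- The image of the homology of a sample at a small scale in that at a larger scale is the local
homology. -/
theorem IsSetting.nonempty_range_equiv (H : IsSetting K P x p t ε δ α π f)
    (hS : IsScaleFamily c S) {R r a s₁ s₂ s₃ : ℝ} (ha : ε ≤ a) (hr : r ≤ R)
    (hs₃ : 0 < s₃) (h₃₂ : s₃ ≤ s₂ - 2 * ε) (h₂₁ : s₂ ≤ s₁) (hs₁ : s₁ < 2 * α)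
    (hα : c * a + t * ε < α) (hα' : c * ε + t * ε < α) (hεα : ε < α)
    (hR : R + (1 + t) * ε ≤ s₁) (hs₂ : s₂ ≤ R - 2 * (c * ε) - 2 * (t * ε))
    (hr₂ : r + (1 + t) * ε ≤ s₂) (hs₃r : s₃ ≤ r - 2 * (c * a) - 2 * (t * ε))
    (ha₁ : c * ε + (1 + t) * ε ≤ a) (haδ : c * ε + δ ≤ a) (ha₂ : ε + c * ε ≤ a)
    (hrR : r ≤ R - 2 * (c * ε) - (1 + t) * ε) (ℓ : ℕ) :
    Nonempty (LinearMap.range ((Pair.Hom.ofLE (P := scalePair S P p ε R)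
      (P' := scalePair S P p a r) (hS.scalePair_total_subset P p ha)
      (hS.scalePair_sub_subset P p ha hr)).map ℓ) ≃+ (singularPair K (K \ {x})).Homology ℓ) := by
  have hε := H.eps_pos
  have hs₂0 : 0 < s₂ := by linarith
  have hs₁0 : 0 < s₁ := by linarith
  have hb₃ := H.tube.away_bijective H.compact H.mem hs₃ (by linarith) ℓ
  have hb₂ := H.smallAwayInclusion_bijective hs₂0 (by linarith) ℓ
  have hb₁ := H.smallAwayInclusion_bijective hs₁0 hs₁ ℓ
  set ι := (Pair.Hom.ofLE (P := scalePair S P p ε R) (P' := scalePair S P p a r)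
    (hS.scalePair_total_subset P p ha) (hS.scalePair_sub_subset P p ha hr)).map ℓ with hι
  let g := (H.vertexHom hS (s := s₂) (a := a) (b := r) ha hr₂).map ℓ
  -- Projecting a filling in the sample back to `K` fills the original cycle, but only relative to
  -- the smaller radius `s₃`; this still kills the local homology class.
  have hg : Function.Injective g := by
    rw [injective_iff_map_eq_zero]
    intro h hh
    obtain ⟨z, hz, rfl⟩ := Pair.exists_homologyMk h
    have h1 : vertexMap f (ℓ + 1) z ∈ (scalePair S P p a r).boundaries ℓ :=
      Pair.homologyMk_eq_zero.1 hh
    have h2 : pushChain π (ℓ + 1) (vertexMap f (ℓ + 1) z) ∈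
        (singularPair K (awayFrom K x s₃)).boundaries ℓ :=
      (H.projHom hS hα hs₃r).map_boundaries h1
    have h3 := H.pushChain_vertexMap_sub_mem hεα h₃₂ hz
    have h4 := (Submodule.sub_mem_iff_right _ h2).1 h3
    refine hb₂.1 ?_
    rw [map_zero]
    exact Pair.homologyMk_eq_zero.2 ((Pair.Hom.ofLE (P := singularPair K (awayFrom K x s₃))
      (P' := singularPair K (K \ {x})) (fun _ => subset_rfl)
      (fun k => singularSimplices_mono (awayFrom_subset_diff K x hs₃) k)).map_boundaries h4)
  have hrange : LinearMap.range ι = LinearMap.range g := by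
    ext h
    constructor
    · rintro ⟨h, rfl⟩
      obtain ⟨w, hw, rfl⟩ := Pair.exists_homologyMk h
      obtain ⟨y, hy, hyw⟩ := H.exists_vertexMap_sub_mem hS hα' hs₂ ha₁ haδ ha₂ hrR hw
      exact ⟨(smallPair K (awayFrom K x s₂) δ).homologyMk y hy, Pair.homologyMk_eq.2 hyw⟩
    · rintro ⟨h, rfl⟩
      obtain ⟨h₁, hh₁⟩ := hb₁.2 ((smallAwayInclusion K x hs₂0 δ).map ℓ h)
      obtain ⟨z, hz, rfl⟩ := Pair.exists_homologyMk h
      obtain ⟨z₁, hz₁, rfl⟩ := Pair.exists_homologyMk h₁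
      let i : Pair.Hom (smallPair K (awayFrom K x s₁) δ) (smallPair K (awayFrom K x s₂) δ) :=
        Pair.Hom.ofLE (fun _ => subset_rfl) fun k σ hσ =>
          ⟨singularSimplices_mono (awayFrom_subset_awayFrom K x h₂₁) k hσ.1, hσ.2⟩
      have h1 : (smallPair K (awayFrom K x s₂) δ).homologyMk z₁ (i.map_cycles hz₁) =
          (smallPair K (awayFrom K x s₂) δ).homologyMk z hz := hb₂.1 hh₁
      refine ⟨(H.vertexHom hS (s := s₁) (a := ε) (b := R) le_rfl hR).map ℓ
        ((smallPair K (awayFrom K x s₁) δ).homologyMk z₁ hz₁), ?_⟩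
      rw [← h1]
      rfl
  rw [hrange]
  exact ⟨(LinearEquiv.ofInjective g hg).symm.toAddEquiv.trans
    (LinearEquiv.ofBijective _ hb₂).toAddEquiv⟩

end Image

/-! ### Samples and admissible scales -/

theorem ofReal_half_lt {a : ℝ} {ν : ℝ≥0∞} (h : ENNReal.ofReal a < 2 * ν) :
    ENNReal.ofReal (a / 2) < ν := by
  contrapose! h
  calc 2 * ν ≤ 2 * ENNReal.ofReal (a / 2) := by gcongr
    _ = ENNReal.ofReal a := by
      rw [← ENNReal.ofReal_ofNat, ← ENNReal.ofReal_mul (by norm_num), mul_div_cancel₀]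
      norm_num

/-- Half of the larger of the two bounds is a real number strictly below `ν`, even for infinite `ν`;
it replaces the extended inequalities by real ones. -/
theorem AdmissibleScales.exists_lt_reach {ν : ℝ≥0∞} {c t ε R r : ℝ}
    (h : AdmissibleScales ν c t ε R r) (hc : 0 ≤ c) (ht : 0 ≤ t) (hε : 0 < ε) :
    ∃ m, ENNReal.ofReal m < ν ∧ (2 * betaConst c t + gammaConst c t) * ε ≤ 2 * m ∧
      R + (betaConst c t + t + 1) * ε ≤ 2 * m := by
  have hβ : 0 ≤ betaConst c t := by unfold betaConst; positivity
  have hγ : 0 ≤ gammaConst c t := by unfold gammaConst; positivity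
  have hR : 0 ≤ R := by
    have h1 := h.lt_r
    have h2 := h.r_lt
    have h3 : 0 ≤ gammaConst c t - betaConst c t := by
      unfold gammaConst betaConst
      linarith
    have h4 : 0 ≤ 2 * betaConst c t * ε := by positivity
    have h5 : 0 ≤ (gammaConst c t - betaConst c t) * ε := mul_nonneg h3 hε.le
    linarith
  have h1 := ENNReal.mul_lt_of_lt_div h.eps_lt
  rw [← ENNReal.ofReal_mul hε.le] at h1
  have h2 := lt_tsub_iff_right.1 h.R_lt
  rw [← ENNReal.ofReal_add hR (by positivity)] at h2
  refine ⟨max (ε * (2 * betaConst c t + gammaConst c t) / 2)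
    ((R + (betaConst c t + t + 1) * ε) / 2), ?_, ?_, ?_⟩
  · rcases max_choice (ε * (2 * betaConst c t + gammaConst c t) / 2)
      ((R + (betaConst c t + t + 1) * ε) / 2) with h3 | h3 <;> rw [h3]
    exacts [ofReal_half_lt h1, ofReal_half_lt h2]
  · linarith [le_max_left (ε * (2 * betaConst c t + gammaConst c t) / 2)
      ((R + (betaConst c t + t + 1) * ε) / 2)]
  · linarith [le_max_right (ε * (2 * betaConst c t + gammaConst c t) / 2)
      ((R + (betaConst c t + t + 1) * ε) / 2)]

theorem noise_nonneg {X : Type} (K P : Set X) : 0 ≤ noise K P := by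
  unfold noise
  split_ifs <;> norm_num

section Sample

variable {E : Type} [NormedAddCommGroup E] [InnerProductSpace ℝ E] {K P : Set E} {x p : E}
  {ε : ℝ}

theorem IsSample.exists_setting (hP : IsSample K P ε) (hK : IsCompact K) (hp : p ∈ P)
    (hx : IsBasePoint K P ε p x) {α : ℝ} {π : E → E} (hπ : IsTube K α π) :
    ∃ δ f, IsSetting K P x p (noise K P) ε δ α π f := by
  choose f hf hfd using fun q => hP.finite.isCompact.exists_infDist_eq_dist ⟨p, hp⟩ q
  have hfle : ∀ q, ∀ v ∈ P, dist q (f q) ≤ dist q v :=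
    fun q v hv => hfd q ▸ Metric.infDist_le_dist_of_mem hv
  -- A number strictly between the Hausdorff distance and `ε` turns the strict sampling bound into a
  -- uniform slack `δ = ε - e`.
  obtain ⟨e, he, heε⟩ := ENNReal.lt_iff_exists_nnreal_btwn.1 hP.dist_lt
  rw [← ENNReal.ofReal_coe_nnreal] at he heε
  have heε' := (ENNReal.ofReal_lt_ofReal_iff'.1 heε).1
  have hdist : ∀ {u v : E} {d : ℝ}, edist u v < ENNReal.ofReal d → dist u v < d := by
    intro u v d h
    rw [edist_dist] at h
    exact (ENNReal.ofReal_lt_ofReal_iff'.1 h).1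
  refine ⟨ε - e, f, hπ, hK, hx.1, ?_, noise_nonneg K P, sub_pos.2 heε', hf, hfle, ?_, ?_⟩
  · unfold noise
    split_ifs with h
    · simpa using hx.2.1 h p (h hp)
    · simpa using (hx.2.2 h).le
  · intro y hy
    obtain ⟨v, hv, hyv⟩ := Metric.exists_edist_lt_of_hausdorffEDist_lt hy he
    linarith [hfle y v hv, hdist hyv]
  · intro v hv
    unfold noise
    split_ifs with h
    · simp [Metric.infDist_zero_of_mem (h hv)]
    · obtain ⟨y, hy, hvy⟩ := Metric.exists_edist_lt_of_hausdorffEDist_lt hv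
        (Metric.hausdorffEDist_comm.trans_lt hP.dist_lt)
      rw [one_mul]
      exact (Metric.infDist_le_dist_of_mem hy).trans (hdist hvy).le

/-- The image of the homology of a sample at the scale `ε`, for admissible scales. -/
theorem IsClosedSubmanifold.nonempty_range_equiv [FiniteDimensional ℝ E]
    (hK : IsClosedSubmanifold K) (hP : IsSample K P ε) (hp : p ∈ P)
    (hx : IsBasePoint K P ε p x) {c : ℝ} (hc : 0 ≤ c) {S : ℝ → Set E → Prop}
    (hS : IsScaleFamily c S) {R r : ℝ} (h : AdmissibleScales (reach K) c (noise K P) ε R r)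
    (ha : ε ≤ (1 + c + noise K P) * ε) (hr : r ≤ R) (ℓ : ℕ) :
    Nonempty (LinearMap.range ((Pair.Hom.ofLE (P := scalePair S P p ε R)
      (P' := scalePair S P p ((1 + c + noise K P) * ε) r) (hS.scalePair_total_subset P p ha)
      (hS.scalePair_sub_subset P p ha hr)).map ℓ) ≃+ (singularPair K (K \ {x})).Homology ℓ) := by
  have ht := noise_nonneg K P
  obtain ⟨m, hm, hm₁, hm₂⟩ := h.exists_lt_reach hc ht hP.pos
  obtain ⟨α, π, hmα, hπ⟩ := hK.exists_tube ⟨x, hx.1⟩ hm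
  obtain ⟨δ, f, H⟩ := hP.exists_setting hK.isCompact hp hx hπ
  generalize noise K P = t at *
  have hε := hP.pos
  have hcε : 0 ≤ c * ε := by positivity
  have htε : 0 ≤ t * ε := by positivity
  -- At the large scale `a = (1 + c + t) * ε`, the number `β * ε` is exactly the bound `c * a + t *
  -- ε` on the distance from a hull to `K`.
  have hβ : c * ((1 + c + t) * ε) + t * ε = betaConst c t * ε := by unfold betaConst; ring
  have hβ0 : 0 ≤ betaConst c t * ε := by unfold betaConst; positivity
  have hγ : gammaConst c t * ε = betaConst c t * ε + 2 * (c * ε) + 4 * (t * ε) + 2 * ε := by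
    unfold gammaConst betaConst; ring
  have h1 := h.lt_r
  have h2 := h.r_lt
  have hδ := H.dist_f_add_le x hx.1
  have hδ' := dist_nonneg (x := x) (y := f x)
  -- `s₁` is the least radius from which the vertex map reaches `R`; `s₂` and `s₃` are the largest
  -- radii kept by projecting from `(ε, R)` and `(a, r)`. Then `s₃ = r - 2 * β * ε` is positive, `s₁
  -- < 2 * α` follows from the upper bound on `R`, and `γ - β = 2 * c + 4 * t + 2` leaves room for
  -- the remaining losses.
  exact H.nonempty_range_equiv hS (s₁ := R + (1 + t) * ε) (s₂ := R - 2 * (c * ε) - 2 * (t * ε))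
    (s₃ := r - 2 * (c * ((1 + c + t) * ε)) - 2 * (t * ε)) ha hr (by linarith) (by linarith)
    (by linarith) (by linarith) (by linarith) (by linarith) (by linarith) le_rfl le_rfl
    (by linarith) le_rfl (by linarith) (by linarith) (by linarith) (by linarith) ℓ

end Sample

/-- An additive equivalence of abelian groups is linear over the integers. -/
def intLinearEquiv {A B : Type} [AddCommGroup A] [AddCommGroup B] [Module ℤ A] [Module ℤ B]
    (e : A ≃+ B) : A ≃ₗ[ℤ] B where
  __ := e
  map_smul' n a := by simpa using map_intCast_smul e ℤ ℤ n a

theorem AdmissibleScales.le {ν : ℝ≥0∞} {c t ε R r : ℝ} (h : AdmissibleScales ν c t ε R r)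
    (hc : 0 ≤ c) (ht : 0 ≤ t) (hε : 0 < ε) : r ≤ R := by
  have h1 : 0 ≤ (gammaConst c t - betaConst c t) * ε := by
    refine mul_nonneg ?_ hε.le
    unfold gammaConst betaConst
    linarith
  linarith [h.r_lt]

theorem le_scale {c t ε : ℝ} (hc : 0 ≤ c) (ht : 0 ≤ t) (hε : 0 < ε) :
    ε ≤ (1 + c + t) * ε := by
  nlinarith

end LocalHomology

end

/-! ### The theorem for Čech and Vietoris–Rips complexes. -/

theorem mainTheorem7 (n : ℕ) (K P : Set (EuclideanSpace ℝ (Fin n))) (ε : ℝ)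
    (hK : LocalHomology.IsClosedSubmanifold K) (hP : LocalHomology.IsSample K P ε)
    (p : EuclideanSpace ℝ (Fin n)) (hp : p ∈ P)
    (x : K) (hx : LocalHomology.IsBasePoint K P ε p x)
    (t : ℝ) (ht : t = LocalHomology.noise K P) :
    (∀ R r : ℝ, LocalHomology.AdmissibleScales (LocalHomology.reach K) 1 t ε R r →
      ∃ h : LocalHomology.cechPair P p ε R ≤ LocalHomology.cechPair P p ((1 + 1 + t) * ε) r,
        ∀ ℓ : ℕ, Nonempty
          (LinearMap.range (LocalHomology.ComplexPair.homologyMap h ℓ).hom ≃ₗ[ℤ]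
            LocalHomology.relativeSingularHomology K {x}ᶜ ℓ)) ∧
    (∀ R r : ℝ, LocalHomology.AdmissibleScales (LocalHomology.reach K) (√2) t ε R r →
      ∃ h : LocalHomology.ripsPair P p ε R ≤ LocalHomology.ripsPair P p ((1 + √2 + t) * ε) r,
        ∀ ℓ : ℕ, Nonempty
          (LinearMap.range (LocalHomology.ComplexPair.homologyMap h ℓ).hom ≃ₗ[ℤ]
            LocalHomology.relativeSingularHomology K {x}ᶜ ℓ)) := by
  have hc₂ : 0 ≤ √2 := Real.sqrt_nonneg 2
  have hA : Subtype.val '' ({x}ᶜ : Set K) = K \ {x.1} := by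
    ext y
    constructor
    · rintro ⟨y, hy, rfl⟩
      exact ⟨y.2, fun h => hy (Subtype.ext h)⟩
    · rintro ⟨hy, hyx⟩
      exact ⟨⟨y, hy⟩, fun h => hyx (congrArg Subtype.val h), rfl⟩
  have key : ∀ ℓ, Nonempty ((LocalHomology.singularPair K (K \ {x.1})).Homology ℓ ≃+
      LocalHomology.relativeSingularHomology K {x}ᶜ ℓ) := fun ℓ =>
    ⟨((LocalHomology.singularModel K {x}ᶜ hA).homologyEquiv ℓ).toAddEquiv⟩
  subst ht
  have ht := LocalHomology.noise_nonneg K P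
  refine ⟨fun R r h => ?_, fun R r h => ?_⟩
  · have ha := LocalHomology.le_scale zero_le_one ht hP.pos
    have hr := h.le zero_le_one ht hP.pos
    refine ⟨LocalHomology.cechPair_le P p ha hr, fun ℓ => ?_⟩
    obtain ⟨e₁⟩ := LocalHomology.IsOrderedPair.rangeEquiv (LocalHomology.cechPair_le P p ha hr)
      (LocalHomology.isOrderedPair_cech P p ε R) (LocalHomology.isOrderedPair_cech P p _ r)
      (LocalHomology.isScaleFamily_cech.scalePair_total_subset P p ha)
      (LocalHomology.isScaleFamily_cech.scalePair_sub_subset P p ha hr) ℓ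
    obtain ⟨e₂⟩ := hK.nonempty_range_equiv hP hp hx zero_le_one
      LocalHomology.isScaleFamily_cech h ha hr ℓ
    obtain ⟨e₃⟩ := key ℓ
    exact ⟨LocalHomology.intLinearEquiv (e₁.trans (e₂.trans e₃))⟩
  · have ha := LocalHomology.le_scale hc₂ ht hP.pos
    have hr := h.le hc₂ ht hP.pos
    refine ⟨LocalHomology.ripsPair_le P p ha hr, fun ℓ => ?_⟩
    obtain ⟨e₁⟩ := LocalHomology.IsOrderedPair.rangeEquiv (LocalHomology.ripsPair_le P p ha hr)
      (LocalHomology.isOrderedPair_rips P p hP.pos.le R)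
      (LocalHomology.isOrderedPair_rips P p (hP.pos.le.trans ha) r)
      (LocalHomology.isScaleFamily_rips.scalePair_total_subset P p ha)
      (LocalHomology.isScaleFamily_rips.scalePair_sub_subset P p ha hr) ℓ
    obtain ⟨e₂⟩ := hK.nonempty_range_equiv hP hp hx hc₂
      LocalHomology.isScaleFamily_rips h ha hr ℓ
    obtain ⟨e₃⟩ := key ℓ
    exact ⟨LocalHomology.intLinearEquiv (e₁.trans (e₂.trans e₃))⟩
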